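/- All graphs are finite, simple and connected; $d$ is the graph distance, and $d(s,vw)=\min\{d(s,v),d(s,w)\}$ for a vertex $s$ and an edge $vw$. A set $S\subseteq V(G)$ is a vertex (edge) metric generator if for any two distinct vertices (edges) $x,y$ there is $s\in S$ with $d(s,x)\ne d(s,y)$; $\dim(G)$ ($\mathrm{edim}(G)$) is the smallest size of such a set. A cactus is a connected graph whose cycles are pairwise edge disjoint. **Threads.** A thread of length $k\ge 1$ hanging at a vertex $v$ of degree $\ge 3$ is a path $u_1\cdots u_k$ such that $u_1$ is a leaf, $u_2,\dots,u_k$ have degree $2$, and $u_k$ is adjacent to $v$. Let $\ell(v)$ be the number of threads hanging at $v$ and $L(G)=\sum_{\ell(v)>1}(\ell(v)-1)$. A thread is $S$-free if it contains no vertex of $S$. A set $S\subseteq V(G)$ is branch-resolving if at most one $S$-free thread hangs at every vertex of degree $\ge 3$. **Activity.** For a vertex $v$ of a cycle $C$ let $T_v(C)$ be the component of $G-E(C)$ containing $v$. The vertex $v$ is branch-active on $C$ if $\deg(v)\ge 4$ or $T_v(C)$ contains a vertex of degree $\ge 3$ other than $v$; $b(C)$ is the number of branch-active vertices on $C$, and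 $B(G)=\sum_C\max\{0,2-b(C)\}$, the sum being over all cycles of $G$. The vertex $v$ is $S$-active on $C$ if $T_v(C)$ contains a vertex of $S$; $a_S(C)$ is the number of $S$-active vertices on $C$. The set $S$ is biactive if $a_S(C)\ge 2$ for every cycle $C$. A smallest biactive branch-resolving set is one of minimum cardinality. **Configurations.** Let $S$ be a biactive branch-resolving set and $C$ a cycle of length $g$. A labelling $C=v_0v_1\cdots v_{g-1}$ is canonical if $v_0$ is $S$-active and $k=\max\{i: v_i\text{ is }S\text{-active}\}$ is as small as possible. With respect to $S$ the canonically labelled cycle $C$ contains configuration - $\mathcal A$ if $a_S(C)=2$, $g$ is even and $k=g/2$; - $\mathcal B$ if $k\le\lfloor g/2\rfloor-1$ and an $S$-free thread hangs at $v_i$ for some $i\in[k,\lfloor g/2\rfloor-1]\cup[\lceil g/2\rceil+k+1,g-1]\cup\{0\}$; - $\mathcal C$ if $a_S(C)=2$, $g$ is even, $k\le g/2$ and an $S$-free thread of length $\ge g/2-k$ hangs at $v_i$ for some $i\in[0,k]$; - $\mathcal D$ if $k\le\lceil g/2\rceil-1$ and an $S$-free thread hangs at $v_i$ for some $i\in[k,\lceil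 g/2\rceil-1]\cup[\lfloor g/2\rfloor+k+1,g-1]\cup\{0\}$; - $\mathcal E$ if $a_S(C)=2$ and an $S$-free thread of length $\ge\lfloor g/2\rfloor-k+1$ hangs at $v_i$ for some $i\in[0,k]$ such that moreover, if $g$ is even, an $S$-free thread hangs at $v_j$ with $j=g/2+k-i$ (where $v_g=v_0$). A cycle is $\mathcal{ABC}$-negative ($\mathcal{ADE}$-negative) if there is a smallest biactive branch-resolving set with respect to which it contains none of $\mathcal A,\mathcal B,\mathcal C$ (none of $\mathcal A,\mathcal D,\mathcal E$), and positive otherwise; $c_{\mathcal{ABC}}(G)$ and $c_{\mathcal{ADE}}(G)$ are the numbers of positive cycles. **Critical incidence.** An $S$-path of $C$ is a shortest subpath of $C$ containing all $S$-active vertices of $C$. A vertex is vertex-critical (edge-critical) on $C$ with respect to $S$ if it is an end-vertex of an $S$-path of $C$ of length at most $\lfloor g/2\rfloor-1$ (at most $\lceil g/2\rceil-1$). Two distinct cycles are vertex-critically (edge-critically) incident with respect to $S$ if they share a vertex which is vertex-critical (edge-critical) on both. A smallest biactive branch-resolving set $S$ is vertex-nice (edge-nice) if no $\mathcal{ABC}$-negative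 ($\mathcal{ADE}$-negative) cycle contains any of $\mathcal A,\mathcal B,\mathcal C$ (any of $\mathcal A,\mathcal D,\mathcal E$) with respect to $S$ and, among all smallest biactive branch-resolving sets with this property, $S$ has the smallest number of vertex-critically (edge-critically) incident pairs of cycles. For a vertex-nice (edge-nice) set $S$, the graph $G_{vi}$ (the graph $G_{ei}$) has the cycles of $G$ as vertices, two being adjacent if both are $\mathcal{ABC}$-negative and they are vertex-critically incident (both are $\mathcal{ADE}$-negative and they are edge-critically incident) with respect to $S$. Finally, $\tau$ denotes the vertex cover number. **Theorem.** Let $G$ be a cactus graph. Vertex-nice sets and edge-nice sets exist in $G$. If $G$ is not a path with at least two vertices, then for every vertex-nice set $S$ used to define $G_{vi}$, $$\dim(G)=L(G)+B(G)+c_{\mathcal{ABC}}(G)+\tau(G_{vi}).$$ If $G$ is not a path with at least three vertices, then for every edge-nice set $S$ used to define $G_{ei}$, $$\mathrm{edim}(G)=L(G)+B(G)+c_{\mathcal{ADE}}(G)+\tau(G_{ei}).$$ -/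

import Mathlib

namespace Cactus

section Dimensions

variable {V : Type*} [Fintype V] (G : SimpleGraph V)

/-- The distance between a vertex `s` and an edge `vw`, the minimum of `d(s,v)` and `d(s,w)`. -/
noncomputable def edgeDist (s : V) (e : Sym2 V) : ℕ :=
  Sym2.lift ⟨fun v w => min (G.dist s v) (G.dist s w), fun _ _ => min_comm _ _⟩ e

/-- `S` is a vertex metric generator. -/
def IsVertexGenerator (S : Finset V) : Prop :=
  ∀ u v : V, u ≠ v → ∃ s ∈ S, G.dist s u ≠ G.dist s v

/-- `S` is an edge metric generator. -/
def IsEdgeGenerator (S : Finset V) : Prop :=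
  ∀ e ∈ G.edgeSet, ∀ f ∈ G.edgeSet, e ≠ f → ∃ s ∈ S, edgeDist G s e ≠ edgeDist G s f

/-- The vertex metric dimension (the whole vertex set is always a generator). -/
noncomputable def dim : ℕ := sInf {n | ∃ S : Finset V, IsVertexGenerator G S ∧ S.card = n}

/-- The edge metric dimension (the whole vertex set is always a generator). -/
noncomputable def edim : ℕ := sInf {n | ∃ S : Finset V, IsEdgeGenerator G S ∧ S.card = n}

end Dimensions

section Cycles

variable {V : Type*}

/-- The cycles of `G`, as subgraphs (no base point, no orientation). -/
def Cycle (G : SimpleGraph V) : Type _ :=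
  {C : G.Subgraph // ∃ (u : V) (w : G.Walk u u), w.IsCycle ∧ w.toSubgraph = C}

noncomputable instance [Fintype V] (G : SimpleGraph V) : Fintype (Cycle G) :=
  haveI : Finite (Cycle G) := by unfold Cycle; infer_instance
  Fintype.ofFinite _

/-- A cactus: a connected graph whose cycles are pairwise edge disjoint. -/
def IsCactus (G : SimpleGraph V) : Prop :=
  G.Connected ∧ ∀ C D : Cycle G, C ≠ D → Disjoint C.1.edgeSet D.1.edgeSet

variable {G : SimpleGraph V}

/-- The length `g` of a cycle. -/
noncomputable def Cycle.len (C : Cycle G) : ℕ := C.1.verts.ncard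

/-- The vertex set of `T_v(C)`, the connected component of `G - E(C)` that contains `v`. -/
def Cycle.comp (C : Cycle G) (v : V) : Set V :=
  {x | (G.deleteEdges C.1.edgeSet).Reachable v x}

/-- A labelling `C = v_0 v_1 ⋯ v_{g-1}`: a closed walk that goes once around `C`. -/
structure Labelling (C : Cycle G) where
  start : V
  walk : G.Walk start start
  isCycle : walk.IsCycle
  toSubgraph_eq : walk.toSubgraph = C.1

/-- The vertex `v_i` of a labelling. -/
def Labelling.vert {C : Cycle G} (lab : Labelling C) (i : ℕ) : V := lab.walk.getVert i

/-- `v` is an `S`-active vertex of `C`. -/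
def Cycle.IsActive (C : Cycle G) (S : Finset V) (v : V) : Prop :=
  v ∈ C.1.verts ∧ ∃ s ∈ S, s ∈ C.comp v

/-- `a_S(C)`, the number of `S`-active vertices on `C`. -/
noncomputable def Cycle.numActive (C : Cycle G) (S : Finset V) : ℕ :=
  {v | C.IsActive S v}.ncard

/-- `S` is biactive. -/
def IsBiactive (G : SimpleGraph V) (S : Finset V) : Prop :=
  ∀ C : Cycle G, 2 ≤ C.numActive S

/-- `v_0` is `S`-active and `k` is the largest index of an `S`-active vertex. -/
def Labelling.HasMaxActive {C : Cycle G} (lab : Labelling C) (S : Finset V) (k : ℕ) : Prop :=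
  C.IsActive S (lab.vert 0) ∧ IsGreatest {i | i < C.len ∧ C.IsActive S (lab.vert i)} k

/-- The labelling is canonical with respect to `S`, and `k` is the largest index of an `S`-active
vertex: `v_0` is `S`-active and `k` is as small as possible among all such labellings. -/
def Labelling.IsCanonical {C : Cycle G} (lab : Labelling C) (S : Finset V) (k : ℕ) : Prop :=
  lab.HasMaxActive S k ∧ ∀ (lab' : Labelling C) (k' : ℕ), lab'.HasMaxActive S k' → k ≤ k'

/-- The walk `p` is a subpath of `C` that contains all `S`-active vertices of `C`. -/
def Cycle.IsCoveringPath (C : Cycle G) (S : Finset V) {a b : V} (p : G.Walk a b) : Prop :=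
  p.IsPath ∧ p.toSubgraph ≤ C.1 ∧ ∀ v, C.IsActive S v → v ∈ p.support

/-- The walk `p` is an `S`-path of `C`. -/
def Cycle.IsSPath (C : Cycle G) (S : Finset V) {a b : V} (p : G.Walk a b) : Prop :=
  C.IsCoveringPath S p ∧
    ∀ (a' b' : V) (q : G.Walk a' b'), C.IsCoveringPath S q → p.length ≤ q.length

/-- The two variants, vertex and edge. -/
inductive Kind
  | vertex
  | edge

/-- `⌊g/2⌋ - 1` in the vertex variant, `⌈g/2⌉ - 1` in the edge variant (here `g ≥ 3`). -/
def Kind.critBound : Kind → ℕ → ℕ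
  | .vertex, g => g / 2 - 1
  | .edge, g => (g + 1) / 2 - 1

/-- `v` is vertex-critical (edge-critical) on `C`: it is an end-vertex of an `S`-path `P` with
`|P| ≤ ⌊g/2⌋ - 1` (`|P| ≤ ⌈g/2⌉ - 1`). -/
def Cycle.IsCritical (C : Cycle G) (κ : Kind) (S : Finset V) (v : V) : Prop :=
  ∃ (b : V) (p : G.Walk v b), C.IsSPath S p ∧ p.length ≤ κ.critBound C.len

/-- The graph on the cycles of `G` in which two distinct cycles are adjacent when they are
vertex-critically (edge-critically) incident with respect to `S`. -/
def criticalGraph (G : SimpleGraph V) (κ : Kind) (S : Finset V) : SimpleGraph (Cycle G) where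
  Adj C D := C ≠ D ∧ ∃ v, C.IsCritical κ S v ∧ D.IsCritical κ S v
  symm := ⟨fun _ _ h => ⟨h.1.symm, h.2.imp fun _ hv => ⟨hv.2, hv.1⟩⟩⟩
  loopless := ⟨fun _ h => h.1 rfl⟩

end Cycles

section Threads

variable {V : Type*} [Fintype V] (G : SimpleGraph V) [DecidableRel G.Adj]

/-- The list `l = [u_1, …, u_k]` is a thread hanging at the vertex `v` of degree at least `3`:
a path in which `u_1` is a leaf, `u_2, …, u_k` have degree `2`, and `u_k` is adjacent to `v`.
The length of the thread is `k`. -/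
def IsThread (v : V) (l : List V) : Prop :=
  3 ≤ G.degree v ∧ l.Nodup ∧ (l ++ [v]).IsChain G.Adj ∧
    ∃ (u : V) (t : List V), l = u :: t ∧ G.degree u = 1 ∧ ∀ x ∈ t, G.degree x = 2

/-- `l` is an `S`-free thread hanging at `v`. -/
def IsFreeThread (S : Finset V) (v : V) (l : List V) : Prop :=
  IsThread G v l ∧ ∀ x ∈ l, x ∉ S

/-- `ℓ(v)`, the number of threads hanging at `v`. -/
noncomputable def numThreads (v : V) : ℕ := {l | IsThread G v l}.ncard

/-- `L(G)`, the sum of `ℓ(v) - 1` over the vertices with `ℓ(v) > 1`. -/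
noncomputable def surplusThreads : ℕ := ∑ v with 1 < numThreads G v, (numThreads G v - 1)

/-- `S` is branch-resolving: at most one `S`-free thread hangs at every vertex of degree `≥ 3`. -/
def IsBranchResolving (S : Finset V) : Prop :=
  ∀ v, {l | IsFreeThread G S v l}.Subsingleton

/-- `S` is a smallest biactive branch-resolving set. -/
def IsSmallestBBR (S : Finset V) : Prop :=
  (IsBiactive G S ∧ IsBranchResolving G S) ∧
    ∀ S' : Finset V, IsBiactive G S' ∧ IsBranchResolving G S' → S.card ≤ S'.card

variable {G}

/-- `v` is a branch-active vertex of `C`. -/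
def Cycle.IsBranchActive (C : Cycle G) (v : V) : Prop :=
  v ∈ C.1.verts ∧ (4 ≤ G.degree v ∨ ∃ x ∈ C.comp v, x ≠ v ∧ 3 ≤ G.degree x)

/-- `b(C)`, the number of branch-active vertices on `C`. -/
noncomputable def Cycle.numBranchActive (C : Cycle G) : ℕ := {v | C.IsBranchActive v}.ncard

/-- `B(G)`, the sum of `max {0, 2 - b(C)}` (truncated subtraction) over all cycles. -/
noncomputable def missingBranchActive (G : SimpleGraph V) [DecidableRel G.Adj] : ℕ :=
  ∑ C : Cycle G, (2 - C.numBranchActive)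

/-- Configuration `𝒜` on the labelled cycle. -/
def Labelling.ConfigA {C : Cycle G} (_lab : Labelling C) (S : Finset V) (k : ℕ) : Prop :=
  C.numActive S = 2 ∧ Even C.len ∧ k = C.len / 2

/-- Configuration `ℬ` on the labelled cycle. -/
def Labelling.ConfigB {C : Cycle G} (lab : Labelling C) (S : Finset V) (k : ℕ) : Prop :=
  k ≤ C.len / 2 - 1 ∧ ∃ i l, IsFreeThread G S (lab.vert i) l ∧
    ((k ≤ i ∧ i ≤ C.len / 2 - 1) ∨ ((C.len + 1) / 2 + k + 1 ≤ i ∧ i ≤ C.len - 1) ∨ i = 0)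

/-- Configuration `𝒞` on the labelled cycle; the thread has length at least `g/2 - k`. -/
def Labelling.ConfigC {C : Cycle G} (lab : Labelling C) (S : Finset V) (k : ℕ) : Prop :=
  C.numActive S = 2 ∧ Even C.len ∧ k ≤ C.len / 2 ∧
    ∃ i l, i ≤ k ∧ IsFreeThread G S (lab.vert i) l ∧ C.len / 2 - k ≤ l.length

/-- Configuration `𝒟` on the labelled cycle. -/
def Labelling.ConfigD {C : Cycle G} (lab : Labelling C) (S : Finset V) (k : ℕ) : Prop :=
  k ≤ (C.len + 1) / 2 - 1 ∧ ∃ i l, IsFreeThread G S (lab.vert i) l ∧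
    ((k ≤ i ∧ i ≤ (C.len + 1) / 2 - 1) ∨ (C.len / 2 + k + 1 ≤ i ∧ i ≤ C.len - 1) ∨ i = 0)

/-- Configuration `ℰ` on the labelled cycle; the thread at `v_i` has length at least
`⌊g/2⌋ - k + 1`, written without subtraction. -/
def Labelling.ConfigE {C : Cycle G} (lab : Labelling C) (S : Finset V) (k : ℕ) : Prop :=
  C.numActive S = 2 ∧
    ∃ i l, i ≤ k ∧ IsFreeThread G S (lab.vert i) l ∧ C.len / 2 + 1 ≤ l.length + k ∧
      (Even C.len → ∃ l', IsFreeThread G S (lab.vert (C.len / 2 + k - i)) l')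

/-- `C`, canonically labelled, contains one of the configurations `𝒜, ℬ, 𝒞` (vertex variant)
or one of `𝒜, 𝒟, ℰ` (edge variant) with respect to `S`. -/
def Cycle.ContainsConfig (C : Cycle G) (κ : Kind) (S : Finset V) : Prop :=
  ∃ (lab : Labelling C) (k : ℕ), lab.IsCanonical S k ∧
    match κ with
    | .vertex => lab.ConfigA S k ∨ lab.ConfigB S k ∨ lab.ConfigC S k
    | .edge => lab.ConfigA S k ∨ lab.ConfigD S k ∨ lab.ConfigE S k

/-- `C` is `𝒜ℬ𝒞`-negative (vertex variant) or `𝒜𝒟ℰ`-negative (edge variant). -/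
def Cycle.IsNegative (C : Cycle G) (κ : Kind) : Prop :=
  ∃ S : Finset V, IsSmallestBBR G S ∧ ¬ C.ContainsConfig κ S

variable (G)

/-- The number of positive cycles: `c_{𝒜ℬ𝒞}(G)` or `c_{𝒜𝒟ℰ}(G)`. -/
noncomputable def numPositive (κ : Kind) : ℕ := {C : Cycle G | ¬ C.IsNegative κ}.ncard

/-- `S` is a smallest biactive branch-resolving set for which every negative cycle avoids the
configurations. -/
def AvoidsConfigs (κ : Kind) (S : Finset V) : Prop :=
  IsSmallestBBR G S ∧ ∀ C : Cycle G, C.IsNegative κ → ¬ C.ContainsConfig κ S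

/-- `S` is nice: it avoids the configurations on all negative cycles and has, among all such
sets, the smallest number of critically incident pairs of cycles. -/
def IsNice (κ : Kind) (S : Finset V) : Prop :=
  AvoidsConfigs G κ S ∧ ∀ S' : Finset V, AvoidsConfigs G κ S' →
    (criticalGraph G κ S).edgeSet.ncard ≤ (criticalGraph G κ S').edgeSet.ncard

/-- The vertex-incident graph `G_vi` or the edge-incident graph `G_ei` with respect to `S`: two
cycles are adjacent when both are negative and they are critically incident. -/
def incidentGraph (κ : Kind) (S : Finset V) : SimpleGraph (Cycle G) where
  Adj C D := C.IsNegative κ ∧ D.IsNegative κ ∧ (criticalGraph G κ S).Adj C D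
  symm := ⟨fun _ _ h => ⟨h.2.1, h.1, h.2.2.symm⟩⟩
  loopless := ⟨fun _ h => h.2.2.ne rfl⟩

end Threads

end Cactus

/-!
In a cactus every vertex `x` has a unique root on each cycle, through which all distances from the
cycle to `x` pass, so whether `S` distinguishes two vertices or edges with different roots on a
cycle is decided by the positions of the active vertices and the heights of the two objects above
their roots. Two neighbours lying behind one vertex as seen from all of `S` are never distinguished;
they come from two free threads at a vertex, a cycle with fewer than two active vertices, a free
thread at a critical vertex, or a critical incidence. The only other obstructions are symmetries of
a cycle with exactly two active vertices, which the remaining configurations describe. Hence, unless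
the graph is a path, the metric generators are the biactive branch-resolving sets without
configurations and critical incidences.

These sets are counted cell by cell: the threads at one vertex form a cell, and so does the part of
the graph hanging at the branch-inactive vertices of one cycle. The cells are disjoint, each demands
a certain number of elements of `S`, the demands sum up to `L(G) + B(G)`, and a smallest biactive
branch-resolving set meets them exactly, so such sets can be recombined cell by cell. Starting from
a nice set, one more vertex on every positive cycle and on every cycle of a minimum vertex cover,
almost antipodal to an active one, removes all configurations and critical incidences. Conversely,
in a metric generator every positive cycle can be charged to a cell that exceeds its demand, and the
other cycles charged in this way cover the incidence graph of the nice set, since by minimality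
critical incidences of that set cannot be avoided by recombination.
-/

namespace Cactus

open SimpleGraph

/-! ### Labellings and parametrizations of a cycle -/

section Parametrization

variable {V : Type*} {G : SimpleGraph V}

theorem toSubgraph_adj_iff_getVert {u v x y : V} {w : G.Walk u v} :
    w.toSubgraph.Adj x y ↔ ∃ i < w.length,
      (x = w.getVert i ∧ y = w.getVert (i + 1)) ∨ (x = w.getVert (i + 1) ∧ y = w.getVert i) := by
  rw [Walk.toSubgraph_adj_iff]
  refine exists_congr fun i => ?_
  rw [Sym2.eq_iff, and_comm]
  grind

variable {C : Cycle G}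

/-- The map `c : ℤ → V` winds around the cycle `C`, meeting each vertex once per period. Indexing
by all integers, rather than by `0, …, g - 1` as in a `Labelling`, lets cycles be shifted and
reflected without wrap-around cases. -/
structure Cycle.IsParam (C : Cycle G) (c : ℤ → V) : Prop where
  eq_iff : ∀ i j, c i = c j ↔ (C.len : ℤ) ∣ i - j
  mem_iff : ∀ v, v ∈ C.1.verts ↔ ∃ i, c i = v
  adj_iff : ∀ x y, C.1.Adj x y ↔ ∃ i, (x = c i ∧ y = c (i + 1)) ∨ (x = c (i + 1) ∧ y = c i)

namespace Labelling

theorem mem_verts_iff_length (lab : Labelling C) {v : V} :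
    v ∈ C.1.verts ↔ ∃ i < lab.walk.length, lab.vert i = v := by
  rw [← lab.toSubgraph_eq, Walk.mem_verts_toSubgraph, Walk.mem_support_iff_exists_getVert]
  constructor
  · rintro ⟨i, rfl, hi⟩
    rcases hi.lt_or_eq with hlt | rfl
    · exact ⟨i, hlt, rfl⟩
    · exact ⟨0, by linarith [lab.isCycle.three_le_length], by simp [vert]⟩
  · rintro ⟨i, hi, rfl⟩
    exact ⟨i, rfl, hi.le⟩

theorem length_eq (lab : Labelling C) : lab.walk.length = C.len := by
  have hverts : C.1.verts = lab.walk.getVert '' {i | i ≤ lab.walk.length - 1} := by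
    ext v
    rw [lab.mem_verts_iff_length]
    have h3 := lab.isCycle.three_le_length
    exact ⟨fun ⟨i, hi, h⟩ => ⟨i, Nat.le_sub_one_of_lt hi, h⟩,
      fun ⟨i, hi, h⟩ => ⟨i, by grind, h⟩⟩
  rw [Cycle.len, hverts, lab.isCycle.getVert_injOn'.ncard_image]
  change _ = (Set.Iic (lab.walk.length - 1)).ncard
  rw [Set.ncard_Iic_nat, Nat.sub_add_cancel (by linarith [lab.isCycle.three_le_length])]

theorem mem_verts_iff (lab : Labelling C) {v : V} :
    v ∈ C.1.verts ↔ ∃ i < C.len, lab.vert i = v :=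
  lab.length_eq ▸ lab.mem_verts_iff_length

theorem adj_iff (lab : Labelling C) {x y : V} :
    C.1.Adj x y ↔ ∃ i < C.len,
      (x = lab.vert i ∧ y = lab.vert (i + 1)) ∨ (x = lab.vert (i + 1) ∧ y = lab.vert i) := by
  rw [← lab.length_eq, ← lab.toSubgraph_eq]
  exact toSubgraph_adj_iff_getVert

theorem vert_len (lab : Labelling C) : lab.vert C.len = lab.vert 0 := by
  simp [vert, ← lab.length_eq]

theorem vert_inj (lab : Labelling C) {i j : ℕ} (hi : i < C.len) (hj : j < C.len) :
    lab.vert i = lab.vert j ↔ i = j := by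
  rw [← lab.length_eq] at hi hj
  exact ⟨fun h => lab.isCycle.getVert_injOn' (Nat.le_sub_one_of_lt hi) (Nat.le_sub_one_of_lt hj) h,
    fun h => h ▸ rfl⟩

/-- The labelling `v_0 ⋯ v_{g-1}`, extended to the integers with period `g`. -/
noncomputable def param (lab : Labelling C) (i : ℤ) : V := lab.vert (i % C.len).toNat

end Labelling

theorem Cycle.nonempty_labelling (C : Cycle G) : Nonempty (Labelling C) :=
  let ⟨_, _, w, hw, h⟩ := C
  ⟨⟨_, w, hw, h⟩⟩

theorem Cycle.three_le_len (C : Cycle G) : 3 ≤ C.len := by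
  obtain ⟨lab⟩ := C.nonempty_labelling
  exact lab.length_eq ▸ lab.isCycle.three_le_length

theorem Cycle.len_pos (C : Cycle G) : (0 : ℤ) < C.len := by
  have := C.three_le_len
  omega

namespace Labelling

theorem param_natCast (lab : Labelling C) {i : ℕ} (hi : i ≤ C.len) : lab.param i = lab.vert i := by
  rcases hi.lt_or_eq with hlt | rfl
  · rw [param, ← Int.natCast_mod, Int.toNat_natCast, Nat.mod_eq_of_lt hlt]
  · rw [param, Int.emod_self, Int.toNat_zero, lab.vert_len]

theorem exists_param_eq_vert (lab : Labelling C) (i : ℤ) :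
    ∃ m < C.len, (C.len : ℤ) ∣ i - m ∧
      lab.param i = lab.vert m ∧ lab.param (i + 1) = lab.vert (m + 1) := by
  obtain ⟨m, hm⟩ := Int.eq_ofNat_of_zero_le (Int.emod_nonneg i C.len_pos.ne')
  have hlt : m < C.len := by exact_mod_cast hm ▸ Int.emod_lt_of_pos i C.len_pos
  have hsucc : (i + 1) % C.len = ((m + 1 : ℕ) : ℤ) % C.len := by
    rw [Nat.cast_add, Nat.cast_one, ← Int.emod_add_emod, hm]
  refine ⟨m, hlt, hm ▸ Int.dvd_self_sub_emod, by rw [param, hm, Int.toNat_natCast], ?_⟩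
  rw [← lab.param_natCast hlt, param, hsucc, param]

theorem isParam_param (lab : Labelling C) : C.IsParam lab.param where
  eq_iff i j := by
    obtain ⟨m, hm, hdm, him, -⟩ := lab.exists_param_eq_vert i
    obtain ⟨l, hl, hdl, hjl, -⟩ := lab.exists_param_eq_vert j
    rw [him, hjl, lab.vert_inj hm hl]
    constructor
    · rintro rfl
      simpa using dvd_sub hdm hdl
    · intro h
      have hml : (C.len : ℤ) ∣ m - l := by
        simpa using (h.sub hdm).add hdl
      have := Int.eq_zero_of_abs_lt_dvd hml (by rw [abs_lt]; omega)
      omega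
  mem_iff v := by
    rw [lab.mem_verts_iff]
    constructor
    · rintro ⟨i, hi, rfl⟩
      exact ⟨i, lab.param_natCast hi.le⟩
    · rintro ⟨i, rfl⟩
      obtain ⟨m, hm, -, him, -⟩ := lab.exists_param_eq_vert i
      exact ⟨m, hm, him.symm⟩
  adj_iff x y := by
    rw [lab.adj_iff]
    constructor
    · rintro ⟨i, hi, h⟩
      refine ⟨i, ?_⟩
      rwa [lab.param_natCast hi.le, ← Nat.cast_succ, lab.param_natCast hi]
    · rintro ⟨i, h⟩
      obtain ⟨m, hm, -, him, him'⟩ := lab.exists_param_eq_vert i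
      exact ⟨m, hm, by rwa [him, him'] at h⟩

end Labelling

theorem Cycle.exists_isParam (C : Cycle G) : ∃ c, C.IsParam c :=
  let ⟨lab⟩ := C.nonempty_labelling
  ⟨_, lab.isParam_param⟩

namespace Cycle.IsParam

variable {c : ℤ → V}

theorem shift (hc : C.IsParam c) (a : ℤ) : C.IsParam fun i => c (a + i) where
  eq_iff i j := by rw [hc.eq_iff, add_sub_add_left_eq_sub]
  mem_iff v := by
    rw [hc.mem_iff]
    exact ⟨fun ⟨i, h⟩ => ⟨i - a, by simpa using h⟩, fun ⟨i, h⟩ => ⟨_, h⟩⟩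
  adj_iff x y := by
    rw [hc.adj_iff]
    exact ⟨fun ⟨i, h⟩ => ⟨i - a, by simpa [← add_assoc] using h⟩,
      fun ⟨i, h⟩ => ⟨a + i, by simpa [← add_assoc] using h⟩⟩

theorem reflect (hc : C.IsParam c) (a : ℤ) : C.IsParam fun i => c (a - i) where
  eq_iff i j := by rw [hc.eq_iff, sub_sub_sub_cancel_left, dvd_sub_comm]
  mem_iff v := by
    rw [hc.mem_iff]
    exact ⟨fun ⟨i, h⟩ => ⟨a - i, by simpa using h⟩, fun ⟨i, h⟩ => ⟨_, h⟩⟩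
  adj_iff x y := by
    rw [hc.adj_iff]
    constructor <;> rintro ⟨i, h⟩ <;> refine ⟨a - i - 1, ?_⟩
    · rw [show a - (a - i - 1) = i + 1 by ring, show a - (a - i - 1 + 1) = i by ring]
      exact h.symm
    · rw [sub_add_cancel, sub_sub]
      exact h.symm

theorem mem (hc : C.IsParam c) (i : ℤ) : c i ∈ C.1.verts := (hc.mem_iff _).2 ⟨i, rfl⟩

theorem adj_succ (hc : C.IsParam c) (i : ℤ) : C.1.Adj (c i) (c (i + 1)) :=
  (hc.adj_iff _ _).2 ⟨i, Or.inl ⟨rfl, rfl⟩⟩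

theorem adj_pred (hc : C.IsParam c) (i : ℤ) : C.1.Adj (c i) (c (i - 1)) := by
  simpa using (hc.adj_succ (i - 1)).symm

theorem add_len (hc : C.IsParam c) (i : ℤ) : c (i + C.len) = c i :=
  (hc.eq_iff _ _).2 (by simp)

theorem inj (hc : C.IsParam c) {i j : ℤ} (h : c i = c j) (h1 : i - j < C.len)
    (h2 : j - i < C.len) : i = j :=
  sub_eq_zero.1 <| Int.eq_zero_of_abs_lt_dvd ((hc.eq_iff i j).1 h) (by rw [abs_lt]; omega)

theorem exists_rep (hc : C.IsParam c) (a : ℤ) {v : V} (hv : v ∈ C.1.verts) :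
    ∃ i, a ≤ i ∧ i < a + C.len ∧ c i = v := by
  obtain ⟨i, rfl⟩ := (hc.mem_iff v).1 hv
  have hnonneg := Int.emod_nonneg (i - a) C.len_pos.ne'
  have hlt := Int.emod_lt_of_pos (i - a) C.len_pos
  refine ⟨a + (i - a) % C.len, by omega, by omega, ?_⟩
  rw [hc.eq_iff, dvd_sub_comm, ← sub_sub]
  exact Int.dvd_self_sub_emod

theorem adj_cases (hc : C.IsParam c) {i : ℤ} {y : V} (h : C.1.Adj (c i) y) :
    y = c (i + 1) ∨ y = c (i - 1) := by
  obtain ⟨j, ⟨hi, rfl⟩ | ⟨hi, rfl⟩⟩ := (hc.adj_iff _ _).1 h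
  · refine Or.inl ((hc.eq_iff _ _).2 ?_)
    rw [add_sub_add_right_eq_sub, dvd_sub_comm]
    exact (hc.eq_iff _ _).1 hi
  · refine Or.inr ((hc.eq_iff _ _).2 ?_)
    rw [dvd_sub_comm, sub_sub, add_comm 1]
    exact (hc.eq_iff _ _).1 hi

theorem exists_arc (hc : C.IsParam c) (a : ℤ) (m : ℕ) :
    ∃ p : G.Walk (c a) (c (a + m)), p.length = m ∧ ∀ t : ℕ, t ≤ m → p.getVert t = c (a + t) := by
  induction m with
  | zero => exact ⟨Walk.nil.copy rfl (by simp), by simp, fun t ht => by simp [Nat.le_zero.1 ht]⟩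
  | succ m ih =>
    obtain ⟨p, hp, hp'⟩ := ih
    have hadj : G.Adj (c (a + m)) (c (a + m + 1)) := (hc.adj_succ _).adj_sub
    refine ⟨(p.concat hadj).copy rfl (by push_cast; ring_nf), by simp [hp], fun t ht => ?_⟩
    rw [Walk.getVert_copy, Walk.concat_eq_append, Walk.getVert_append, hp]
    split_ifs with h
    · exact hp' t h.le
    · obtain rfl | rfl : t = m ∨ t = m + 1 := by omega
      · simp
      · simp [add_assoc]

theorem mem_iff_exists_lt (hc : C.IsParam c) {v : V} :
    v ∈ C.1.verts ↔ ∃ i < C.len, c (i : ℕ) = v := by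
  constructor
  · intro hv
    obtain ⟨i, h0, h1, hi⟩ := hc.exists_rep 0 hv
    lift i to ℕ using h0
    exact ⟨i, by omega, hi⟩
  · rintro ⟨i, -, rfl⟩
    exact hc.mem i

theorem adj_iff_exists_lt (hc : C.IsParam c) {x y : V} :
    C.1.Adj x y ↔ ∃ i < C.len,
      (x = c (i : ℕ) ∧ y = c (i + 1 : ℕ)) ∨ (x = c (i + 1 : ℕ) ∧ y = c (i : ℕ)) := by
  rw [hc.adj_iff]
  constructor
  · rintro ⟨i, h⟩
    obtain ⟨j, hj, hji⟩ := hc.mem_iff_exists_lt.1 (hc.mem i)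
    have hsucc : c (j + 1 : ℕ) = c (i + 1) := by
      rw [hc.eq_iff] at hji ⊢
      rwa [Nat.cast_succ, add_sub_add_right_eq_sub]
    exact ⟨j, hj, by rwa [hji, hsucc]⟩
  · rintro ⟨i, -, h⟩
    exact ⟨i, by exact_mod_cast h⟩

theorem exists_isCycle (hc : C.IsParam c) :
    ∃ w : G.Walk (c 0) (c 0), w.IsCycle ∧ w.length = C.len ∧
      ∀ t : ℕ, t ≤ C.len → w.getVert t = c t := by
  have h3 := C.three_le_len
  obtain ⟨p, hp, hp'⟩ := hc.exists_arc 0 C.len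
  set w : G.Walk (c 0) (c 0) := p.copy rfl (hc.add_len 0) with hw
  have hlen : w.length = C.len := by simp [hw, hp]
  have hvert : ∀ t : ℕ, t ≤ C.len → w.getVert t = c t := fun t ht => by
    rw [hw, Walk.getVert_copy, hp' t ht, zero_add]
  refine ⟨w, ?_, hlen, hvert⟩
  rw [Walk.isCycle_iff_isPath_tail_and_le_length, ← Walk.IsPath.getVert_injOn_iff]
  refine ⟨fun i hi j hj h => ?_, by omega⟩
  have htail : w.tail.length + 1 = w.length := Walk.length_tail_add_one (by
    rw [← Walk.length_eq_zero_iff]; omega)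
  simp only [Set.mem_ofPred_eq] at hi hj
  rw [Walk.getVert_tail, Walk.getVert_tail, hvert _ (by omega), hvert _ (by omega)] at h
  have := hc.inj h (by omega) (by omega)
  omega

theorem exists_labelling (hc : C.IsParam c) : ∃ lab : Labelling C, lab.param = c := by
  obtain ⟨w, hcyc, hlen, hvert⟩ := hc.exists_isCycle
  refine ⟨⟨c 0, w, hcyc, SimpleGraph.Subgraph.ext ?_ ?_⟩, funext fun i => ?_⟩
  · ext v
    rw [Walk.mem_verts_toSubgraph, Walk.mem_support_iff_exists_getVert]
    constructor
    · rintro ⟨i, rfl, hi⟩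
      exact hvert i (hlen ▸ hi) ▸ hc.mem _
    · intro hv
      obtain ⟨i, hi, rfl⟩ := hc.mem_iff_exists_lt.1 hv
      exact ⟨i, hvert i hi.le, hlen ▸ hi.le⟩
  · ext x y
    rw [toSubgraph_adj_iff_getVert, hc.adj_iff_exists_lt, hlen]
    refine exists_congr fun i => and_congr_right fun hi => ?_
    rw [hvert _ hi.le, hvert _ hi]
  · have hnonneg := Int.emod_nonneg i C.len_pos.ne'
    have hlt := Int.emod_lt_of_pos i C.len_pos
    refine (hvert _ (by omega)).trans ?_
    rw [Int.toNat_of_nonneg hnonneg, hc.eq_iff, dvd_sub_comm]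
    exact Int.dvd_self_sub_emod

end Cycle.IsParam

theorem Cycle.exists_isParam_zero {v : V} (hv : v ∈ C.1.verts) : ∃ c, C.IsParam c ∧ c 0 = v := by
  obtain ⟨c, hc⟩ := C.exists_isParam
  obtain ⟨i, hi⟩ := (hc.mem_iff v).1 hv
  exact ⟨_, hc.shift i, by simpa using hi⟩

theorem Cycle.exists_isParam_zero_one {v y : V} (h : C.1.Adj v y) :
    ∃ c, C.IsParam c ∧ c 0 = v ∧ c 1 = y := by
  obtain ⟨c, hc, rfl⟩ := Cycle.exists_isParam_zero h.fst_mem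
  rcases hc.adj_cases h with rfl | rfl
  · exact ⟨c, hc, rfl, by simp⟩
  · exact ⟨_, hc.reflect 0, by simp, by simp⟩

theorem Cycle.exists_isParam_eq_getVert {a b : V} {p : G.Walk a b} (hp : p.IsPath)
    (hpC : p.toSubgraph ≤ C.1) :
    ∃ c, C.IsParam c ∧ ∀ t : ℕ, t ≤ p.length → p.getVert t = c t := by
  have hadj : ∀ t < p.length, C.1.Adj (p.getVert t) (p.getVert (t + 1)) := fun t ht =>
    hpC.2 (p.toSubgraph_adj_getVert ht)
  rcases Nat.eq_zero_or_pos p.length with hlen | hlen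
  · obtain ⟨c, hc, h0⟩ := Cycle.exists_isParam_zero (C := C) (v := a) (hpC.1 (by simp))
    exact ⟨c, hc, fun t ht => by simp [Nat.le_zero.1 (hlen ▸ ht), h0]⟩
  -- The first edge fixes the direction; a path cannot turn back, so it keeps to it.
  obtain ⟨c, hc, h0, h1⟩ := Cycle.exists_isParam_zero_one (hadj 0 hlen)
  refine ⟨c, hc, fun t => ?_⟩
  induction t using Nat.strong_induction_on with
  | _ t ih =>
    intro ht
    match t with
    | 0 => simpa using h0.symm
    | 1 => simpa using h1.symm
    | m + 2 =>
      have hm : p.getVert m = c m := ih m (by omega) (by omega)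
      have hstep := hadj (m + 1) (by omega)
      rw [ih (m + 1) (by omega) (by omega)] at hstep
      rcases hc.adj_cases hstep with h | h
      · rw [h]; push_cast; ring_nf
      · rw [Nat.cast_succ, add_sub_cancel_right, ← hm] at h
        have := hp.getVert_injOn (by simp; omega) (by simp; omega) h
        omega

end Parametrization

/-! ### Distances through a cut vertex -/

section Distance

variable {V : Type*} {G : SimpleGraph V}

theorem dist_eq_add_of_gate (hconn : G.Connected) {K : Set V} {a : V}
    (hK : ∀ y z, G.Adj y z → y ∈ K → z ∉ K → y = a) {s x : V} (hs : s ∈ K) (hx : x ∉ K) :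
    G.dist s x = G.dist s a + G.dist a x := by
  classical
  refine le_antisymm hconn.dist_triangle ?_
  obtain ⟨p, hp⟩ := hconn.exists_walk_length_eq_dist s x
  obtain ⟨d, hd, hfst, hsnd⟩ := p.exists_boundary_dart K hs hx
  have ha : a ∈ p.support := hK _ _ d.adj hfst hsnd ▸ Walk.dart_fst_mem_support_of_mem_darts p hd
  calc G.dist s a + G.dist a x
      ≤ (p.takeUntil a ha).length + (p.dropUntil a ha).length := add_le_add (dist_le _) (dist_le _)
    _ = G.dist s x := by rw [← Walk.length_append, p.take_spec, hp]

theorem le_add_dist_of_lipschitz (hconn : G.Connected) {φ : V → ℤ}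
    (hφ : ∀ x y, G.Adj x y → φ y ≤ φ x + 1) (s x : V) : φ x ≤ φ s + G.dist s x := by
  obtain ⟨p, hp⟩ := hconn.exists_walk_length_eq_dist s x
  rw [← hp]
  clear hp
  induction p with
  | nil => simp
  | cons h q ih =>
    have := hφ _ _ h
    rw [Walk.length_cons]
    omega

theorem dist_le_dist_add_one (hconn : G.Connected) {x y : V} (h : G.Adj x y) (s : V) :
    G.dist s y ≤ G.dist s x + 1 :=
  dist_eq_one_iff_adj.2 h ▸ hconn.dist_triangle

theorem exists_adj_dist_eq (hconn : G.Connected) {u x : V} {m : ℕ} (h : G.dist u x = m + 1) :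
    ∃ y, G.Adj y x ∧ G.dist u y = m := by
  obtain ⟨p, hp⟩ := hconn.exists_walk_length_eq_dist u x
  have hadj := p.adj_getVert_succ (i := m) (by omega)
  rw [show m + 1 = p.length by omega, Walk.getVert_length] at hadj
  have htake := dist_le (p.take m)
  rw [Walk.take_length] at htake
  have := dist_le_dist_add_one hconn hadj u
  exact ⟨_, hadj, by omega⟩

end Distance

/-! ### The components of `G - E(C)` -/

section Components

variable {V : Type*} {G : SimpleGraph V} {C : Cycle G}

namespace Cycle

theorem deleteEdges_adj_iff {x y : V} :
    (G.deleteEdges C.1.edgeSet).Adj x y ↔ G.Adj x y ∧ ¬ C.1.Adj x y := by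
  rw [deleteEdges_adj, Subgraph.mem_edgeSet]

theorem mem_comp_self (C : Cycle G) (v : V) : v ∈ C.comp v := Reachable.refl _

theorem mem_comp_of_adj {v x y : V} (hx : x ∈ C.comp v) (h : G.Adj x y)
    (hC : ¬ C.1.Adj x y) : y ∈ C.comp v :=
  Reachable.trans hx (Adj.reachable (deleteEdges_adj_iff.2 ⟨h, hC⟩))

namespace IsParam

variable {c : ℤ → V}

theorem edge_inj (hc : C.IsParam c) {i j : ℤ} (h : s(c i, c (i + 1)) = s(c j, c (j + 1)))
    (h1 : i - j < C.len) (h2 : j - i < C.len) : i = j := by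
  rcases Sym2.eq_iff.1 h with ⟨hij, -⟩ | ⟨hij, hji⟩
  · exact hc.inj hij h1 h2
  · have h3 := C.three_le_len
    have hdvd := dvd_sub ((hc.eq_iff _ _).1 hji) ((hc.eq_iff _ _).1 hij)
    have := Int.eq_zero_of_abs_lt_dvd hdvd (by rw [abs_lt]; omega)
    omega

theorem reachable {H : SimpleGraph V} {i j : ℤ} (hij : i ≤ j)
    (hH : ∀ t, i ≤ t → t < j → H.Adj (c t) (c (t + 1))) : H.Reachable (c i) (c j) := by
  induction j, hij using Int.leInduction with
  | base => rfl
  | succ j hij ih =>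
    exact (ih fun t h1 h2 => hH t h1 (by omega)).trans (hH j hij (by omega)).reachable

end IsParam

theorem exists_nbrs {v : V} (hv : v ∈ C.1.verts) :
    ∃ x y, x ≠ y ∧ C.1.Adj v x ∧ C.1.Adj v y ∧ ∀ z, C.1.Adj v z → z = x ∨ z = y := by
  obtain ⟨c, hc, rfl⟩ := exists_isParam_zero hv
  have h3 := C.three_le_len
  refine ⟨c (0 + 1), c (0 - 1), fun h => ?_, hc.adj_succ 0, hc.adj_pred 0,
    fun z hz => hc.adj_cases hz⟩
  have := hc.inj h (by omega) (by omega)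
  omega

end Cycle

theorem isBridge_iff_forall_cycle_not_adj {x y : V} (h : G.Adj x y) :
    G.IsBridge s(x, y) ↔ ∀ C : Cycle G, ¬ C.1.Adj x y := by
  rw [isBridge_iff_forall_cycle_notMem (by simpa using h)]
  constructor
  · rintro hb ⟨_, u, w, hw, rfl⟩ hadj
    exact hb w hw (by rwa [← Subgraph.mem_edgeSet, Walk.mem_edges_toSubgraph] at hadj)
  · intro hb u w hw hmem
    exact hb ⟨_, u, w, hw, rfl⟩ (by rwa [← Subgraph.mem_edgeSet, Walk.mem_edges_toSubgraph])

namespace IsCactus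

theorem eq_of_mem_edgeSet (hG : IsCactus G) {C D : Cycle G} {e : Sym2 V} (hC : e ∈ C.1.edgeSet)
    (hD : e ∈ D.1.edgeSet) : C = D := by
  by_contra h
  exact Set.disjoint_left.1 (hG.2 C D h) hC hD

theorem eq_of_adj (hG : IsCactus G) {C D : Cycle G} {x y : V} (hC : C.1.Adj x y)
    (hD : D.1.Adj x y) : C = D :=
  hG.eq_of_mem_edgeSet (Subgraph.mem_edgeSet.2 hC) (Subgraph.mem_edgeSet.2 hD)

theorem isBridge_deleteEdges (hG : IsCactus G) {e f : Sym2 V} (he : e ∈ C.1.edgeSet)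
    (hf : f ∈ C.1.edgeSet) (hef : f ≠ e) : (G.deleteEdges {e}).IsBridge f := by
  have hf' : f ∈ (G.deleteEdges {e}).edgeSet := by
    rw [edgeSet_deleteEdges]
    exact ⟨C.1.edgeSet_subset hf, hef⟩
  rw [isBridge_iff_forall_cycle_notMem hf']
  intro u p hp hfp
  let D : Cycle G := ⟨_, u, p.mapLe (deleteEdges_le _), (Walk.isCycle_mapLe _).2 hp, rfl⟩
  have hD : ∀ e', e' ∈ D.1.edgeSet ↔ e' ∈ p.edges := fun e' => by
    simp only [D, Walk.mem_edges_toSubgraph, Walk.edges_mapLe_eq_edges]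
  have hep : e ∈ p.edges := (hD e).1 (hG.eq_of_mem_edgeSet hf ((hD f).2 hfp) ▸ he)
  have := p.edges_subset_edgeSet hep
  rw [edgeSet_deleteEdges] at this
  exact this.2 rfl

theorem eq_of_mem_comp (hG : IsCactus G) {u w : V} (hu : u ∈ C.1.verts)
    (hw : w ∈ C.1.verts) (h : w ∈ C.comp u) : w = u := by
  obtain ⟨c, hc, rfl⟩ := Cycle.exists_isParam_zero hu
  obtain ⟨j, hj0, hj1, rfl⟩ := hc.exists_rep 0 hw
  have h3 := C.three_le_len
  by_contra hne
  have hj : 0 < j := lt_of_le_of_ne hj0 (by rintro rfl; exact hne rfl)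
  -- Without its two `C`-edges at `c 0`, the vertex `c 0` is cut off from `c 1`, hence from `c j`.
  have hne_edge : ∀ t : ℤ, -1 < t → t < j → s(c t, c (t + 1)) ≠ s(c (-1), c (-1 + 1)) :=
    fun t h1 h2 he => by have := hc.edge_inj he (by omega) (by omega); omega
  have hbridge := hG.isBridge_deleteEdges (hc.adj_succ (-1)) (hc.adj_succ 0)
    (hne_edge 0 (by omega) hj)
  rw [isBridge_iff, deleteEdges_deleteEdges] at hbridge
  have harc : (G.deleteEdges ({s(c (-1), c (-1 + 1))} ∪ {s(c 0, c (0 + 1))})).Reachable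
      (c (0 + 1)) (c j) := Cycle.IsParam.reachable (by omega) fun t h1 h2 => by
    refine deleteEdges_adj.2 ⟨(hc.adj_succ t).adj_sub, ?_⟩
    rintro (he | he)
    · exact hne_edge t (by omega) h2 he
    · have := hc.edge_inj he (by omega) (by omega)
      omega
  refine hbridge ((Reachable.mono (deleteEdges_anti ?_) h).trans harc.symm)
  rintro e (rfl | rfl)
  · exact Subgraph.mem_edgeSet.2 (hc.adj_succ (-1))
  · exact Subgraph.mem_edgeSet.2 (hc.adj_succ 0)

theorem exists_mem_comp (hG : IsCactus G) (C : Cycle G) (x : V) :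
    ∃ v ∈ C.1.verts, x ∈ C.comp v := by
  obtain ⟨v₀, hv₀⟩ : C.1.verts.Nonempty :=
    let ⟨_, hc⟩ := C.exists_isParam
    ⟨_, hc.mem 0⟩
  obtain ⟨p⟩ := hG.1.preconnected x v₀
  induction p with
  | nil => exact ⟨_, hv₀, C.mem_comp_self _⟩
  | @cons x y _ hxy _ ih =>
    by_cases hC : C.1.Adj x y
    · exact ⟨x, hC.fst_mem, C.mem_comp_self _⟩
    · obtain ⟨v, hv, hy⟩ := ih hv₀
      exact ⟨v, hv, Cycle.mem_comp_of_adj hy hxy.symm fun h => hC h.symm⟩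

end IsCactus

open Classical in
/-- The vertex of the cycle `C` whose component of `G - E(C)` contains `x`; it exists in a connected
graph and is unique in a cactus. The value `x` is a placeholder in all other cases. -/
noncomputable def Cycle.root (C : Cycle G) (x : V) : V :=
  if h : ∃ v ∈ C.1.verts, x ∈ C.comp v then h.choose else x

namespace IsCactus

theorem root_mem_and_mem_comp (hG : IsCactus G) (C : Cycle G) (x : V) :
    C.root x ∈ C.1.verts ∧ x ∈ C.comp (C.root x) := by
  rw [Cycle.root, dif_pos (hG.exists_mem_comp C x)]
  exact (hG.exists_mem_comp C x).choose_spec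

theorem root_mem (hG : IsCactus G) (C : Cycle G) (x : V) : C.root x ∈ C.1.verts :=
  (hG.root_mem_and_mem_comp C x).1

theorem mem_comp_root (hG : IsCactus G) (C : Cycle G) (x : V) : x ∈ C.comp (C.root x) :=
  (hG.root_mem_and_mem_comp C x).2

theorem mem_comp_iff (hG : IsCactus G) {v x : V} (hv : v ∈ C.1.verts) :
    x ∈ C.comp v ↔ C.root x = v := by
  refine ⟨fun h => hG.eq_of_mem_comp hv (hG.root_mem C x) ?_, ?_⟩
  · exact Reachable.trans h (hG.mem_comp_root C x).symm
  · rintro rfl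
    exact hG.mem_comp_root C x

theorem root_self (hG : IsCactus G) {v : V} (hv : v ∈ C.1.verts) : C.root v = v :=
  (hG.mem_comp_iff hv).1 (C.mem_comp_self v)

theorem root_eq_of_adj (hG : IsCactus G) {x y : V} (h : G.Adj x y) (h' : ¬ C.1.Adj x y) :
    C.root y = C.root x :=
  (hG.mem_comp_iff (hG.root_mem C x)).1 (Cycle.mem_comp_of_adj (hG.mem_comp_root C x) h h')

theorem dist_eq_of_root_ne (hG : IsCactus G) {s x : V} (h : C.root s ≠ C.root x) :
    G.dist s x = G.dist s (C.root s) + G.dist (C.root s) x := by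
  refine dist_eq_add_of_gate hG.1 (K := {y | C.root y = C.root s}) ?_ rfl h.symm
  intro y z hyz hy hz
  by_cases hC : C.1.Adj y z
  · exact (hG.root_self hC.fst_mem).symm.trans hy
  · exact absurd ((hG.root_eq_of_adj hyz hC).trans hy) hz

theorem dist_eq_of_mem (hG : IsCactus G) {s v : V} (hv : v ∈ C.1.verts) :
    G.dist s v = G.dist s (C.root s) + G.dist (C.root s) v := by
  by_cases h : C.root s = v
  · simp [h]
  · exact hG.dist_eq_of_root_ne (by rwa [hG.root_self hv])

variable {c : ℤ → V}

theorem exists_index_root (hG : IsCactus G) (hc : C.IsParam c) (a : ℤ) :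
    ∃ m : V → ℤ, (∀ x, a ≤ m x ∧ m x < a + C.len ∧ c (m x) = C.root x) ∧
      ∀ x y, G.Adj x y → |m x - m y| ≤ 1 ∨ |m x - m y| = C.len - 1 := by
  choose m ha hlt hroot using fun x => hc.exists_rep a (hG.root_mem C x)
  have hinj : ∀ x t, a ≤ t → t < a + C.len → c t = C.root x → m x = t := fun x t h1 h2 h =>
    hc.inj ((hroot x).trans h.symm) (by linarith [hlt x]) (by linarith [ha x])
  have hsucc : ∀ i, m (c (i + 1)) = m (c i) + 1 ∨
      (m (c (i + 1)) = a ∧ m (c i) = a + C.len - 1) := by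
    intro i
    have hi : c (m (c i) + 1) = C.root (c (i + 1)) := by
      have hmi := (hroot (c i)).trans (hG.root_self (hc.mem i))
      rw [hG.root_self (hc.mem _), hc.eq_iff, add_sub_add_right_eq_sub]
      exact (hc.eq_iff _ _).1 hmi
    have hai := ha (c i)
    rcases lt_or_ge (m (c i) + 1) (a + C.len) with h | h
    · exact Or.inl (hinj _ _ (by omega) h hi)
    · have heq : m (c i) + 1 = a + C.len := by linarith [hlt (c i)]
      refine Or.inr ⟨hinj _ _ le_rfl (by linarith [C.len_pos]) ?_, by omega⟩
      rw [← hi, heq, hc.add_len]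
  have h3 := C.three_le_len
  refine ⟨m, fun x => ⟨ha x, hlt x, hroot x⟩, fun x y hxy => ?_⟩
  by_cases hC : C.1.Adj x y
  · obtain ⟨i, ⟨rfl, rfl⟩ | ⟨rfl, rfl⟩⟩ := (hc.adj_iff x y).1 hC <;>
      rcases hsucc i with h | h <;> grind
  · have := hinj y (m x) (ha x) (hlt x) ((hroot x).trans (hG.root_eq_of_adj hxy hC).symm)
    simp [this]

theorem dist_param (hG : IsCactus G) (hc : C.IsParam c) {i j : ℤ} (hij : i ≤ j)
    (hji : j ≤ i + C.len) : (G.dist (c i) (c j) : ℤ) = min (j - i) (C.len - (j - i)) := by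
  have hle_arc : ∀ a b, a ≤ b → (G.dist (c a) (c b) : ℤ) ≤ b - a := fun a b hab => by
    obtain ⟨p, hp, -⟩ := hc.exists_arc a (b - a).toNat
    have := dist_le p
    rw [hp, show a + ((b - a).toNat : ℤ) = b by omega] at this
    omega
  refine le_antisymm (le_min (hle_arc i j hij) ?_) ?_
  · have := hle_arc j (i + C.len) hji
    rw [hc.add_len, SimpleGraph.dist_comm] at this
    omega
  obtain ⟨m, hm, hadj⟩ := hG.exists_index_root hc i
  have hindex : ∀ t, i ≤ t → t < i + C.len → m (c t) = t := fun t h1 h2 =>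
    hc.inj ((hm _).2.2.trans (hG.root_self (hc.mem t)))
      (by linarith [(hm (c t)).2.1]) (by linarith [(hm (c t)).1])
  -- The distance of `C.root x` from `c i` along `C` is a 1-Lipschitz function of `x`.
  have hlip := le_add_dist_of_lipschitz hG.1 (φ := fun x => min (m x - i) (C.len - (m x - i)))
    (fun x y hxy => by
      have := hm x
      have := hm y
      have := hadj x y hxy
      grind) (c i) (c j)
  simp only [hindex i le_rfl (by linarith [C.len_pos])] at hlip
  rcases hji.lt_or_eq with hlt | rfl
  · rw [hindex j hij hlt] at hlip
    omega
  · omega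

end IsCactus

end Components

/-! ### Branches at a vertex -/

section Branch

variable {V : Type*} {G : SimpleGraph V}

/-- The branch at `v` towards `z`: the vertices that can be reached from `z` without passing
through `v`. -/
def branch (G : SimpleGraph V) (v z : V) : Set V := {x | ∃ p : G.Walk z x, v ∉ p.support}

theorem mem_branch_self {v z : V} (h : z ≠ v) : z ∈ branch G v z :=
  ⟨Walk.nil, by simpa using h.symm⟩

theorem ne_of_mem_branch {v z x : V} (h : x ∈ branch G v z) : x ≠ v := by
  rintro rfl
  obtain ⟨p, hp⟩ := h
  exact hp p.end_mem_support

theorem mem_branch_of_adj {v z x y : V} (h : x ∈ branch G v z) (hxy : G.Adj x y) (hy : y ≠ v) :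
    y ∈ branch G v z := by
  obtain ⟨p, hp⟩ := h
  exact ⟨p.concat hxy, by simp [Walk.support_concat, hp, hy.symm]⟩

theorem branch_trans {v x y z : V} (h : x ∈ branch G v y) (h' : y ∈ branch G v z) :
    x ∈ branch G v z := by
  obtain ⟨p, hp⟩ := h
  obtain ⟨q, hq⟩ := h'
  exact ⟨q.append p, by rw [Walk.mem_support_append_iff]; tauto⟩

theorem branch_symm {v x z : V} (h : x ∈ branch G v z) : z ∈ branch G v x := by
  obtain ⟨p, hp⟩ := h
  exact ⟨p.reverse, by simpa using hp⟩

theorem branch_induction {v z : V} {P : V → Prop} (h0 : P z)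
    (h : ∀ x y, x ∈ branch G v z → P x → G.Adj x y → y ≠ v → P y) {x : V}
    (hx : x ∈ branch G v z) : P x := by
  obtain ⟨p, hp⟩ := hx
  induction p using Walk.concatRec with
  | Hnil => exact h0
  | Hconcat p hadj ih =>
    rw [Walk.support_concat, List.mem_append, not_or] at hp
    exact h _ _ ⟨p, hp.1⟩ (ih h0 h hp.1) hadj (by simpa [eq_comm] using hp.2)

theorem branch_subset {u v z z' : V} (h : v ∉ branch G u z') (h' : z' ∈ branch G v z) :
    branch G u z' ⊆ branch G v z := fun _ hx =>
  branch_induction (P := (· ∈ branch G v z)) h'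
    (fun _ _ hx hxv hxy hy => mem_branch_of_adj hxv hxy (by
      rintro rfl
      exact h (mem_branch_of_adj hx hxy hy))) hx

theorem dist_eq_of_mem_branch (hconn : G.Connected) {v z s x : V} (hs : s ∉ branch G v z)
    (hx : x ∈ branch G v z) : G.dist s x = G.dist s v + G.dist v x := by
  refine dist_eq_add_of_gate hconn (K := (branch G v z)ᶜ) ?_ hs (not_not.2 hx)
  intro y w hyw hy hw
  by_contra hne
  exact hy (mem_branch_of_adj (not_not.1 hw) hyw.symm hne)

theorem mem_branch_or (hconn : G.Connected) {v z : V} (h : G.Adj v z) (x : V) :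
    x ∈ branch G v z ∨ x ∈ branch G z v := by
  by_contra! hx
  have hxz := dist_eq_of_mem_branch hconn hx.1 (mem_branch_self h.ne')
  have hxv := dist_eq_of_mem_branch hconn hx.2 (mem_branch_self h.ne)
  rw [dist_eq_one_iff_adj.2 h] at hxz
  rw [dist_eq_one_iff_adj.2 h.symm] at hxv
  omega

theorem notMem_branch_of_isBridge {v z x : V} (hb : G.IsBridge s(v, z))
    (hx : x ∈ branch G v z) : x ∉ branch G z v := by
  rintro ⟨q, hq⟩
  obtain ⟨p, hp⟩ := hx
  have hmem := isBridge_iff_forall_walk_mem_edges.1 hb (q.append p.reverse)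
  rw [Walk.edges_append, List.mem_append, Walk.edges_reverse, List.mem_reverse] at hmem
  rcases hmem with h | h
  · exact hq (q.snd_mem_support_of_mem_edges h)
  · exact hp (p.fst_mem_support_of_mem_edges h)

theorem dist_eq_or_of_isBridge (hconn : G.Connected) {x y : V} (h : G.Adj x y)
    (hb : G.IsBridge s(x, y)) (s : V) :
    (G.dist s x = G.dist s y + 1 ∧ s ∈ branch G x y) ∨
      (G.dist s y = G.dist s x + 1 ∧ s ∈ branch G y x) := by
  rcases mem_branch_or hconn h s with hs | hs
  · have := dist_eq_of_mem_branch hconn (notMem_branch_of_isBridge hb hs) (mem_branch_self h.ne)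
    exact Or.inl ⟨by rwa [dist_eq_one_iff_adj.2 h.symm] at this, hs⟩
  · have := dist_eq_of_mem_branch hconn
      (notMem_branch_of_isBridge (Sym2.eq_swap ▸ hb) hs) (mem_branch_self h.ne')
    exact Or.inr ⟨by rwa [dist_eq_one_iff_adj.2 h] at this, hs⟩

theorem dist_ne_of_isBridge (hconn : G.Connected) {x y : V} (h : G.Adj x y)
    (hb : G.IsBridge s(x, y)) (s : V) : G.dist s x ≠ G.dist s y := by
  have := dist_eq_or_of_isBridge hconn h hb s
  omega

theorem branch_ssubset_of_isBridge {v z w : V} (hvz : G.Adj v z) (hb : G.IsBridge s(v, z))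
    (hzw : G.Adj z w) (hwv : w ≠ v) : branch G z w ⊂ branch G v z := by
  have hz : z ∈ branch G v z := mem_branch_self hvz.ne'
  have hw := mem_branch_of_adj hz hzw hwv
  exact ⟨branch_subset (fun h => notMem_branch_of_isBridge hb hw (branch_symm h)) hw,
    fun h => ne_of_mem_branch (h hz) rfl⟩

variable {C : Cycle G}

theorem IsCactus.branch_subset_comp (hG : IsCactus G) {v z : V} (hv : v ∈ C.1.verts)
    (hadj : G.Adj v z) (hz : ¬ C.1.Adj v z) : branch G v z ⊆ C.comp v := fun _ hx =>
  branch_induction (P := (· ∈ C.comp v)) (Cycle.mem_comp_of_adj (C.mem_comp_self v) hadj hz)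
    (fun _ _ hx hxv hxy _ => Cycle.mem_comp_of_adj hxv hxy fun hC =>
      ne_of_mem_branch hx (hG.eq_of_mem_comp hv hC.fst_mem hxv)) hx

namespace Cycle

theorem exists_branch {v x : V} (hx : x ∈ C.comp v) (hne : x ≠ v) :
    ∃ z, G.Adj v z ∧ ¬ C.1.Adj v z ∧ x ∈ branch G v z := by
  obtain ⟨p, hp⟩ := Reachable.exists_isPath hx
  cases p with
  | nil => exact absurd rfl hne
  | @cons _ z _ h q =>
    rw [Walk.cons_isPath_iff] at hp
    obtain ⟨hvz, hC⟩ := deleteEdges_adj_iff.1 h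
    exact ⟨z, hvz, hC, q.mapLe (deleteEdges_le _), by simpa using hp.2⟩

theorem mem_branch {v z u : V} (h : C.1.Adj v z) (hu : u ∈ C.1.verts) (hne : u ≠ v) :
    u ∈ branch G v z := by
  obtain ⟨c, hc, rfl, rfl⟩ := exists_isParam_zero_one h
  obtain ⟨j, hj0, hj1, rfl⟩ := hc.exists_rep 0 hu
  have hj : 1 ≤ j := lt_of_le_of_ne hj0 (by rintro rfl; exact hne rfl)
  clear hu hne hj0
  induction j, hj using Int.leInduction with
  | base => exact mem_branch_self h.adj_sub.ne'
  | succ j hj ih =>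
    refine mem_branch_of_adj (ih (by omega)) (hc.adj_succ j).adj_sub fun h => ?_
    have := hc.inj h (by omega) (by omega)
    omega

end Cycle

theorem IsCactus.branch_ssubset_of_adj (hG : IsCactus G) {v z u w : V}
    (hvz : C.1.Adj v z) (hu : u ∈ C.1.verts) (huv : u ≠ v) (huw : G.Adj u w)
    (huwC : ¬ C.1.Adj u w) : branch G u w ⊂ branch G v z := by
  have hub : u ∈ branch G v z := Cycle.mem_branch hvz hu huv
  have hv : v ∉ branch G u w := fun h =>
    huv (hG.eq_of_mem_comp hu hvz.fst_mem (hG.branch_subset_comp hu huw huwC h)).symm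
  have hwv : w ≠ v := fun h => hv (h ▸ mem_branch_self huw.ne')
  exact ⟨branch_subset hv (mem_branch_of_adj hub huw hwv), fun h => ne_of_mem_branch (h hub) rfl⟩

end Branch

/-! ### Degrees -/

section Degree

variable {V : Type*} [Fintype V] {G : SimpleGraph V} [DecidableRel G.Adj]

theorem two_le_degree {v x y : V} (hx : G.Adj v x) (hy : G.Adj v y) (hxy : x ≠ y) :
    2 ≤ G.degree v :=
  Finset.one_lt_card.2 ⟨x, by simpa using hx, y, by simpa using hy, hxy⟩

theorem three_le_degree {v x y z : V} (hx : G.Adj v x) (hy : G.Adj v y) (hz : G.Adj v z)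
    (hxy : x ≠ y) (hxz : x ≠ z) (hyz : y ≠ z) : 3 ≤ G.degree v :=
  Finset.two_lt_card.2
    ⟨x, by simpa using hx, y, by simpa using hy, z, by simpa using hz, hxy, hxz, hyz⟩

theorem eq_of_degree_eq_one {z x y : V} (hz : G.degree z = 1) (hx : G.Adj z x)
    (hy : G.Adj z y) : y = x :=
  (degree_eq_one_iff_existsUnique_adj.1 hz).unique hy hx

theorem eq_or_eq_of_degree_eq_two {z x y w : V} (hz : G.degree z = 2) (hx : G.Adj z x)
    (hy : G.Adj z y) (hxy : x ≠ y) (hw : G.Adj z w) : w = x ∨ w = y := by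
  by_contra! h
  have := three_le_degree hx hy hw hxy h.1.symm h.2.symm
  omega

namespace Cycle

variable {C : Cycle G} {v : V}

theorem two_le_degree (hv : v ∈ C.1.verts) : 2 ≤ G.degree v := by
  obtain ⟨x, y, hxy, hx, hy, -⟩ := exists_nbrs hv
  exact Cactus.two_le_degree hx.adj_sub hy.adj_sub hxy

theorem three_le_degree {z : V} (hv : v ∈ C.1.verts) (hz : G.Adj v z) (hz' : ¬ C.1.Adj v z) :
    3 ≤ G.degree v := by
  obtain ⟨x, y, hxy, hx, hy, -⟩ := exists_nbrs hv
  exact Cactus.three_le_degree hx.adj_sub hy.adj_sub hz hxy (fun h => hz' (h ▸ hx))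
    (fun h => hz' (h ▸ hy))

theorem four_le_degree {z w : V} (hv : v ∈ C.1.verts) (hz : G.Adj v z) (hz' : ¬ C.1.Adj v z)
    (hw : G.Adj v w) (hw' : ¬ C.1.Adj v w) (hzw : z ≠ w) : 4 ≤ G.degree v := by
  classical
  obtain ⟨x, y, hxy, hx, hy, -⟩ := exists_nbrs hv
  have hsub : ({z, w} ∪ {x, y} : Finset V) ⊆ G.neighborFinset v := by
    simp only [Finset.union_subset_iff, Finset.insert_subset_iff, Finset.singleton_subset_iff,
      mem_neighborFinset]
    exact ⟨⟨hz, hw⟩, hx.adj_sub, hy.adj_sub⟩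
  have hdisj : Disjoint ({z, w} : Finset V) {x, y} := by
    simp only [Finset.disjoint_left, Finset.mem_insert, Finset.mem_singleton]
    rintro _ (rfl | rfl) (rfl | rfl) <;> contradiction
  have := Finset.card_le_card hsub
  rwa [Finset.card_union_of_disjoint hdisj, Finset.card_pair hzw, Finset.card_pair hxy] at this

theorem exists_two_nbrs_of_four_le_degree (hv : v ∈ C.1.verts) (h4 : 4 ≤ G.degree v) :
    ∃ w w', w ≠ w' ∧ (G.Adj v w ∧ ¬ C.1.Adj v w) ∧ (G.Adj v w' ∧ ¬ C.1.Adj v w') := by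
  classical
  obtain ⟨a, b, -, -, -, honly⟩ := exists_nbrs hv
  have hcard : 1 < (G.neighborFinset v \ {a, b}).card := by
    have := Finset.le_card_sdiff {a, b} (G.neighborFinset v)
    have := Finset.card_le_two (a := a) (b := b)
    rw [card_neighborFinset_eq_degree] at *
    omega
  have hoff : ∀ w ∈ G.neighborFinset v \ {a, b}, G.Adj v w ∧ ¬ C.1.Adj v w := fun w hw => by
    rw [Finset.mem_sdiff, mem_neighborFinset, Finset.mem_insert, Finset.mem_singleton] at hw
    exact ⟨hw.1, fun h => hw.2 (honly w h)⟩
  obtain ⟨w, hw, w', hw', hne⟩ := Finset.one_lt_card.1 hcard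
  exact ⟨w, w', hne, hoff w hw, hoff w' hw'⟩

end Cycle

end Degree

/-! ### Tails and threads -/

section Tail

variable {V : Type*} [Fintype V] {G : SimpleGraph V} [DecidableRel G.Adj]

/-- `IsTail G v z l`: the list `l` satisfies all conditions on a thread at `v`, except possibly that
`v` has degree at least `3`, and its last vertex, the one adjacent to `v`, is `z`. -/
inductive IsTail (G : SimpleGraph V) [DecidableRel G.Adj] : V → V → List V → Prop
  | leaf {v z : V} (hvz : G.Adj v z) (hz : G.degree z = 1) : IsTail G v z [z]
  | concat {v z w : V} {l : List V} (hvz : G.Adj v z) (hz : G.degree z = 2)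
      (h : IsTail G z w l) (hv : v ∉ l) : IsTail G v z (l ++ [z])

namespace IsTail

variable {v z : V} {l : List V}

theorem adj (h : IsTail G v z l) : G.Adj v z := by
  cases h <;> assumption

theorem mem (h : IsTail G v z l) : z ∈ l := by
  cases h <;> simp

theorem notMem (h : IsTail G v z l) : v ∉ l := by
  cases h with
  | leaf hvz _ => simpa using hvz.ne
  | concat hvz _ _ hv => simpa [hv] using hvz.ne

theorem nodup (h : IsTail G v z l) : l.Nodup := by
  induction h with
  | leaf => simp
  | concat _ _ h _ ih => exact List.concat_eq_append ▸ ih.concat h.notMem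

theorem isChain (h : IsTail G v z l) : (l ++ [v]).IsChain G.Adj := by
  induction h with
  | leaf hvz => simpa using hvz.symm
  | concat hvz _ _ _ ih => exact List.isChain_append.2 ⟨ih, by simp, by simp [hvz.symm]⟩

theorem exists_eq_cons (h : IsTail G v z l) :
    ∃ (u : V) (t : List V), l = u :: t ∧ G.degree u = 1 ∧ ∀ x ∈ t, G.degree x = 2 := by
  induction h with
  | @leaf _ z _ hz => exact ⟨z, [], rfl, hz, by simp⟩
  | @concat _ z _ _ _ hz _ _ ih =>
    obtain ⟨u, t, rfl, hu, ht⟩ := ih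
    exact ⟨u, t ++ [z], rfl, hu, by simpa [or_imp, forall_and, hz] using ht⟩

theorem degree_le (h : IsTail G v z l) {x : V} (hx : x ∈ l) : G.degree x ≤ 2 := by
  obtain ⟨u, t, rfl, hu, ht⟩ := h.exists_eq_cons
  rcases List.mem_cons.1 hx with rfl | hx
  · omega
  · exact (ht x hx).le

theorem mem_or_eq_of_adj (h : IsTail G v z l) {x y : V} (hx : x ∈ l) (hxy : G.Adj x y) :
    y ∈ l ∨ y = v := by
  induction h with
  | leaf hvz hz =>
    obtain rfl := List.mem_singleton.1 hx
    exact Or.inr (eq_of_degree_eq_one hz hvz.symm hxy)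
  | @concat v _ w _ hvz hz h hv ih =>
    rw [List.mem_append, List.mem_singleton] at hx ⊢
    rcases hx with hx | rfl
    · exact Or.inl (ih hx)
    · have hne : v ≠ w := fun e => hv (e ▸ h.mem)
      rcases eq_or_eq_of_degree_eq_two hz hvz.symm h.adj hne hxy with rfl | rfl
      · exact Or.inr rfl
      · exact Or.inl (Or.inl h.mem)

theorem eq_of_adj (h : IsTail G v z l) {x : V} (hx : x ∈ l) (hxv : G.Adj x v) : x = z := by
  cases h with
  | leaf => simpa using hx
  | concat hvz _ h hv =>
    rw [List.mem_append, List.mem_singleton] at hx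
    exact hx.resolve_left fun hx => (h.mem_or_eq_of_adj hx hxv).elim hv hvz.ne

theorem mem_of_mem_branch (h : IsTail G v z l) {x y : V} (hx : x ∈ l)
    (hy : y ∈ branch G v x) : y ∈ l :=
  branch_induction (P := (· ∈ l)) hx
    (fun _ _ _ ha hab hb => (h.mem_or_eq_of_adj ha hab).resolve_right hb) hy

theorem mem_iff_mem_branch (h : IsTail G v z l) {x : V} : x ∈ l ↔ x ∈ branch G v z := by
  refine ⟨fun hx => ?_, h.mem_of_mem_branch h.mem⟩
  induction h with
  | leaf hvz =>
    obtain rfl := List.mem_singleton.1 hx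
    exact mem_branch_self hvz.ne'
  | concat hvz _ h hv ih =>
    rw [List.mem_append, List.mem_singleton] at hx
    rcases hx with hx | rfl
    · have hw := mem_branch_of_adj (mem_branch_self hvz.ne') h.adj fun e => hv (e ▸ h.mem)
      exact branch_subset (fun hv' => hv (h.mem_of_mem_branch h.mem hv')) hw (ih hx)
    · exact mem_branch_self hvz.ne'

theorem notMem_verts (h : IsTail G v z l) (C : Cycle G) {x : V} (hx : x ∈ l) :
    x ∉ C.1.verts := by
  induction h generalizing x with
  | leaf _ hz =>
    intro hC
    have := Cycle.two_le_degree hC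
    obtain rfl := List.mem_singleton.1 hx
    omega
  | @concat v _ w _ hvz hz h hv ih =>
    rw [List.mem_append, List.mem_singleton] at hx
    rcases hx with hx | rfl
    · exact ih hx
    -- Both neighbours of `x` on `C` would have to be `v`, as the other neighbour lies on the tail.
    · intro hC
      obtain ⟨a, b, hab, ha, hb, -⟩ := Cycle.exists_nbrs hC
      have heq : ∀ y, C.1.Adj x y → y = v := fun y hy =>
        (eq_or_eq_of_degree_eq_two hz hvz.symm h.adj (fun e => hv (e ▸ h.mem))
          hy.adj_sub).resolve_right fun e : y = w => ih h.mem (e ▸ hy.snd_mem)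
      exact hab ((heq a ha).trans (heq b hb).symm)

theorem unique {l' : List V} (h : IsTail G v z l) (h' : IsTail G v z l') : l = l' := by
  induction h generalizing l' with
  | leaf _ hz =>
    cases h' with
    | leaf => rfl
    | concat _ hz' => omega
  | concat hvz hz h hv ih =>
    cases h' with
    | leaf _ hz' => omega
    | concat _ _ h' hv' =>
      obtain rfl := (eq_or_eq_of_degree_eq_two hz hvz.symm h.adj (fun e => hv (e ▸ h.mem))
        h'.adj).resolve_left fun e => hv' (e ▸ h'.mem)
      rw [ih h']

theorem dist_le_length (hconn : G.Connected) (h : IsTail G v z l) {x : V} (hx : x ∈ l) :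
    G.dist v x ≤ l.length := by
  induction h with
  | leaf hvz => simp [List.mem_singleton.1 hx, dist_eq_one_iff_adj.2 hvz]
  | @concat v z _ _ hvz _ _ _ ih =>
    have hdist := dist_eq_one_iff_adj.2 hvz
    rw [List.length_append, List.length_singleton]
    rcases List.mem_append.1 hx with hx | hx
    · have := hconn.dist_triangle (u := v) (v := z) (w := x)
      have := ih hx
      omega
    · rw [List.mem_singleton.1 hx]
      omega

theorem exists_dist_eq (hconn : G.Connected) (h : IsTail G v z l) {m : ℕ} (hm : 1 ≤ m)
    (hml : m ≤ l.length) : ∃ x ∈ l, G.dist v x = m := by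
  induction h generalizing m with
  | @leaf v z hvz _ =>
    rw [List.length_singleton] at hml
    exact ⟨z, by simp, by rw [dist_eq_one_iff_adj.2 hvz]; omega⟩
  | @concat v z w l hvz _ h hv ih =>
    rw [List.length_append, List.length_singleton] at hml
    have hdist := dist_eq_one_iff_adj.2 hvz
    rcases hm.eq_or_lt with rfl | hm
    · exact ⟨z, by simp, hdist⟩
    · obtain ⟨x, hx, hxm⟩ := ih (m := m - 1) (by omega) (by omega)
      refine ⟨x, List.mem_append_left _ hx, ?_⟩
      rw [dist_eq_of_mem_branch hconn (mt h.mem_iff_mem_branch.2 hv) (h.mem_iff_mem_branch.1 hx)]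
      omega

theorem isThread (h : IsTail G v z l) (hv : 3 ≤ G.degree v) : IsThread G v l :=
  ⟨hv, h.nodup, h.isChain, h.exists_eq_cons⟩

end IsTail

namespace IsThread

theorem exists_isTail {v : V} {l : List V} (h : IsThread G v l) : ∃ z, IsTail G v z l := by
  obtain ⟨hdeg, hnd, hch, u, t, rfl, hu, ht⟩ := h
  have hv : v ∉ u :: t := by
    rw [List.mem_cons]
    rintro (rfl | hv)
    · omega
    · have := ht v hv
      omega
  clear hdeg
  induction t using List.reverseRecOn generalizing v with
  | nil => exact ⟨u, .leaf (by simpa [adj_comm] using hch) hu⟩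
  | append_singleton t z ih =>
    rw [← List.cons_append] at hnd hch hv
    have hz : z ∉ u :: t := fun hz =>
      (List.nodup_append.1 hnd).2.2 z hz z (List.mem_singleton_self z) rfl
    obtain ⟨w, hw⟩ := ih hnd.of_append_left hch.left_of_append
      (fun x hx => ht x (List.mem_append_left _ hx)) hz
    rw [List.append_assoc, List.isChain_append] at hch
    have hvz : G.Adj z v := by simpa using hch.2.1
    exact ⟨z, .concat hvz.symm (ht z (by simp)) hw fun h => hv (List.mem_append_left _ h)⟩

theorem notMem_verts {v : V} {l : List V} (h : IsThread G v l) {x : V} (hx : x ∈ l)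
    (C : Cycle G) : x ∉ C.1.verts :=
  let ⟨_, ht⟩ := h.exists_isTail
  ht.notMem_verts C hx

theorem eq_of_mem {v v' x : V} {l l' : List V} (h : IsThread G v l) (h' : IsThread G v' l')
    (hx : x ∈ l) (hx' : x ∈ l') : v = v' ∧ l = l' := by
  obtain ⟨z, ht⟩ := h.exists_isTail
  obtain ⟨z', ht'⟩ := h'.exists_isTail
  have hv : v ∉ l' := fun hv => by linarith [ht'.degree_le hv, h.1]
  have hv' : v' ∉ l := fun hv' => by linarith [ht.degree_le hv', h'.1]
  -- Walking along `l'` from `x` to its end `z'` never meets `v`, so it stays in `l`.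
  have hz' : z' ∈ l := by
    have hb := branch_symm (ht'.mem_iff_mem_branch.1 hx')
    refine branch_induction (P := (· ∈ l)) hx (fun a b ha hal hab hbv' => ?_) hb
    refine (ht.mem_or_eq_of_adj hal hab).resolve_right ?_
    rintro rfl
    exact hv (ht'.mem_of_mem_branch hx' (mem_branch_of_adj ha hab hbv'))
  obtain rfl := (ht.mem_or_eq_of_adj hz' ht'.adj.symm).resolve_left hv'
  obtain rfl := ht.eq_of_adj hz' ht'.adj.symm
  exact ⟨rfl, ht.unique ht'⟩

end IsThread

end Tail

/-! ### Branches that avoid `S` -/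

section FreeBranch

variable {V : Type*} [Fintype V] {G : SimpleGraph V} [DecidableRel G.Adj] {S : Finset V}

/-- Every cycle has at least two vertices that are branch-active or `S`-active. For a
branch-resolving set this is equivalent to being biactive, and it is easier to check. -/
def IsWeaklyBiactive (G : SimpleGraph V) [DecidableRel G.Adj] (S : Finset V) : Prop :=
  ∀ C : Cycle G, 2 ≤ {v | C.IsBranchActive v ∨ C.IsActive S v}.ncard

theorem IsBiactive.isWeaklyBiactive (h : IsBiactive G S) : IsWeaklyBiactive G S := fun C =>
  (h C).trans (Set.ncard_le_ncard (fun _ hv => Or.inr hv) (Set.toFinite _))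

theorem IsTail.isFreeThread {v z : V} {l : List V} (h : IsTail G v z l) (hv : 3 ≤ G.degree v)
    (hfree : ∀ s ∈ S, s ∉ branch G v z) : IsFreeThread G S v l :=
  ⟨h.isThread hv, fun x hx hxS => hfree x hxS (h.mem_iff_mem_branch.1 hx)⟩

theorem IsBranchResolving.eq_of_isTail (hbr : IsBranchResolving G S) {u a b : V} {l m : List V}
    (hu : 3 ≤ G.degree u) (ha : IsTail G u a l) (hb : IsTail G u b m)
    (ha' : ∀ s ∈ S, s ∉ branch G u a) (hb' : ∀ s ∈ S, s ∉ branch G u b) : a = b := by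
  obtain rfl := hbr u (ha.isFreeThread hu ha') (hb.isFreeThread hu hb')
  exact hb.eq_of_adj ha.mem ha.adj.symm

theorem IsBranchResolving.not_isBranchActive (hbr : IsBranchResolving G S) {C : Cycle G} {u : V}
    (hu : u ∈ C.1.verts)
    (h : ∀ w, G.Adj u w → ¬ C.1.Adj u w → (∀ s ∈ S, s ∉ branch G u w) ∧ ∃ l, IsTail G u w l) :
    ¬ C.IsBranchActive u := by
  rintro ⟨-, h4 | ⟨x, hx, hxu, hx3⟩⟩
  · obtain ⟨w, w', hne, ⟨hw, hwC⟩, hw', hwC'⟩ := Cycle.exists_two_nbrs_of_four_le_degree hu h4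
    obtain ⟨hfree, l, hl⟩ := h w hw hwC
    obtain ⟨hfree', l', hl'⟩ := h w' hw' hwC'
    exact hne (hbr.eq_of_isTail (by omega) hl hl' hfree hfree')
  · obtain ⟨w, hw, hwC, hxw⟩ := Cycle.exists_branch hx hxu
    obtain ⟨-, l, hl⟩ := h w hw hwC
    have := hl.degree_le (hl.mem_iff_mem_branch.2 hxw)
    omega

theorem IsWeaklyBiactive.isBridge_of_free (hG : IsCactus G) (hbr : IsBranchResolving G S)
    (hS : IsWeaklyBiactive G S) {v z : V} (hvz : G.Adj v z) (hfree : ∀ s ∈ S, s ∉ branch G v z)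
    (htail : ∀ u w, G.Adj u w → branch G u w ⊂ branch G v z → ∃ l, IsTail G u w l) :
    G.IsBridge s(v, z) := by
  refine (isBridge_iff_forall_cycle_not_adj hvz).2 fun C hC => ?_
  have hactive : {u | C.IsBranchActive u ∨ C.IsActive S u} ⊆ {v} := by
    rintro u hu
    by_contra huv
    rcases hu with hu | ⟨huC, s, hs, hsu⟩
    · refine hbr.not_isBranchActive hu.1 (fun w hw hwC => ?_) hu
      have hsub := hG.branch_ssubset_of_adj hC hu.1 huv hw hwC
      exact ⟨fun s hs h => hfree s hs (hsub.1 h), htail u w hw hsub⟩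
    · by_cases hsu' : s = u
      · exact hfree s hs (hsu' ▸ Cycle.mem_branch hC huC huv)
      · obtain ⟨w, hw, hwC, hsw⟩ := Cycle.exists_branch hsu hsu'
        exact hfree s hs ((hG.branch_ssubset_of_adj hC huC huv hw hwC).1 hsw)
  have := (hS C).trans (Set.ncard_le_ncard hactive (Set.toFinite _))
  simp at this

theorem IsBranchResolving.exists_isTail_of_isBridge (hbr : IsBranchResolving G S) {v z : V}
    (hvz : G.Adj v z) (hb : G.IsBridge s(v, z)) (hfree : ∀ s ∈ S, s ∉ branch G v z)
    (htail : ∀ u w, G.Adj u w → branch G u w ⊂ branch G v z → ∃ l, IsTail G u w l) :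
    ∃ l, IsTail G v z l := by
  classical
  have hsub := fun w (hw : G.Adj z w) (hwv : w ≠ v) => branch_ssubset_of_isBridge hvz hb hw hwv
  by_cases hw : ∃ w, G.Adj z w ∧ w ≠ v
  · obtain ⟨w, hw, hwv⟩ := hw
    obtain ⟨l, hl⟩ := htail z w hw (hsub w hw hwv)
    have honly : ∀ x, G.Adj z x → x = v ∨ x = w := fun x hx => by
      by_contra! hne
      obtain ⟨m, hm⟩ := htail z x hx (hsub x hx hne.1)
      exact hne.2 (hbr.eq_of_isTail
        (three_le_degree hvz.symm hw hx hwv.symm hne.1.symm hne.2.symm) hm hl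
        (fun s hs h => hfree s hs ((hsub x hx hne.1).1 h))
        (fun s hs h => hfree s hs ((hsub w hw hwv).1 h)))
    have hnbrs : G.neighborFinset z = {v, w} := by
      ext x
      rw [mem_neighborFinset, Finset.mem_insert, Finset.mem_singleton]
      exact ⟨honly x, by rintro (rfl | rfl) <;> [exact hvz.symm; exact hw]⟩
    have hdeg : G.degree z = 2 := by
      rw [← card_neighborFinset_eq_degree, hnbrs, Finset.card_pair hwv.symm]
    refine ⟨_, .concat hvz hdeg hl fun hv => ?_⟩
    exact ne_of_mem_branch ((hsub w hw hwv).1 (hl.mem_iff_mem_branch.1 hv)) rfl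
  · push Not at hw
    exact ⟨[z], .leaf hvz (degree_eq_one_iff_existsUnique_adj.2 ⟨v, hvz.symm, hw⟩)⟩

theorem isBridge_and_exists_isTail_of_free (hG : IsCactus G) (hbr : IsBranchResolving G S)
    (hS : IsWeaklyBiactive G S) {v z : V} (hvz : G.Adj v z)
    (hfree : ∀ s ∈ S, s ∉ branch G v z) : G.IsBridge s(v, z) ∧ ∃ l, IsTail G v z l := by
  induction hn : (branch G v z).ncard using Nat.strong_induction_on generalizing v z with
  | _ n ih =>
    have htail : ∀ u w, G.Adj u w → branch G u w ⊂ branch G v z → ∃ l, IsTail G u w l :=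
      fun u w huw hsub => (ih _ (hn ▸ Set.ncard_lt_ncard hsub (Set.toFinite _)) huw
        (fun s hs h => hfree s hs (hsub.1 h)) rfl).2
    have hb := hS.isBridge_of_free hG hbr hvz hfree htail
    exact ⟨hb, hbr.exists_isTail_of_isBridge hvz hb hfree htail⟩

end FreeBranch

/-! ### Canonical labellings and critical vertices -/

section Canonical

variable {V : Type*} {G : SimpleGraph V} {C : Cycle G} {S : Finset V} {κ : Kind} {c : ℤ → V}
  {k : ℕ}

theorem IsCactus.isActive_iff (hG : IsCactus G) {v : V} :
    C.IsActive S v ↔ ∃ s ∈ S, C.root s = v := by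
  constructor
  · rintro ⟨hv, s, hs, h⟩
    exact ⟨s, hs, (hG.mem_comp_iff hv).1 h⟩
  · rintro ⟨s, hs, rfl⟩
    exact ⟨hG.root_mem C s, s, hs, hG.mem_comp_root C s⟩

theorem Cycle.eq_or_eq_of_numActive (h : C.numActive S = 2) {a b : V} (ha : C.IsActive S a)
    (hb : C.IsActive S b) (hab : a ≠ b) {v : V} (hv : C.IsActive S v) : v = a ∨ v = b := by
  have hfin := Set.finite_of_ncard_ne_zero (s := {v | C.IsActive S v}) (h.trans_ne two_ne_zero)
  have hpair : {a, b} = {v | C.IsActive S v} :=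
    Set.eq_of_subset_of_ncard_le (Set.pair_subset ha hb) (h.trans (Set.ncard_pair hab).symm).le hfin
  exact hpair.symm.subset hv

theorem Cycle.exists_active_ne (h : 2 ≤ C.numActive S) (v : V) : ∃ u, C.IsActive S u ∧ u ≠ v :=
  Set.exists_ne_of_one_lt_ncard (s := {v | C.IsActive S v}) h v

/-- All `S`-active vertices of `C` are among `c 0, …, c k`. Canonical labellings, `S`-paths and
critical vertices are all analysed through this notion. -/
def Cycle.ActiveWithin (C : Cycle G) (S : Finset V) (c : ℤ → V) (k : ℕ) : Prop :=
  ∀ v, C.IsActive S v → ∃ j : ℤ, 0 ≤ j ∧ j ≤ k ∧ c j = v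

namespace Cycle

theorem ActiveWithin.mono {m : ℕ} (h : C.ActiveWithin S c k) (hkm : k ≤ m) :
    C.ActiveWithin S c m := fun v hv =>
  let ⟨j, h0, hjk, hj⟩ := h v hv
  ⟨j, h0, by omega, hj⟩

theorem ActiveWithin.reflect (h : C.ActiveWithin S c k) :
    C.ActiveWithin S (fun i => c (k - i)) k := by
  intro v hv
  obtain ⟨j, h0, h1, rfl⟩ := h v hv
  exact ⟨k - j, by omega, by omega, by simp⟩

theorem IsParam.activeWithin (hc : C.IsParam c) : C.ActiveWithin S c (C.len - 1) := by
  intro v hv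
  have h3 := C.three_le_len
  obtain ⟨j, h0, h1, rfl⟩ := hc.exists_rep 0 hv.1
  exact ⟨j, h0, by omega, rfl⟩

theorem ActiveWithin.exists_max (h : C.ActiveWithin S c k) {v : V} (hv : C.IsActive S v) :
    ∃ m ≤ k, C.IsActive S (c (m : ℕ)) ∧ C.ActiveWithin S c m := by
  classical
  have hle : ∀ w, C.IsActive S w → ∃ i ≤ k, c (i : ℕ) = w := fun w hw => by
    obtain ⟨j, h0, hjk, rfl⟩ := h w hw
    lift j to ℕ using h0
    exact ⟨j, by omega, rfl⟩
  obtain ⟨i, hik, rfl⟩ := hle v hv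
  refine ⟨Nat.findGreatest (fun i => C.IsActive S (c i)) k, Nat.findGreatest_le k,
    Nat.findGreatest_spec (P := fun i => C.IsActive S (c i)) hik hv, fun w hw => ?_⟩
  obtain ⟨j, hjk, rfl⟩ := hle w hw
  exact ⟨j, by omega, by exact_mod_cast Nat.le_findGreatest hjk hw, rfl⟩

theorem ActiveWithin.numActive_le_two [Finite V] (hall : C.ActiveWithin S c k)
    (hact : ∀ l : ℤ, 0 ≤ l → l ≤ k → C.IsActive S (c l) → l = 0 ∨ l = k) : C.numActive S ≤ 2 := by
  have hsub : {v | C.IsActive S v} ⊆ {c 0, c k} := by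
    intro v hv
    obtain ⟨j, hj0, hjk, rfl⟩ := hall v hv
    rcases hact j hj0 hjk hv with rfl | rfl
    · exact Or.inl rfl
    · exact Or.inr rfl
  exact (Set.ncard_le_ncard hsub (Set.toFinite _)).trans
    ((Set.ncard_insert_le _ _).trans (by simp))

end Cycle

theorem Labelling.hasMaxActive_iff {lab : Labelling C} : lab.HasMaxActive S k ↔
    k < C.len ∧ C.IsActive S (lab.param 0) ∧ C.IsActive S (lab.param k) ∧
      C.ActiveWithin S lab.param k := by
  have h3 := C.three_le_len
  have h0 : lab.param 0 = lab.vert 0 := lab.param_natCast (Nat.zero_le _)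
  constructor
  · rintro ⟨hact, ⟨hk, hkact⟩, hub⟩
    refine ⟨hk, h0 ▸ hact, lab.param_natCast hk.le ▸ hkact, fun v hv => ?_⟩
    obtain ⟨j, hj0, hj, rfl⟩ := lab.isParam_param.activeWithin v hv
    lift j to ℕ using hj0
    have hjk : j ≤ k := hub ⟨by omega, lab.param_natCast (i := j) (by omega) ▸ hv⟩
    exact ⟨j, by omega, by omega, rfl⟩
  · rintro ⟨hk, hact, hkact, hall⟩
    refine ⟨h0 ▸ hact, ⟨hk, lab.param_natCast hk.le ▸ hkact⟩, fun i ⟨hi, hiact⟩ => ?_⟩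
    rw [← lab.param_natCast hi.le] at hiact
    obtain ⟨j, hj0, hjk, hj⟩ := hall _ hiact
    have := lab.isParam_param.inj hj (by omega) (by omega)
    omega

theorem dist_getVert_add_le {a b : V} (p : G.Walk a b) (i j : ℕ) :
    G.dist (p.getVert i) (p.getVert (i + j)) ≤ j := by
  have hlen : ((p.drop i).take j).length ≤ j := by
    rw [Walk.take_length]
    exact min_le_left _ _
  have hend : (p.drop i).getVert j = p.getVert (i + j) := Walk.drop_getVert ..
  exact hend ▸ (dist_le _).trans hlen

theorem dist_le_length_of_mem {x y a b : V} {p : G.Walk a b} (hx : x ∈ p.support)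
    (hy : y ∈ p.support) : G.dist x y ≤ p.length := by
  obtain ⟨i, rfl, hi⟩ := Walk.mem_support_iff_exists_getVert.1 hx
  obtain ⟨j, rfl, hj⟩ := Walk.mem_support_iff_exists_getVert.1 hy
  rcases le_total i j with h | h <;> obtain ⟨d, rfl⟩ := Nat.exists_eq_add_of_le h
  · exact (dist_getVert_add_le p i d).trans (by omega)
  · rw [SimpleGraph.dist_comm]
    exact (dist_getVert_add_le p j d).trans (by omega)

namespace Cycle.IsParam

theorem dist_le_of_le (hc : C.IsParam c) {a b : ℤ} (ha : 0 ≤ a) (hak : a ≤ k) (hb : 0 ≤ b)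
    (hbk : b ≤ k) : G.dist (c a) (c b) ≤ k := by
  obtain ⟨p, hp, hpv⟩ := hc.exists_arc 0 k
  have hmem : ∀ i : ℤ, 0 ≤ i → i ≤ k → c i ∈ p.support := fun i h0 hik => by
    lift i to ℕ using h0
    rw [Walk.mem_support_iff_exists_getVert]
    exact ⟨i, by simpa using hpv i (by omega), by omega⟩
  exact hp ▸ dist_le_length_of_mem (hmem a ha hak) (hmem b hb hbk)

theorem exists_isPath (hc : C.IsParam c) (hk : k < C.len) :
    ∃ p : G.Walk (c 0) (c k), p.IsPath ∧ p.toSubgraph ≤ C.1 ∧ p.length = k ∧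
      ∀ t ≤ k, p.getVert t = c (t : ℕ) := by
  obtain ⟨q, hq, hqv⟩ := hc.exists_arc 0 k
  obtain ⟨p, hp, hpv⟩ : ∃ p : G.Walk (c 0) (c k), p.length = k ∧ ∀ t ≤ k, p.getVert t = c t :=
    ⟨q.copy rfl (by rw [zero_add]), by simpa using hq, by simpa using hqv⟩
  refine ⟨p, (Walk.IsPath.getVert_injOn_iff p).1 fun i hi j hj h => ?_, ⟨?_, ?_⟩, hp, hpv⟩
  · simp only [hp, Set.mem_ofPred_eq] at hi hj
    rw [hpv i hi, hpv j hj] at h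
    have := hc.inj h (by omega) (by omega)
    omega
  · intro v hv
    rw [Walk.mem_verts_toSubgraph, Walk.mem_support_iff_exists_getVert] at hv
    obtain ⟨i, rfl, hi⟩ := hv
    exact hpv i (by omega) ▸ hc.mem i
  · intro x y hxy
    obtain ⟨i, hi, h⟩ := toSubgraph_adj_iff_getVert.1 hxy
    rw [hpv i (by omega), hpv (i + 1) (by omega)] at h
    exact (hc.adj_iff x y).2 ⟨i, by exact_mod_cast h⟩

end Cycle.IsParam

namespace Kind

theorem critBound_lt (κ : Kind) (C : Cycle G) : 2 * κ.critBound C.len < C.len := by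
  have := C.three_le_len
  cases κ <;> simp only [critBound] <;> omega

end Kind

namespace IsCactus

theorem exists_isCanonical_of_two_mul_le (hG : IsCactus G) (hc : C.IsParam c)
    (h0 : C.IsActive S (c 0)) (hk : C.IsActive S (c k)) (hall : C.ActiveWithin S c k)
    (hkn : 2 * k ≤ C.len) : ∃ lab : Labelling C, lab.param = c ∧ lab.IsCanonical S k := by
  have h3 := C.three_le_len
  obtain ⟨lab, rfl⟩ := hc.exists_labelling
  refine ⟨lab, rfl, Labelling.hasMaxActive_iff.2 ⟨by omega, h0, hk, hall⟩, fun lab' k' h' => ?_⟩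
  -- `v_0` and `v_k` are at distance `k`, so no labelling can squeeze them closer together.
  obtain ⟨-, -, -, hall'⟩ := Labelling.hasMaxActive_iff.1 h'
  obtain ⟨a, ha0, hak, ha⟩ := hall' _ h0
  obtain ⟨b, hb0, hbk, hb⟩ := hall' _ hk
  have hle := lab'.isParam_param.dist_le_of_le ha0 hak hb0 hbk
  have heq := hG.dist_param hc (i := 0) (j := k) (by omega) (by omega)
  rw [ha, hb] at hle
  omega

theorem isCritical_of_activeWithin (hG : IsCactus G) (hc : C.IsParam c)
    (h0 : C.IsActive S (c 0)) (hk : C.IsActive S (c k)) (hall : C.ActiveWithin S c k)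
    (hkn : k ≤ κ.critBound C.len) : C.IsCritical κ S (c 0) := by
  have hlt := κ.critBound_lt C
  obtain ⟨p, hp, hpC, hlen, hpv⟩ := hc.exists_isPath (k := k) (by omega)
  refine ⟨_, p, ⟨⟨hp, hpC, fun v hv => ?_⟩, fun a b q hq => ?_⟩, by omega⟩
  · obtain ⟨j, hj0, hjk, rfl⟩ := hall v hv
    lift j to ℕ using hj0
    exact Walk.mem_support_iff_exists_getVert.2 ⟨j, hpv j (by omega), by omega⟩
  · have hle := dist_le_length_of_mem (hq.2.2 _ h0) (hq.2.2 _ hk)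
    have heq := hG.dist_param hc (i := 0) (j := k) (by omega) (by omega)
    omega

end IsCactus

theorem Cycle.IsCritical.exists_isParam {v : V} (h : C.IsCritical κ S v) :
    ∃ c, ∃ k ≤ κ.critBound C.len, C.IsParam c ∧ c 0 = v ∧ C.ActiveWithin S c k := by
  obtain ⟨b, p, ⟨⟨hp, hpC, hcov⟩, -⟩, hlen⟩ := h
  obtain ⟨c, hc, hcp⟩ := exists_isParam_eq_getVert hp hpC
  refine ⟨c, p.length, hlen, hc, by simpa using (hcp 0 (by omega)).symm, fun w hw => ?_⟩
  obtain ⟨t, rfl, ht⟩ := Walk.mem_support_iff_exists_getVert.1 (hcov w hw)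
  exact ⟨t, by omega, by omega, (hcp t ht).symm⟩

theorem Cycle.IsParam.exists_hasMaxActive (hc : C.IsParam c) (h0 : C.IsActive S (c 0))
    (hall : C.ActiveWithin S c k) :
    ∃ (lab : Labelling C) (m : ℕ), m ≤ k ∧ lab.HasMaxActive S m := by
  have h3 := C.three_le_len
  obtain ⟨m, hm, hmact, hmall⟩ := hall.exists_max h0
  obtain ⟨n, hn, hnact, hnall⟩ := hc.activeWithin.exists_max h0
  obtain ⟨lab, rfl⟩ := hc.exists_labelling
  rcases le_total m n with h | h
  · exact ⟨lab, m, hm, Labelling.hasMaxActive_iff.2 ⟨by omega, h0, hmact, hmall⟩⟩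
  · exact ⟨lab, n, h.trans hm, Labelling.hasMaxActive_iff.2 ⟨by omega, h0, hnact, hnall⟩⟩

theorem Cycle.exists_isCanonical (h : 1 ≤ C.numActive S) :
    ∃ (lab : Labelling C) (k : ℕ), lab.IsCanonical S k := by
  classical
  obtain ⟨v, hv⟩ : {v | C.IsActive S v}.Nonempty :=
    Set.nonempty_of_ncard_ne_zero (Nat.one_le_iff_ne_zero.1 h)
  obtain ⟨c, hc, rfl⟩ := exists_isParam_zero hv.1
  have hex : ∃ k, ∃ lab : Labelling C, lab.HasMaxActive S k := by
    obtain ⟨lab, k, -, hk⟩ := hc.exists_hasMaxActive hv hc.activeWithin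
    exact ⟨k, lab, hk⟩
  obtain ⟨lab, hlab⟩ := Nat.find_spec hex
  exact ⟨lab, _, hlab, fun lab' k' h' => Nat.find_min' hex ⟨lab', h'⟩⟩

/-- Three active vertices that cut the cycle into three geodesics. When they exist, no vertex of
the cycle is critical. -/
def Cycle.HasGeodesicTriple (C : Cycle G) (S : Finset V) : Prop :=
  ∃ (c : ℤ → V) (p q : ℤ), C.IsParam c ∧ C.IsActive S (c 0) ∧ C.IsActive S (c p) ∧
    C.IsActive S (c q) ∧ 0 < p ∧ p < q ∧ q < C.len ∧ 2 * p ≤ C.len ∧ 2 * (q - p) ≤ C.len ∧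
    2 * (C.len - q) ≤ C.len

namespace Labelling.IsCanonical

variable {lab : Labelling C}

theorem le (h : lab.IsCanonical S k) (hc : C.IsParam c) {k' : ℕ} (h0 : C.IsActive S (c 0))
    (hall : C.ActiveWithin S c k') : k ≤ k' := by
  obtain ⟨lab', m, hm, hmax⟩ := hc.exists_hasMaxActive h0 hall
  exact (h.2 lab' m hmax).trans hm

theorem pos (h : lab.IsCanonical S k) (h2 : 2 ≤ C.numActive S) : 0 < k := by
  obtain ⟨-, -, -, hall⟩ := hasMaxActive_iff.1 h.1
  obtain ⟨u, hu, hne⟩ := Cycle.exists_active_ne h2 (lab.param 0)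
  obtain ⟨j, hj0, hjk, rfl⟩ := hall u hu
  rcases hj0.eq_or_lt with rfl | hj0
  · exact absurd rfl hne
  · omega

theorem add_gap_le (h : lab.IsCanonical S k) (hc : C.IsParam c) {a b : ℕ} (hab : a ≤ b)
    (hbn : b ≤ C.len) (hb : C.IsActive S (c b))
    (hgap : ∀ j : ℕ, j < C.len → C.IsActive S (c j) → j ≤ a ∨ b ≤ j) : k + (b - a) ≤ C.len := by
  have h3 := C.three_le_len
  suffices k ≤ C.len - (b - a) by omega
  refine h.le (hc.shift b) (by simpa using hb) fun v hv => ?_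
  obtain ⟨j, hj0, hj, rfl⟩ := hc.activeWithin v hv
  lift j to ℕ using hj0
  rcases hgap j (by omega) hv with hja | hbj
  · refine ⟨C.len - b + j, by omega, by omega, ?_⟩
    beta_reduce
    rw [show (b : ℤ) + (C.len - b + j) = j + C.len by ring, hc.add_len]
  · exact ⟨j - b, by omega, by omega, by simp⟩

theorem two_mul_le (h : lab.IsCanonical S k) (h2 : C.numActive S = 2) : 2 * k ≤ C.len := by
  have hpos := h.pos h2.ge
  obtain ⟨hk, h0, hkact, -⟩ := hasMaxActive_iff.1 h.1
  have hc := lab.isParam_param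
  have hne : lab.param 0 ≠ lab.param k := fun e => by
    have := hc.inj e (by omega) (by omega)
    omega
  have := h.add_gap_le hc (a := 0) (Nat.zero_le k) hk.le hkact fun j hj hjact => by
    rcases Cycle.eq_or_eq_of_numActive h2 h0 hkact hne hjact with e | e <;>
    · have := hc.inj e (by omega) (by omega)
      omega
  omega

theorem hasGeodesicTriple (h : lab.IsCanonical S k) (hk : C.len < 2 * k) :
    C.HasGeodesicTriple S := by
  classical
  obtain ⟨hkn, h0, hkact, hall⟩ := hasMaxActive_iff.1 h.1
  have hc := lab.isParam_param
  set c := lab.param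
  -- `a` and `b` are the last active index in the first half and the first one in the second.
  obtain ⟨a, han, ha, hamax⟩ : ∃ a ≤ C.len / 2, C.IsActive S (c (a : ℕ)) ∧
      ∀ j : ℕ, j ≤ C.len / 2 → C.IsActive S (c j) → j ≤ a :=
    ⟨Nat.findGreatest (fun i => C.IsActive S (c i)) (C.len / 2), Nat.findGreatest_le _,
      Nat.findGreatest_spec (P := fun i => C.IsActive S (c i)) (Nat.zero_le _) (by simpa using h0),
      fun j hj hjact => Nat.le_findGreatest hj hjact⟩
  obtain ⟨b, ⟨hbn, hb⟩, hbmin⟩ : ∃ b : ℕ, (C.len / 2 < b ∧ C.IsActive S (c b)) ∧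
      ∀ j : ℕ, C.len / 2 < j → C.IsActive S (c j) → b ≤ j := by
    have hex : ∃ b : ℕ, C.len / 2 < b ∧ C.IsActive S (c b) := ⟨k, by omega, hkact⟩
    exact ⟨Nat.find hex, Nat.find_spec hex, fun j hj hjact => Nat.find_min' hex ⟨hj, hjact⟩⟩
  have hbk : b ≤ k := hbmin k (by omega) hkact
  have hgap := h.add_gap_le hc (a := a) (b := b) (by omega) (by omega) hb fun j _ hjact =>
    (le_or_gt j (C.len / 2)).imp (fun hj => hamax j hj hjact) fun hj => hbmin j hj hjact
  by_cases hka : 2 * (k - a) ≤ C.len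
  · exact ⟨c, a, k, hc, h0, ha, hkact, by omega, by omega, by omega, by omega, by omega, by omega⟩
  · exact ⟨_, b - a, k - a, hc.shift a, by simpa using ha, by simpa using hb,
      by simpa using hkact, by omega, by omega, by omega, by omega, by omega, by omega⟩

end Labelling.IsCanonical

namespace Cycle.HasGeodesicTriple

theorem not_isCritical (hG : IsCactus G) (h : C.HasGeodesicTriple S) (v : V) :
    ¬ C.IsCritical κ S v := by
  intro hcrit
  obtain ⟨c, p, q, hc, h0, hp, hq, hp0, hpq, hqn, hp2, hpq2, hq2⟩ := h
  obtain ⟨c', k, hk, hc', -, hall⟩ := hcrit.exists_isParam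
  have hlt := κ.critBound_lt C
  -- Within the window `c' 0, …, c' k` the metric is that of a line, which rules out a triple whose
  -- pairwise distances add up to the length of the cycle.
  have hline : ∀ {a b : ℤ}, 0 ≤ a → a ≤ k → 0 ≤ b → b ≤ k →
      (G.dist (c' a) (c' b) : ℤ) = max (b - a) (a - b) := fun {a b} ha hak hb hbk => by
    rcases le_total a b with hab | hab
    · rw [hG.dist_param hc' hab (by omega)]
      omega
    · rw [SimpleGraph.dist_comm, hG.dist_param hc' hab (by omega)]
      omega
  obtain ⟨x, hx0, hxk, hx⟩ := hall _ h0
  obtain ⟨y, hy0, hyk, hy⟩ := hall _ hp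
  obtain ⟨z, hz0, hzk, hz⟩ := hall _ hq
  have hxy := hG.dist_param hc (i := 0) (j := p) (by omega) (by omega)
  have hyz := hG.dist_param hc (i := p) (j := q) (by omega) (by omega)
  have hxz := hG.dist_param hc (i := 0) (j := q) (by omega) (by omega)
  rw [← hx, ← hy, hline hx0 hxk hy0 hyk] at hxy
  rw [← hy, ← hz, hline hy0 hyk hz0 hzk] at hyz
  rw [← hx, ← hz, hline hx0 hxk hz0 hzk] at hxz
  omega

theorem three_le_numActive [Finite V] (h : C.HasGeodesicTriple S) : 3 ≤ C.numActive S := by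
  obtain ⟨c, p, q, hc, h0, hp, hq, hp0, hpq, hqn, -⟩ := h
  have hne : ∀ {i j : ℤ}, 0 ≤ i → i < j → j < C.len → c i ≠ c j := fun hi hij hj e => by
    have := hc.inj e (by omega) (by omega)
    omega
  have hcard : ({c 0, c p, c q} : Set V).ncard = 3 := Set.ncard_eq_three.2
    ⟨_, _, _, hne le_rfl hp0 (hpq.trans hqn), hne le_rfl (hp0.trans hpq) hqn,
      hne hp0.le hpq hqn, rfl⟩
  rw [← hcard]
  refine Set.ncard_le_ncard ?_ (Set.toFinite _)
  rintro _ (rfl | rfl | rfl) <;> assumption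

end Cycle.HasGeodesicTriple

end Canonical

/-! ### Shadows -/

section Shadow

variable {V : Type*} {G : SimpleGraph V} {C : Cycle G} {S : Finset V} {κ : Kind} {c : ℤ → V} {k : ℕ}

namespace Kind

/-- `κ.Beyond a b`: a neighbour at distance `b` from a landmark cannot be told apart, by that
landmark, from the other neighbours lying behind a vertex at distance `a`. For edges a neighbour at
the same distance already qualifies, since an edge is as far as its nearer end. -/
def Beyond : Kind → ℕ → ℕ → Prop
  | .vertex, a, b => b = a + 1
  | .edge, a, b => a ≤ b

theorem beyond_succ (κ : Kind) (a : ℕ) : κ.Beyond a (a + 1) := by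
  cases κ <;> simp [Beyond]

theorem Beyond.le {a b : ℕ} (h : κ.Beyond a b) : a ≤ b := by
  cases κ <;> simp only [Beyond] at h <;> omega

end Kind

/-- `y` is a shadow of `v`: a neighbour of `v` lying behind `v` as seen from every element of `S`.
Two shadows of one vertex are not distinguished by `S`. -/
def IsShadow (G : SimpleGraph V) (κ : Kind) (S : Finset V) (v y : V) : Prop :=
  G.Adj v y ∧ ∀ s ∈ S, κ.Beyond (G.dist s v) (G.dist s y)

/-- Every vertex has at most one shadow, as is necessary for `S` to be a metric generator. -/
def HasUniqueShadows (G : SimpleGraph V) (κ : Kind) (S : Finset V) : Prop :=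
  ∀ v y y', IsShadow G κ S v y → IsShadow G κ S v y' → y = y'

theorem isShadow_of_forall_notMem_branch (hconn : G.Connected) {v z : V} (hvz : G.Adj v z)
    (hfree : ∀ s ∈ S, s ∉ branch G v z) : IsShadow G κ S v z := by
  refine ⟨hvz, fun s hs => ?_⟩
  rw [dist_eq_of_mem_branch hconn (hfree s hs) (mem_branch_self hvz.ne'),
    dist_eq_one_iff_adj.2 hvz]
  exact κ.beyond_succ _

theorem IsShadow.notMem_branch (hconn : G.Connected) {v y s : V} (h : IsShadow G κ S v y)
    (hb : G.IsBridge s(v, y)) (hs : s ∈ S) : s ∉ branch G v y := by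
  intro hsb
  have h1 := dist_eq_of_mem_branch hconn (notMem_branch_of_isBridge hb hsb)
    (mem_branch_self h.1.ne)
  rw [dist_eq_one_iff_adj.2 h.1.symm] at h1
  have := (h.2 s hs).le
  omega

namespace IsCactus

theorem beyond_dist_iff (hG : IsCactus G) (hc : C.IsParam c) {s : V} {j : ℤ} (hj0 : 0 ≤ j)
    (hj : j < C.len) (hs : c j = C.root s) :
    κ.Beyond (G.dist s (c 0)) (G.dist s (c (-1))) ↔ j ≤ κ.critBound C.len := by
  have h3 := C.three_le_len
  have h0 := hG.dist_param hc (i := 0) (j := j) (by omega) (by omega)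
  have h1 := hG.dist_param hc (i := -1) (j := j) (by omega) (by omega)
  rw [hG.dist_eq_of_mem (s := s) (hc.mem 0), hG.dist_eq_of_mem (s := s) (hc.mem (-1)), ← hs,
    SimpleGraph.dist_comm (u := c j), SimpleGraph.dist_comm (u := c j)]
  cases κ <;> simp only [Kind.Beyond, Kind.critBound] <;> omega

theorem isShadow_iff_activeWithin (hG : IsCactus G) (hc : C.IsParam c) :
    IsShadow G κ S (c 0) (c (-1)) ↔ C.ActiveWithin S c (κ.critBound C.len) := by
  have hlt := κ.critBound_lt C
  constructor
  · intro h v hv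
    obtain ⟨s, hs, rfl⟩ := hG.isActive_iff.1 hv
    obtain ⟨j, hj0, hj, hjs⟩ := hc.exists_rep 0 (hG.root_mem C s)
    exact ⟨j, hj0, (hG.beyond_dist_iff hc hj0 (by omega) hjs).1 (h.2 s hs), hjs⟩
  · refine fun h => ⟨(hc.adj_pred 0).adj_sub, fun s hs => ?_⟩
    obtain ⟨j, hj0, hjk, hjs⟩ := h _ (hG.isActive_iff.2 ⟨s, hs, rfl⟩)
    exact (hG.beyond_dist_iff hc hj0 (by omega) hjs).2 hjk

theorem exists_isShadow (hG : IsCactus G) (hc : C.IsParam c)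
    (hall : C.ActiveWithin S c k) (hk : k ≤ κ.critBound C.len) {i : ℕ}
    (hi : (k ≤ i ∧ i ≤ κ.critBound C.len) ∨
      (C.len + k ≤ i + κ.critBound C.len ∧ i < C.len) ∨ i = 0) :
    ∃ y, C.1.Adj (c i) y ∧ IsShadow G κ S (c i) y := by
  rcases hi with ⟨hki, hi⟩ | ⟨hki, hi⟩ | rfl
  · have hact : C.ActiveWithin S (fun j => c (i - j)) (κ.critBound C.len) :=
      ((hall.mono hki).reflect).mono hi
    have := (hG.isShadow_iff_activeWithin (hc.reflect i)).2 hact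
    exact ⟨_, hc.adj_succ i, by simpa using this⟩
  · have hact : C.ActiveWithin S (fun j => c (i + j)) (κ.critBound C.len) := by
      intro v hv
      obtain ⟨j, hj0, hjk, rfl⟩ := hall v hv
      refine ⟨j + C.len - i, by omega, by omega, ?_⟩
      beta_reduce
      rw [show (i : ℤ) + (j + C.len - i) = j + C.len by ring, hc.add_len]
    have := (hG.isShadow_iff_activeWithin (hc.shift i)).2 hact
    exact ⟨_, hc.adj_pred i, by simpa [sub_eq_add_neg] using this⟩
  · exact ⟨_, hc.adj_pred 0, (hG.isShadow_iff_activeWithin hc).2 (hall.mono hk)⟩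

end IsCactus

theorem Cycle.IsCritical.exists_isShadow (hG : IsCactus G) {v : V} (h : C.IsCritical κ S v) :
    ∃ y, C.1.Adj v y ∧ IsShadow G κ S v y := by
  obtain ⟨c, k, hk, hc, rfl, hall⟩ := h.exists_isParam
  exact ⟨_, hc.adj_pred 0, (hG.isShadow_iff_activeWithin hc).2 (hall.mono hk)⟩

namespace IsShadow

theorem isCritical (hG : IsCactus G) {v y : V} (h : IsShadow G κ S v y)
    (hvy : C.1.Adj v y) (hv : C.IsActive S v) : C.IsCritical κ S v := by
  obtain ⟨c, hc, rfl, rfl⟩ := Cycle.exists_isParam_zero_one hvy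
  have hc' := hc.reflect 0
  have hact := (hG.isShadow_iff_activeWithin hc').1 (by simpa using h)
  obtain ⟨k, hk, hkact, hall⟩ := hact.exists_max hv
  simpa using hG.isCritical_of_activeWithin hc' (by simpa using hv) hkact hall hk

theorem eq_of_adj (hG : IsCactus G) (h2 : 2 ≤ C.numActive S) {v y y' : V}
    (h : IsShadow G κ S v y) (hy : C.1.Adj v y) (h' : IsShadow G κ S v y') (hy' : C.1.Adj v y') :
    y = y' := by
  obtain ⟨c, hc, rfl, rfl⟩ := Cycle.exists_isParam_zero_one hy
  rcases hc.adj_cases hy' with rfl | rfl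
  · simp
  -- The active vertices would lie both within `c 0, c 1, …` and within `c 0, c (-1), …`.
  exfalso
  have hlt := κ.critBound_lt C
  have hpos := (hG.isShadow_iff_activeWithin hc).1 h'
  have hneg := (hG.isShadow_iff_activeWithin (κ := κ) (S := S) (hc.reflect 0)).1 (by simpa using h)
  obtain ⟨u, hu, hne⟩ := Cycle.exists_active_ne h2 (c 0)
  obtain ⟨i, hi0, hi1, hi⟩ := hpos u hu
  obtain ⟨j, hj0, hj1, hj⟩ := hneg u hu
  have := hc.inj (hi.trans hj.symm) (by omega) (by omega)
  obtain rfl : i = 0 := by omega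
  exact hne hi.symm

end IsShadow

/-- `S` is a vertex or an edge metric generator, according to the kind. -/
def IsGenerator [Fintype V] (G : SimpleGraph V) : Kind → Finset V → Prop
  | .vertex, S => IsVertexGenerator G S
  | .edge, S => IsEdgeGenerator G S

theorem edgeDist_mk (s x y : V) : edgeDist G s s(x, y) = min (G.dist s x) (G.dist s y) := rfl

theorem IsGenerator.hasUniqueShadows [Fintype V] (h : IsGenerator G κ S) :
    HasUniqueShadows G κ S := by
  intro v y y' hy hy'
  by_contra hne
  cases κ with
  | vertex =>
    obtain ⟨s, hs, hd⟩ := h y y' hne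
    exact hd ((hy.2 s hs).trans (hy'.2 s hs).symm)
  | edge =>
    obtain ⟨s, hs, hd⟩ := h s(v, y) (by simpa using hy.1) s(v, y') (by simpa using hy'.1)
      (by simpa [Sym2.eq_iff, hne] using fun h1 h2 => hne (h2.trans h1))
    rw [edgeDist_mk, edgeDist_mk, min_eq_left (hy.2 s hs).le, min_eq_left (hy'.2 s hs).le] at hd
    exact hd rfl

namespace HasUniqueShadows

theorem isBiactive [Finite V] (hG : IsCactus G) (h : HasUniqueShadows G κ S) :
    IsBiactive G S := by
  intro C
  have h3 := C.three_le_len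
  by_contra hlt
  have hle : {v | C.IsActive S v}.ncard ≤ 1 := by
    unfold Cycle.numActive at hlt
    omega
  obtain ⟨v, hv, hall⟩ : ∃ v ∈ C.1.verts, ∀ w, C.IsActive S w → w = v := by
    by_cases hne : ∃ v, C.IsActive S v
    · obtain ⟨v, hv⟩ := hne
      exact ⟨v, hv.1, fun w hw => (Set.ncard_le_one (Set.toFinite _)).1 hle w hw v hv⟩
    · obtain ⟨c, hc⟩ := C.exists_isParam
      exact ⟨c 0, hc.mem 0, fun w hw => absurd ⟨w, hw⟩ hne⟩
  -- With a single active vertex, both its neighbours on `C` are shadows.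
  obtain ⟨c, hc, rfl⟩ := Cycle.exists_isParam_zero hv
  have hpred := (hG.isShadow_iff_activeWithin (κ := κ) hc).2
    fun w hw => ⟨0, le_rfl, by omega, (hall w hw).symm⟩
  have hsucc := (hG.isShadow_iff_activeWithin (κ := κ) (S := S) (hc.reflect 0)).2
    fun w hw => ⟨0, le_rfl, by omega, by simpa using (hall w hw).symm⟩
  have := hc.inj (h _ _ _ hpred (by simpa using hsucc)) (by omega) (by omega)
  omega

theorem not_adj_criticalGraph (hG : IsCactus G) (h : HasUniqueShadows G κ S)
    (C D : Cycle G) : ¬ (criticalGraph G κ S).Adj C D := by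
  rintro ⟨hne, v, hC, hD⟩
  obtain ⟨y, hy, hs⟩ := hC.exists_isShadow hG
  obtain ⟨y', hy', hs'⟩ := hD.exists_isShadow hG
  obtain rfl := h _ _ _ hs hs'
  exact hne (hG.eq_of_adj hy hy')

end HasUniqueShadows

end Shadow

/-! ### Free threads and configurations -/

section FreeThread

variable {V : Type*} [Fintype V] {G : SimpleGraph V} [DecidableRel G.Adj] {C : Cycle G}
  {S : Finset V} {κ : Kind} {v : V} {l : List V}

theorem IsWeaklyBiactive.exists_isTail_of_not_isActive (hG : IsCactus G)
    (hbr : IsBranchResolving G S) (hS : IsWeaklyBiactive G S) (hv : v ∈ C.1.verts)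
    (h : ¬ C.IsActive S v) {w : V} (hw : G.Adj v w) (hw' : ¬ C.1.Adj v w) :
    (∀ s ∈ S, s ∉ branch G v w) ∧ ∃ l, IsTail G v w l := by
  have hfree : ∀ s ∈ S, s ∉ branch G v w := fun s hs hsb =>
    h ⟨hv, s, hs, hG.branch_subset_comp hv hw hw' hsb⟩
  exact ⟨hfree, (isBridge_and_exists_isTail_of_free hG hbr hS hw hfree).2⟩

theorem Cycle.IsBranchActive.isActive (hG : IsCactus G) (hbr : IsBranchResolving G S)
    (hS : IsWeaklyBiactive G S) (h : C.IsBranchActive v) : C.IsActive S v := by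
  by_contra hv
  exact hbr.not_isBranchActive h.1
    (fun w hw hw' => hS.exists_isTail_of_not_isActive hG hbr h.1 hv hw hw') h

theorem IsWeaklyBiactive.isBiactive (hG : IsCactus G) (hbr : IsBranchResolving G S)
    (hS : IsWeaklyBiactive G S) : IsBiactive G S := by
  intro C
  refine (hS C).trans (Set.ncard_le_ncard ?_ (Set.toFinite _))
  rintro v (hv | hv)
  · exact hv.isActive hG hbr hS
  · exact hv

theorem exists_isFreeThread_of_mem_comp (hG : IsCactus G) (hbr : IsBranchResolving G S)
    (hS : IsBiactive G S) (hv : v ∈ C.1.verts) (h : ¬ C.IsActive S v) {x : V}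
    (hx : x ∈ C.comp v) (hxv : x ≠ v) : ∃ l, IsFreeThread G S v l ∧ x ∈ l := by
  obtain ⟨z, hz, hz', hxz⟩ := Cycle.exists_branch hx hxv
  obtain ⟨hfree, l, hl⟩ :=
    hS.isWeaklyBiactive.exists_isTail_of_not_isActive hG hbr hv h hz hz'
  exact ⟨l, hl.isFreeThread (Cycle.three_le_degree hv hz hz') hfree, hl.mem_iff_mem_branch.2 hxz⟩

namespace IsFreeThread

theorem exists_branch (h : IsFreeThread G S v l) :
    ∃ z, G.Adj v z ∧ (∀ x, x ∈ l ↔ x ∈ branch G v z) ∧ ∀ s ∈ S, s ∉ branch G v z := by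
  obtain ⟨z, hz⟩ := h.1.exists_isTail
  exact ⟨z, hz.adj, fun x => hz.mem_iff_mem_branch,
    fun s hs hsz => h.2 s (hz.mem_iff_mem_branch.2 hsz) hs⟩

theorem dist_eq (hconn : G.Connected) (h : IsFreeThread G S v l) {x s : V} (hx : x ∈ l)
    (hs : s ∈ S) : G.dist s x = G.dist s v + G.dist v x := by
  obtain ⟨z, -, hmem, hfree⟩ := h.exists_branch
  exact dist_eq_of_mem_branch hconn (hfree s hs) ((hmem x).1 hx)

theorem exists_isShadow (hconn : G.Connected) (h : IsFreeThread G S v l) (κ : Kind) :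
    ∃ z ∈ l, IsShadow G κ S v z := by
  obtain ⟨z, hvz, hmem, hfree⟩ := h.exists_branch
  exact ⟨z, (hmem z).2 (mem_branch_self hvz.ne'),
    isShadow_of_forall_notMem_branch hconn hvz hfree⟩

end IsFreeThread

/-- The common form of the configurations `ℬ` and `𝒟`. -/
def Labelling.ConfigThread (lab : Labelling C) (κ : Kind) (S : Finset V) (k : ℕ) : Prop :=
  k ≤ κ.critBound C.len ∧ ∃ i l, IsFreeThread G S (lab.vert i) l ∧
    ((k ≤ i ∧ i ≤ κ.critBound C.len) ∨ (C.len + k ≤ i + κ.critBound C.len ∧ i < C.len) ∨ i = 0)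

/-- Configuration `𝒞` or `ℰ`, according to the kind. -/
def Labelling.ConfigLong (lab : Labelling C) (S : Finset V) (k : ℕ) : Kind → Prop
  | .vertex => lab.ConfigC S k
  | .edge => lab.ConfigE S k

theorem Labelling.configB_iff {lab : Labelling C} {k : ℕ} :
    lab.ConfigB S k ↔ lab.ConfigThread .vertex S k := by
  have h3 := C.three_le_len
  refine and_congr Iff.rfl (exists₂_congr fun i l => and_congr Iff.rfl ?_)
  simp only [Kind.critBound]
  omega

theorem Labelling.configD_iff {lab : Labelling C} {k : ℕ} :
    lab.ConfigD S k ↔ lab.ConfigThread .edge S k := by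
  have h3 := C.three_le_len
  refine and_congr Iff.rfl (exists₂_congr fun i l => and_congr Iff.rfl ?_)
  simp only [Kind.critBound]
  omega

theorem Cycle.containsConfig_iff : C.ContainsConfig κ S ↔
    ∃ (lab : Labelling C) (k : ℕ), lab.IsCanonical S k ∧
      (lab.ConfigA S k ∨ lab.ConfigThread κ S k ∨ lab.ConfigLong S k κ) := by
  unfold Cycle.ContainsConfig
  cases κ <;> simp only [Labelling.configB_iff, Labelling.configD_iff, Labelling.ConfigLong]

/-- `S` is a biactive branch-resolving set without configurations and critical incidences. These
are exactly the metric generators of a cactus other than a path. -/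
def IsGood (G : SimpleGraph V) [DecidableRel G.Adj] (κ : Kind) (S : Finset V) : Prop :=
  (IsBiactive G S ∧ IsBranchResolving G S) ∧ (∀ C : Cycle G, ¬ C.ContainsConfig κ S) ∧
    ∀ C D, ¬ (criticalGraph G κ S).Adj C D

namespace HasUniqueShadows

theorem isBranchResolving (hG : IsCactus G) (h : HasUniqueShadows G κ S) :
    IsBranchResolving G S := by
  intro v l hl l' hl'
  obtain ⟨z, hz, hs⟩ := hl.exists_isShadow hG.1 κ
  obtain ⟨z', hz', hs'⟩ := hl'.exists_isShadow hG.1 κ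
  obtain rfl := h _ _ _ hs hs'
  exact (hl.1.eq_of_mem hl'.1 hz hz').2

theorem not_configThread (hG : IsCactus G) (h : HasUniqueShadows G κ S)
    {lab : Labelling C} {k : ℕ} (hcan : lab.IsCanonical S k) : ¬ lab.ConfigThread κ S k := by
  rintro ⟨hk, i, l, hl, hi⟩
  have hlt := κ.critBound_lt C
  obtain ⟨-, -, -, hall⟩ := Labelling.hasMaxActive_iff.1 hcan.1
  rw [← lab.param_natCast (by omega)] at hl
  obtain ⟨y, hy, hs⟩ := hG.exists_isShadow lab.isParam_param hall hk hi
  obtain ⟨z, hz, hs'⟩ := hl.exists_isShadow hG.1 κ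
  obtain rfl := h _ _ _ hs hs'
  exact hl.1.notMem_verts hz C hy.snd_mem

end HasUniqueShadows

end FreeThread

/-! ### Generators are good -/

section Necessity

variable {V : Type*} {G : SimpleGraph V} {C : Cycle G} {S : Finset V} {κ : Kind}
  {lab : Labelling C} {k : ℕ}

namespace Labelling.HasMaxActive

theorem root_eq_or (hG : IsCactus G) (hmax : lab.HasMaxActive S k) (hpos : 0 < k)
    (h2 : C.numActive S = 2) {s : V} (hs : s ∈ S) :
    C.root s = lab.param 0 ∨ C.root s = lab.param k := by
  obtain ⟨hk, h0, hkact, -⟩ := hasMaxActive_iff.1 hmax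
  refine Cycle.eq_or_eq_of_numActive h2 h0 hkact (fun e => ?_) (hG.isActive_iff.2 ⟨s, hs, rfl⟩)
  have := lab.isParam_param.inj e (by omega) (by omega)
  omega

theorem dist_one_eq_dist_neg_one (hG : IsCactus G) (hmax : lab.HasMaxActive S k) (hpos : 0 < k)
    (h2 : C.numActive S = 2) (hk : 2 * k = C.len) {s : V} (hs : s ∈ S) :
    G.dist s (lab.param 1) = G.dist s (lab.param (-1)) := by
  have hc := lab.isParam_param
  have h3 := C.three_le_len
  rw [hG.dist_eq_of_mem (s := s) (hc.mem 1), hG.dist_eq_of_mem (s := s) (hc.mem (-1))]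
  rcases hmax.root_eq_or hG hpos h2 hs with e | e <;> rw [e]
  · have hright := hG.dist_param hc (i := 0) (j := 1) (by omega) (by omega)
    have hleft := hG.dist_param hc (i := -1) (j := 0) (by omega) (by omega)
    rw [SimpleGraph.dist_comm] at hleft
    omega
  · have hright := hG.dist_param hc (i := 1) (j := k) (by omega) (by omega)
    have hleft := hG.dist_param hc (i := -1) (j := k) (by omega) (by omega)
    rw [SimpleGraph.dist_comm] at hright hleft
    omega

/-- The reflection `i ↦ k - i` exchanges the two active vertices, so the vertices antipodal to
`v_{k-i}` are at the same distance from both of them, up to the shift `g/2 - k`, as `v_i`. -/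
theorem min_dist_antipodes (hG : IsCactus G) (hmax : lab.HasMaxActive S k) (hpos : 0 < k)
    (h2 : C.numActive S = 2) (hk : 2 * k ≤ C.len) {i : ℕ} (hik : i ≤ k) {s : V} (hs : s ∈ S) :
    min (G.dist s (lab.param (C.len / 2 + k - i : ℕ)))
      (G.dist s (lab.param ((C.len + 1) / 2 + k - i : ℕ))) =
    G.dist s (lab.param i) + (C.len / 2 - k) := by
  have hc := lab.isParam_param
  set a : ℕ := C.len / 2 + k - i
  set b : ℕ := (C.len + 1) / 2 + k - i
  rw [hG.dist_eq_of_mem (s := s) (hc.mem a), hG.dist_eq_of_mem (s := s) (hc.mem b),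
    hG.dist_eq_of_mem (s := s) (hc.mem i)]
  rcases hmax.root_eq_or hG hpos h2 hs with e | e <;> rw [e]
  · have hi := hG.dist_param hc (i := 0) (j := i) (by omega) (by omega)
    have hda := hG.dist_param hc (i := 0) (j := a) (by omega) (by omega)
    have hdb := hG.dist_param hc (i := 0) (j := b) (by omega) (by omega)
    omega
  · have hi := hG.dist_param hc (i := i) (j := k) (by omega) (by omega)
    have hda := hG.dist_param hc (i := k) (j := a) (by omega) (by omega)
    have hdb := hG.dist_param hc (i := k) (j := b) (by omega) (by omega)
    rw [SimpleGraph.dist_comm] at hi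
    omega

end Labelling.HasMaxActive

namespace IsGenerator

variable [Fintype V]

theorem not_configA (hG : IsCactus G) (h : IsGenerator G κ S) (hcan : lab.IsCanonical S k) :
    ¬ lab.ConfigA S k := by
  rintro ⟨h2, heven, hk⟩
  have hpos := hcan.pos h2.ge
  have hlen : 2 * k = C.len := hk ▸ Nat.two_mul_div_two_of_even heven
  have hc := lab.isParam_param
  have hdist := fun s hs => hcan.1.dist_one_eq_dist_neg_one hG hpos h2 hlen (s := s) hs
  have hne : lab.param 1 ≠ lab.param (-1) := fun e => by
    have h3 := C.three_le_len
    have := hc.inj e (by omega) (by omega)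
    omega
  cases κ with
  | vertex =>
    obtain ⟨s, hs, hd⟩ := h _ _ hne
    exact hd (hdist s hs)
  | edge =>
    have hsucc : G.Adj (lab.param 0) (lab.param 1) := (hc.adj_succ 0).adj_sub
    have hpred : G.Adj (lab.param 0) (lab.param (-1)) := (hc.adj_pred 0).adj_sub
    obtain ⟨s, hs, hd⟩ := h s(lab.param 0, lab.param 1) hsucc s(lab.param 0, lab.param (-1)) hpred
      (by simpa [Sym2.eq_iff, hne] using fun h1 h2 => hne (h2.trans h1))
    rw [edgeDist_mk, edgeDist_mk, hdist s hs] at hd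
    exact hd rfl

theorem two_mul_lt_len (hG : IsCactus G) (h : IsGenerator G κ S) (hcan : lab.IsCanonical S k)
    (h2 : C.numActive S = 2) : 2 * k < C.len :=
  (hcan.two_mul_le h2).lt_of_ne fun hk =>
    h.not_configA hG hcan ⟨h2, ⟨k, by omega⟩, by omega⟩

variable [DecidableRel G.Adj]

theorem not_configC (hG : IsCactus G) (h : IsGenerator G .vertex S)
    (hcan : lab.IsCanonical S k) : ¬ lab.ConfigC S k := by
  rintro ⟨h2, ⟨m, hm⟩, -, i, l, hik, hl, hlen⟩
  have hlt := h.two_mul_lt_len hG hcan h2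
  rw [← lab.param_natCast (by omega)] at hl
  obtain ⟨z, hz⟩ := hl.1.exists_isTail
  obtain ⟨x, hx, hxd⟩ := hz.exists_dist_eq hG.1 (m := C.len / 2 - k) (by omega) hlen
  have hxC : x ≠ lab.param (C.len / 2 + k - i : ℕ) := by
    rintro rfl
    exact hl.1.notMem_verts hx C (lab.isParam_param.mem _)
  obtain ⟨s, hs, hd⟩ := h _ _ hxC
  have hanti := hcan.1.min_dist_antipodes hG (hcan.pos h2.ge) h2 hlt.le hik hs
  rw [show (C.len + 1) / 2 = C.len / 2 by omega, min_self] at hanti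
  exact hd (by rw [hl.dist_eq hG.1 hx hs, hxd, hanti])

/-- The edge antipodal to `v_{k-i}` if the cycle is odd, the last edge of the thread hanging at the
vertex antipodal to `v_{k-i}` if it is even. -/
theorem exists_antipodal_edge (hG : IsCactus G) (hcan : lab.IsCanonical S k)
    (h2 : C.numActive S = 2) (hk : 2 * k < C.len) {i : ℕ} (hik : i ≤ k) {l : List V}
    (hl : IsThread G (lab.param i) l)
    (heven : Even C.len → ∃ l', IsFreeThread G S (lab.vert (C.len / 2 + k - i)) l') :
    ∃ f ∈ G.edgeSet, (∀ x ∈ l, x ∉ f) ∧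
      ∀ s ∈ S, edgeDist G s f = G.dist s (lab.param i) + (C.len / 2 - k) := by
  have hc := lab.isParam_param
  have hanti := fun s hs => hcan.1.min_dist_antipodes hG (hcan.pos h2.ge) h2 hk.le hik (s := s) hs
  have hlC : ∀ x ∈ l, ∀ j, x ≠ lab.param j := by
    rintro x hx j rfl
    exact hl.notMem_verts hx C (hc.mem j)
  by_cases hev : Even C.len
  · obtain ⟨l', hl'⟩ := heven hev
    rw [Nat.even_iff] at hev
    rw [← lab.param_natCast (by omega)] at hl'
    rw [show (C.len + 1) / 2 = C.len / 2 by omega] at hanti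
    obtain ⟨z, hz⟩ := hl'.1.exists_isTail
    refine ⟨s(lab.param (C.len / 2 + k - i : ℕ), z), hz.adj, fun x hx => ?_, fun s hs => ?_⟩
    · rw [Sym2.mem_iff, not_or]
      refine ⟨hlC x hx _, ?_⟩
      rintro rfl
      have := hc.inj (hl.eq_of_mem hl'.1 hx hz.mem).1 (by omega) (by omega)
      omega
    · rw [edgeDist_mk, hl'.dist_eq hG.1 hz.mem hs, min_eq_left le_self_add, ← hanti s hs, min_self]
  · rw [Nat.not_even_iff] at hev
    refine ⟨s(lab.param (C.len / 2 + k - i : ℕ), lab.param ((C.len + 1) / 2 + k - i : ℕ)), ?_,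
      fun x hx => ?_, hanti⟩
    · rw [show ((C.len + 1) / 2 + k - i : ℕ) = (C.len / 2 + k - i) + 1 by omega, Nat.cast_succ]
      exact (hc.adj_succ _).adj_sub
    · exact Sym2.mem_iff.not.2 (not_or.2 ⟨hlC x hx _, hlC x hx _⟩)

theorem not_configE (hG : IsCactus G) (h : IsGenerator G .edge S)
    (hcan : lab.IsCanonical S k) : ¬ lab.ConfigE S k := by
  rintro ⟨h2, i, l, hik, hl, hlen, heven⟩
  have hlt := h.two_mul_lt_len hG hcan h2
  rw [← lab.param_natCast (by omega)] at hl
  obtain ⟨f, hf, hlf, hfd⟩ := exists_antipodal_edge hG hcan h2 hlt hik hl.1 heven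
  obtain ⟨z, hz⟩ := hl.1.exists_isTail
  obtain ⟨x, hx, hxd⟩ := hz.exists_dist_eq hG.1 (m := C.len / 2 - k + 1) (by omega) (by omega)
  obtain ⟨y, hyx, hyd⟩ := exists_adj_dist_eq hG.1 hxd
  have hdist : ∀ s ∈ S, G.dist s y = G.dist s (lab.param i) + G.dist (lab.param i) y := by
    intro s hs
    rcases hz.mem_or_eq_of_adj hx hyx.symm with hy | rfl
    · exact hl.dist_eq hG.1 hy hs
    · simp
  obtain ⟨s, hs, hd⟩ := h s(y, x) hyx f hf (by rintro rfl; exact hlf x hx (by simp))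
  refine hd ?_
  rw [hfd s hs, edgeDist_mk, hdist s hs, hl.dist_eq hG.1 hx hs]
  omega

theorem isGood (hG : IsCactus G) (h : IsGenerator G κ S) : IsGood G κ S := by
  have hu := h.hasUniqueShadows
  refine ⟨⟨hu.isBiactive hG, hu.isBranchResolving hG⟩, fun C hC => ?_,
    hu.not_adj_criticalGraph hG⟩
  obtain ⟨lab, k, hcan, hA | hT | hL⟩ := Cycle.containsConfig_iff.1 hC
  · exact h.not_configA hG hcan hA
  · exact hu.not_configThread hG hcan hT
  · cases κ with
    | vertex => exact h.not_configC hG hcan hL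
    | edge => exact h.not_configE hG hcan hL

end IsGenerator

end Necessity

/-! ### Paths -/

section Path

variable {V : Type*} [Fintype V] {G : SimpleGraph V} [DecidableRel G.Adj]

theorem dist_injective_of_degree_le_two (hconn : G.Connected) (hdeg : ∀ x, G.degree x ≤ 2) {u : V}
    (hu : G.degree u ≤ 1) : Function.Injective (G.dist u) := by
  intro x y h
  induction hm : G.dist u x generalizing x y with
  | zero =>
    exact (hconn.dist_eq_zero_iff.1 hm).symm.trans (hconn.dist_eq_zero_iff.1 (h ▸ hm))
  | succ m ih =>
    obtain ⟨x', hx', hxm⟩ := exists_adj_dist_eq hconn hm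
    obtain ⟨y', hy', hym⟩ := exists_adj_dist_eq hconn (h ▸ hm)
    obtain rfl := ih (hxm.trans hym.symm) hxm
    by_contra hne
    rcases Nat.eq_zero_or_pos m with rfl | hpos
    · obtain rfl := hconn.dist_eq_zero_iff.1 hxm
      have := two_le_degree hx' hy' hne
      omega
    · obtain ⟨w, hw, hwm⟩ := exists_adj_dist_eq hconn (u := u) (x := x') (m := m - 1) (by omega)
      have := three_le_degree hx' hy' hw.symm hne (by rintro rfl; omega) (by rintro rfl; omega)
      have := hdeg x'
      omega

theorem nonempty_iso_pathGraph (hconn : G.Connected) (hdeg : ∀ x, G.degree x ≤ 2) {u : V}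
    (hu : G.degree u ≤ 1) : Nonempty (G ≃g pathGraph (Fintype.card V)) := by
  have hinj := dist_injective_of_degree_le_two hconn hdeg hu
  have hlt : ∀ x, G.dist u x < Fintype.card V := fun x => by
    obtain ⟨p, hp, hpl⟩ := hconn.exists_path_of_dist u x
    exact hpl ▸ hp.length_lt
  let f : V → Fin (Fintype.card V) := fun x => ⟨G.dist u x, hlt x⟩
  have hf : Function.Bijective f := by
    rw [Fintype.bijective_iff_injective_and_card]
    exact ⟨fun x y h => hinj (Fin.ext_iff.1 h), by simp⟩
  have hstep : ∀ x y, G.dist u x + 1 = G.dist u y → G.Adj x y := fun x y h => by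
    obtain ⟨x', hx', hd⟩ := exists_adj_dist_eq hconn h.symm
    rwa [hinj hd] at hx'
  refine ⟨⟨Equiv.ofBijective f hf, fun {x y} => ?_⟩⟩
  rw [pathGraph_adj]
  simp only [Equiv.ofBijective_apply, f]
  constructor
  · rintro (h | h)
    · exact hstep x y h
    · exact (hstep y x h).symm
  · intro h
    have hxy := dist_le_dist_add_one hconn h u
    have hyx := dist_le_dist_add_one hconn h.symm u
    have hne : G.dist u x ≠ G.dist u y := hinj.ne h.ne
    omega

end Path

/-! ### Good sets have unique shadows -/

section Roots

variable {V : Type*} {G : SimpleGraph V} {S : Finset V}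

theorem exists_adj_and_mem_branch (hconn : G.Connected) {v x : V} (h : x ≠ v) :
    ∃ w, G.Adj v w ∧ x ∈ branch G v w := by
  obtain ⟨p, hp⟩ := (hconn.preconnected v x).exists_isPath
  cases p with
  | nil => exact absurd rfl h
  | @cons _ z _ hz q =>
    rw [Walk.cons_isPath_iff] at hp
    exact ⟨z, hz, q, hp.2⟩

namespace IsCactus

theorem root_eq_root (hG : IsCactus G) {C D : Cycle G} (hCD : C ≠ D) {x y : V}
    (hx : x ∈ D.1.verts) (hy : y ∈ D.1.verts) : C.root x = C.root y := by
  obtain ⟨c, hc, rfl⟩ := Cycle.exists_isParam_zero hx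
  obtain ⟨j, hj0, -, rfl⟩ := hc.exists_rep 0 hy
  lift j to ℕ using hj0
  clear hy
  induction j with
  | zero => rfl
  | succ j ih =>
    have hD := hc.adj_succ j
    rw [ih, Nat.cast_succ]
    exact (hG.root_eq_of_adj hD.adj_sub fun hC => hCD (hG.eq_of_adj hC hD)).symm

theorem root_root (hG : IsCactus G) {C D : Cycle G} {x z : V} (hx : x ∈ C.1.verts)
    (hCD : C ≠ D) (hz : D.root z ≠ D.root x) : C.root z = C.root (D.root z) := by
  have hwalk : ∀ {a b : V} (_ : (G.deleteEdges D.1.edgeSet).Walk a b),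
      D.root a = D.root z → C.root b = C.root a := by
    intro a b q
    induction q with
    | nil => exact fun _ => rfl
    | @cons a b d hab _ ih =>
      intro ha
      obtain ⟨hab, hD⟩ := Cycle.deleteEdges_adj_iff.1 hab
      rw [ih ((hG.root_eq_of_adj hab hD).trans ha)]
      refine hG.root_eq_of_adj hab fun hC => hz ?_
      rw [← ha]
      exact hG.root_eq_root hCD.symm hC.fst_mem hx
  obtain ⟨p⟩ : (G.deleteEdges D.1.edgeSet).Reachable (D.root z) z := hG.mem_comp_root D z
  exact hwalk p (hG.root_self (hG.root_mem D z))

theorem isActive_root (hG : IsCactus G) {C D : Cycle G} (hCD : C ≠ D)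
    (h2 : 2 ≤ D.numActive S) {x : V} (hx : x ∈ D.1.verts) : C.IsActive S (C.root x) := by
  obtain ⟨c, hc⟩ := C.exists_isParam
  obtain ⟨u, hu, hne⟩ := Cycle.exists_active_ne h2 (D.root (c 0))
  obtain ⟨s, hs, rfl⟩ := hG.isActive_iff.1 hu
  rw [hG.isActive_iff]
  refine ⟨s, hs, ?_⟩
  rw [hG.root_root (hc.mem 0) hCD hne]
  exact hG.root_eq_root hCD (hG.root_mem D s) hx

theorem isActive_of_mem_of_mem (hG : IsCactus G) {C D : Cycle G} (hCD : C ≠ D)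
    (h2 : 2 ≤ D.numActive S) {v : V} (hC : v ∈ C.1.verts) (hD : v ∈ D.1.verts) :
    C.IsActive S v :=
  hG.root_self hC ▸ hG.isActive_root hCD h2 hD

theorem exists_isCanonical_of_activeWithin (hG : IsCactus G) {C : Cycle G} {c : ℤ → V} {k : ℕ}
    (hc : C.IsParam c) (hk : 2 * k ≤ C.len) (hall : C.ActiveWithin S c k)
    (hkact : C.IsActive S (c k)) :
    ∃ (lab : Labelling C) (m : ℕ), m ≤ k ∧ lab.IsCanonical S m ∧
      ∀ i, lab.param i = c (k - m + i) := by
  obtain ⟨m, hm, hmact, hmall⟩ := hall.reflect.exists_max hkact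
  have hshift : (fun i : ℤ => c (k - (m - i))) = fun i => c (k - m + i) := by
    funext i
    congr 1
    ring
  obtain ⟨lab, hlab, hcan⟩ := hG.exists_isCanonical_of_two_mul_le (hshift ▸ hc.shift (k - m))
    (by simpa using hmact) (by simpa using hkact) hmall.reflect (by omega)
  exact ⟨lab, m, hm, hcan, fun i => by rw [hlab]; exact congrFun hshift i⟩

end IsCactus

end Roots

section UniqueShadows

variable {V : Type*} [Fintype V] {G : SimpleGraph V} [DecidableRel G.Adj] {C : Cycle G}
  {S : Finset V} {κ : Kind} {v y y' : V}

theorem IsShadow.containsConfig_of_isFreeThread (hG : IsCactus G) (h2 : 2 ≤ C.numActive S)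
    (hs : IsShadow G κ S v y) (hvy : C.1.Adj v y) {l : List V} (hl : IsFreeThread G S v l) :
    C.ContainsConfig κ S := by
  have h3 := C.three_le_len
  have hlt := κ.critBound_lt C
  obtain ⟨c, hc, rfl, rfl⟩ : ∃ c, C.IsParam c ∧ c 0 = v ∧ c (-1) = y := by
    obtain ⟨c, hc, h0, h1⟩ := Cycle.exists_isParam_zero_one hvy
    exact ⟨_, hc.reflect 0, by simpa using h0, by simpa using h1⟩
  obtain ⟨u, hu, -⟩ := Cycle.exists_active_ne h2 (c 0)
  obtain ⟨k, hk, hkact, hall⟩ := ((hG.isShadow_iff_activeWithin hc).1 hs).exists_max hu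
  obtain ⟨lab, m, hmk, hcan, hlab⟩ :=
    hG.exists_isCanonical_of_activeWithin hc (by omega) hall hkact
  refine Cycle.containsConfig_iff.2 ⟨lab, m, hcan, Or.inr (Or.inl ⟨by omega, ?_⟩)⟩
  rcases hmk.eq_or_lt with rfl | hmk
  · refine ⟨0, l, ?_, by omega⟩
    rw [← lab.param_natCast (by omega), hlab]
    simpa using hl
  · refine ⟨C.len - (k - m), l, ?_, by omega⟩
    rw [← lab.param_natCast (by omega), hlab,
      show (k : ℤ) - m + ((C.len - (k - m) : ℕ) : ℤ) = 0 + C.len by omega, hc.add_len]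
    exact hl

theorem IsShadow.exists_isTail (hG : IsCactus G) (hbi : IsBiactive G S)
    (hbr : IsBranchResolving G S) (h : IsShadow G κ S v y) (hb : G.IsBridge s(v, y)) :
    (∀ s ∈ S, s ∉ branch G v y) ∧ ∃ l, IsTail G v y l := by
  have hfree : ∀ s ∈ S, s ∉ branch G v y := fun s hs => h.notMem_branch hG.1 hb hs
  exact ⟨hfree, (isBridge_and_exists_isTail_of_free hG hbr hbi.isWeaklyBiactive h.1 hfree).2⟩

theorem IsTail.nonempty_iso_pathGraph (hconn : G.Connected) (hv : G.degree v ≤ 2) {l l' : List V}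
    (h : IsTail G v y l) (h' : IsTail G v y' l') (hne : y ≠ y') :
    ∃ n, 3 ≤ n ∧ Nonempty (G ≃g pathGraph n) := by
  classical
  have hdeg : ∀ x, G.degree x ≤ 2 := by
    intro x
    by_cases hxv : x = v
    · exact hxv ▸ hv
    obtain ⟨w, hw, hxw⟩ := exists_adj_and_mem_branch hconn hxv
    have hwy : w = y ∨ w = y' := by
      by_contra! hcon
      have := three_le_degree h.adj h'.adj hw hne hcon.1.symm hcon.2.symm
      omega
    rcases hwy with rfl | rfl
    · exact h.degree_le (h.mem_iff_mem_branch.2 hxw)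
    · exact h'.degree_le (h'.mem_iff_mem_branch.2 hxw)
  obtain ⟨u, t, -, hu, -⟩ := h.exists_eq_cons
  refine ⟨Fintype.card V, ?_, Cactus.nonempty_iso_pathGraph hconn hdeg hu.le⟩
  have hcard := Finset.card_le_univ ({v, y, y'} : Finset V)
  rwa [Finset.card_eq_three.2 ⟨v, y, y', h.adj.ne, h'.adj.ne, hne, rfl⟩] at hcard

namespace IsGood

theorem not_isBridge_of_adj (hG : IsCactus G) (h : IsGood G κ S) (hs : IsShadow G κ S v y)
    (hC : C.1.Adj v y) (hs' : IsShadow G κ S v y') : ¬ G.IsBridge s(v, y') := by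
  intro hb
  obtain ⟨⟨hbi, hbr⟩, hconf, -⟩ := h
  obtain ⟨hfree, l, hl⟩ := hs'.exists_isTail hG hbi hbr hb
  have hv3 := Cycle.three_le_degree hC.fst_mem hs'.1
    ((isBridge_iff_forall_cycle_not_adj hs'.1).1 hb C)
  exact hconf C (hs.containsConfig_of_isFreeThread hG (hbi C) hC (hl.isFreeThread hv3 hfree))

theorem eq_of_isShadow_of_isBridge (hG : IsCactus G) (h : IsGood G κ S)
    (hpath : ∀ n, 3 ≤ n → IsEmpty (G ≃g pathGraph n)) (hs : IsShadow G κ S v y)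
    (hb : G.IsBridge s(v, y)) (hs' : IsShadow G κ S v y') (hb' : G.IsBridge s(v, y')) :
    y = y' := by
  by_contra hne
  obtain ⟨⟨hbi, hbr⟩, -⟩ := h
  obtain ⟨hfree, l, hl⟩ := hs.exists_isTail hG hbi hbr hb
  obtain ⟨hfree', l', hl'⟩ := hs'.exists_isTail hG hbi hbr hb'
  by_cases hv : 3 ≤ G.degree v
  · exact hne (hbr.eq_of_isTail hv hl hl' hfree hfree')
  · obtain ⟨n, hn, ⟨e⟩⟩ := hl.nonempty_iso_pathGraph hG.1 (by omega) hl' hne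
    exact (hpath n hn).false e

theorem eq_of_isShadow_of_adj (hG : IsCactus G) (h : IsGood G κ S) {D : Cycle G}
    (hs : IsShadow G κ S v y) (hC : C.1.Adj v y) (hs' : IsShadow G κ S v y') (hD : D.1.Adj v y') :
    y = y' := by
  obtain ⟨⟨hbi, -⟩, -, hcrit⟩ := h
  by_cases hCD : C = D
  · subst hCD
    exact hs.eq_of_adj hG (hbi C) hC hs' hD
  · have hactC := hG.isActive_of_mem_of_mem hCD (hbi D) hC.fst_mem hD.fst_mem
    have hactD := hG.isActive_of_mem_of_mem (Ne.symm hCD) (hbi C) hD.fst_mem hC.fst_mem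
    exact absurd ⟨hCD, v, hs.isCritical hG hC hactC, hs'.isCritical hG hD hactD⟩ (hcrit C D)

theorem hasUniqueShadows (hG : IsCactus G) (h : IsGood G κ S)
    (hpath : ∀ n, 3 ≤ n → IsEmpty (G ≃g pathGraph n)) : HasUniqueShadows G κ S := by
  intro v y y' hs hs'
  have hcycle : ∀ {z}, G.Adj v z → ¬ G.IsBridge s(v, z) → ∃ C : Cycle G, C.1.Adj v z :=
    fun hz hb => by simpa [isBridge_iff_forall_cycle_not_adj hz] using hb
  by_cases hb : G.IsBridge s(v, y) <;> by_cases hb' : G.IsBridge s(v, y')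
  · exact h.eq_of_isShadow_of_isBridge hG hpath hs hb hs' hb'
  · obtain ⟨D, hD⟩ := hcycle hs'.1 hb'
    exact absurd hb (h.not_isBridge_of_adj hG hs' hD hs)
  · obtain ⟨C, hC⟩ := hcycle hs.1 hb
    exact absurd hb' (h.not_isBridge_of_adj hG hs hC hs')
  · obtain ⟨C, hC⟩ := hcycle hs.1 hb
    obtain ⟨D, hD⟩ := hcycle hs'.1 hb'
    exact h.eq_of_isShadow_of_adj hG hs hC hs' hD

end IsGood

end UniqueShadows

/-! ### Positions on a circle -/

section Circle

variable {n k p q H H' : ℤ}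

/-- The distance of the positions `a, b ∈ [0, 2 * n)` on a circle of circumference `2 * n`. -/
def circleDist (n a b : ℤ) : ℤ := min (max (a - b) (b - a)) (2 * n - max (a - b) (b - a))

/-- The landmark at position `2 * l` does not tell apart an object attached at position `p` by a
stem of height `H` and one attached at position `q` by a stem of height `H'`. A landmark at the
very position `p` may sit on the stem, whence the inequality. -/
def Unresolved (n p q H H' l : ℤ) : Prop :=
  (2 * l ≠ p ∧ 2 * l ≠ q ∧ circleDist n (2 * l) p + H = circleDist n (2 * l) q + H') ∨
    (2 * l = p ∧ circleDist n p q + H' ≤ H)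

/-- The positions `p` and `q` are mirror images in the line that swaps the landmarks `0` and
`2 * k`, and the difference of heights makes up for the difference of distances. -/
def Mirrored (n k p q H H' : ℤ) : Prop :=
  0 < p ∧ p + q = n + 2 * k ∧ 2 * k + (H - H') = n ∧ (p < 2 * k ∨ 2 * k = n)

/-- The position `p` lies between `q` and both landmarks `0` and `2 * k`, and the difference of
heights makes up for the difference of distances. -/
def Behind (n k p q H H' : ℤ) : Prop :=
  H = H' + circleDist n p q ∧
    ((2 * k ≤ p ∧ p < q ∧ q ≤ n) ∨ (n + 2 * k ≤ q ∧ (q < p ∨ p = 0)))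

theorem circleDist_zero_left {x : ℤ} (hx : 0 ≤ x) : circleDist n 0 x = min x (2 * n - x) := by
  simp only [circleDist]
  omega

theorem circleDist_cases {x : ℤ} (hkn : 2 * k ≤ n) (hx : 0 ≤ x) :
    (x < 2 * k ∧ circleDist n (2 * k) x = 2 * k - x) ∨
    (2 * k ≤ x ∧ x ≤ n + 2 * k ∧ circleDist n (2 * k) x = x - 2 * k) ∨
    (n + 2 * k < x ∧ circleDist n (2 * k) x = 2 * n - x + 2 * k) := by
  simp only [circleDist]
  omega

theorem mirrored_or_behind_of_dist_eq (hk : 0 < k) (hkn : 2 * k ≤ n) (hp : 0 ≤ p)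
    (hpn : p < 2 * n) (hq : 0 < q) (hqn : q < 2 * n) (hpq : p ≠ q) (hH : H' ≤ H)
    (h0 : circleDist n 0 p + H = circleDist n 0 q + H')
    (hk' : circleDist n (2 * k) p + H = circleDist n (2 * k) q + H') :
    Mirrored n k p q H H' ∨ Behind n k p q H H' := by
  rw [circleDist_zero_left hp, circleDist_zero_left hq.le] at h0
  simp only [Mirrored, Behind]
  rcases circleDist_cases hkn hp with hp' | hp' | hp' <;>
    rcases circleDist_cases hkn hq.le with hq' | hq' | hq' <;>
    simp only [circleDist] <;> omega

theorem mirrored_or_behind (hk : 0 < k) (hkn : 2 * k ≤ n) (hp : 0 ≤ p)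
    (hpn : p < 2 * n) (hq : 0 ≤ q) (hqn : q < 2 * n) (hpq : p ≠ q) (hH : H' ≤ H)
    (h0 : Unresolved n p q H H' 0) (hk' : Unresolved n p q H H' k) :
    Mirrored n k p q H H' ∨ Behind n k p q H H' := by
  rw [Unresolved, mul_zero] at h0
  rcases h0 with ⟨h0, h0', e0⟩ | ⟨rfl, e0⟩ <;> rcases hk' with ⟨-, hq', ek⟩ | ⟨hp', ek⟩
  · exact mirrored_or_behind_of_dist_eq hk hkn hp hpn (by omega) hqn hpq hH e0 ek
  · subst hp'
    rw [circleDist_zero_left hp, circleDist_zero_left hq] at e0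
    simp only [circleDist, Mirrored, Behind] at *
    omega
  · rw [Behind, circleDist_zero_left hq]
    rw [circleDist_zero_left hq] at e0
    simp only [circleDist] at ek
    omega
  · omega

theorem Mirrored.not_unresolved {l : ℤ} (hkn : 2 * k ≤ n) (hpq : p ≠ q) (hpn : p < 2 * n)
    (hl : 0 < l) (hlk : l < k) (h : Mirrored n k p q H H') : ¬ Unresolved n p q H H' l := by
  simp only [Mirrored, Unresolved, circleDist] at *
  omega

theorem not_unresolved_triple {a b : ℤ} (ha : 0 < a) (hab : a < b) (hbn : b < n)
    (h1 : 2 * a ≤ n) (h2 : 2 * (b - a) ≤ n) (h3 : 2 * (n - b) ≤ n) (hp : 0 ≤ p)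
    (hpn : p < 2 * n) (hq : 0 ≤ q) (hqn : q < 2 * n) (hpq : p ≠ q) (hH : H' ≤ H)
    (u0 : Unresolved n p q H H' 0) (ua : Unresolved n p q H H' a) :
    ¬ Unresolved n p q H H' b := by
  rcases mirrored_or_behind ha h1 hp hpn hq hqn hpq hH u0 ua with h | h <;>
  · simp only [Mirrored, Behind, Unresolved, circleDist] at *
    omega

end Circle

/-! ### Profiles of vertices and edges over a cycle -/

section RootDist

variable {V : Type*} {G : SimpleGraph V} {C : Cycle G} {c : ℤ → V}

namespace IsCactus

theorem two_mul_dist_param (hG : IsCactus G) (hc : C.IsParam c) {i j : ℤ} (hi : 0 ≤ i)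
    (hin : i < C.len) (hj : 0 ≤ j) (hjn : j ≤ C.len) :
    2 * (G.dist (c i) (c j) : ℤ) = circleDist C.len (2 * i) (2 * j) := by
  unfold circleDist
  rcases le_total i j with h | h
  · have := hG.dist_param hc h (by omega)
    omega
  · have := hG.dist_param hc h (by omega)
    rw [SimpleGraph.dist_comm] at this
    omega

theorem two_mul_dist_of_root (hG : IsCactus G) (hc : C.IsParam c) {s x : V} {l i : ℤ} (hl : 0 ≤ l)
    (hln : l < C.len) (hi : 0 ≤ i) (hin : i < C.len) (hs : C.root s = c l) (hx : C.root x = c i)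
    (hne : l ≠ i) :
    (2 * G.dist s x : ℤ) =
      2 * G.dist s (c l) + circleDist C.len (2 * l) (2 * i) + 2 * G.dist (c i) x := by
  have hroot : C.root s ≠ C.root x := fun e => by
    have := hc.inj (hs.symm.trans (e.trans hx)) (by omega) (by omega)
    omega
  have h1 := hG.dist_eq_of_root_ne hroot
  have h2 := hG.dist_eq_of_mem (s := x) (hc.mem l)
  rw [hs] at h1
  rw [hx, SimpleGraph.dist_comm (v := c l), SimpleGraph.dist_comm (u := x),
    SimpleGraph.dist_comm (u := c i) (v := c l)] at h2
  have h3 := hG.two_mul_dist_param hc hl hln hi hin.le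
  omega

theorem exists_not_adj_dist_lt (hG : IsCactus G) {v x : V} (hx : C.root x = v) (hne : x ≠ v) :
    ∃ z, G.Adj v z ∧ ¬ C.1.Adj v z ∧ G.dist z x + 1 = G.dist v x := by
  have hpos := hG.1.pos_dist_of_ne hne.symm
  obtain ⟨z, hz, hd⟩ := exists_adj_dist_eq hG.1 (u := x) (x := v) (m := G.dist v x - 1)
    (by rw [SimpleGraph.dist_comm]; omega)
  rw [SimpleGraph.dist_comm] at hd
  refine ⟨z, hz.symm, fun h => ?_, by omega⟩
  have := hG.dist_eq_of_mem (s := x) h.snd_mem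
  rw [hx, SimpleGraph.dist_comm (u := x) (v := z), SimpleGraph.dist_comm (u := x)] at this
  omega

end IsCactus

end RootDist

section Profile

variable {V : Type*} [Fintype V] {G : SimpleGraph V} [DecidableRel G.Adj] {C : Cycle G}
  {S : Finset V} {κ : Kind} {c : ℤ → V} {D D' : V → ℤ} {k : ℕ} {p q H H' : ℤ}

/-- `D s` is the doubled distance from `s` to a vertex or an edge that hangs over the position `p`
of the cycle `C`, of doubled length, by a stem of doubled height `H`. The midpoint of an edge counts
as its position, so that doubling makes all quantities integral. -/
structure IsProfile (C : Cycle G) (S : Finset V) (κ : Kind) (c : ℤ → V) (D : V → ℤ) (p H : ℤ) :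
    Prop where
  nonneg : 0 ≤ p
  lt : p < 2 * C.len
  height_nonneg : 0 ≤ H
  far : ∀ (s : V) (l : ℤ), 0 ≤ l → l < C.len → C.root s = c l → 2 * l ≠ p →
    D s = 2 * G.dist s (c l) + circleDist C.len (2 * l) p + H
  near : ∀ (s : V) (l : ℤ), 0 ≤ l → l < C.len → C.root s = c l → 2 * l = p →
    D s ≤ 2 * G.dist s (c l) + H
  vertex : κ = .vertex → p % 2 = 0 ∧ H % 2 = 0
  edge : κ = .edge → (p % 2 = 1 ∧ H = 0) ∨ (p % 2 = 0 ∧ H % 2 = 1)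
  shadow : ∀ i : ℤ, p = 2 * i → 0 < H → (∀ s ∈ S, 2 * G.dist s (c i) + H ≤ D s) →
    ∃ z, ¬ C.1.Adj (c i) z ∧ IsShadow G κ S (c i) z
  thread : ∀ i : ℤ, p = 2 * i → 0 < H → ∃ x ∈ C.comp (c i), x ≠ c i ∧
    ∀ l, IsThread G (c i) l → x ∈ l → H ≤ 2 * l.length

theorem IsThread.dist_lt_length (hconn : G.Connected) {v x y : V} {l : List V} (hl : IsThread G v l)
    (hy : y ∈ l) (hxy : G.Adj x y) (hle : G.dist v x ≤ G.dist v y) : G.dist v x < l.length := by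
  obtain ⟨z, hz⟩ := hl.exists_isTail
  have hb : G.IsBridge s(x, y) :=
    (isBridge_iff_forall_cycle_not_adj hxy).2 fun D hD => hl.notMem_verts hy D hD.snd_mem
  exact (lt_of_le_of_ne hle (dist_ne_of_isBridge hconn hxy hb v)).trans_le
    (hz.dist_le_length hconn hy)

namespace IsCactus

theorem exists_isProfile_dist (hG : IsCactus G) (hc : C.IsParam c) (S : Finset V) (x : V) :
    ∃ i : ℤ, 0 ≤ i ∧ i < C.len ∧ c i = C.root x ∧
      IsProfile C S .vertex c (fun s => 2 * G.dist s x) (2 * i) (2 * G.dist (c i) x) := by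
  obtain ⟨i, hi0, hin, hi⟩ := hc.exists_rep 0 (hG.root_mem C x)
  refine ⟨i, hi0, by omega, hi, by omega, by omega, by omega, ?_, ?_, by omega, by simp, ?_, ?_⟩
  · intro s l hl hln hs hne
    exact hG.two_mul_dist_of_root hc hl hln hi0 (by omega) hs hi.symm (by omega)
  · intro s l _ _ _ he
    obtain rfl : l = i := by omega
    have := hG.1.dist_triangle (u := s) (v := c l) (w := x)
    omega
  · intro j hj hH hs
    obtain rfl : i = j := by omega
    obtain ⟨z, hz, hzC, hd⟩ :=
      hG.exists_not_adj_dist_lt hi.symm (by rintro rfl; simp at hH)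
    refine ⟨z, hzC, hz, fun s hsS => ?_⟩
    have h1 := hs s hsS
    have h2 := hG.1.dist_triangle (u := s) (v := z) (w := x)
    have h4 := dist_le_dist_add_one hG.1 hz s
    simp only [Kind.Beyond]
    omega
  · intro j hj hH
    obtain rfl : i = j := by omega
    refine ⟨x, (hG.mem_comp_iff (hc.mem i)).2 hi.symm, by rintro rfl; simp at hH, ?_⟩
    intro l hl hxl
    obtain ⟨z, hz⟩ := hl.exists_isTail
    have := hz.dist_le_length hG.1 hxl
    omega

theorem isProfile_edgeDist_of_not_adj (hG : IsCactus G) (hc : C.IsParam c) (S : Finset V)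
    {x y : V} (hxy : G.Adj x y) (hC : ¬ C.1.Adj x y) {i : ℤ} (hi0 : 0 ≤ i) (hin : i < C.len)
    (hi : c i = C.root x) (hle : G.dist (c i) x ≤ G.dist (c i) y) :
    IsProfile C S .edge c (fun s => 2 * edgeDist G s s(x, y) + 1) (2 * i)
      (2 * G.dist (c i) x + 1) := by
  have hi' : c i = C.root y := hi.trans (hG.root_eq_of_adj hxy hC).symm
  refine ⟨by omega, by omega, by omega, ?_, ?_, by simp, fun _ => by omega, ?_, ?_⟩
  · intro s l hl hln hs hne
    have h1 := hG.two_mul_dist_of_root hc hl hln hi0 hin hs hi.symm (by omega)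
    have h2 := hG.two_mul_dist_of_root hc hl hln hi0 hin hs hi'.symm (by omega)
    simp only [edgeDist_mk]
    push_cast
    omega
  · intro s l _ _ _ he
    obtain rfl : l = i := by omega
    have := hG.1.dist_triangle (u := s) (v := c l) (w := x)
    simp only [edgeDist_mk]
    omega
  · intro j hj hH hs
    obtain rfl : i = j := by omega
    simp only [Kind.Beyond, IsShadow, edgeDist_mk] at hs ⊢
    by_cases hxi : x = c i
    · subst hxi
      refine ⟨y, hC, hxy, fun s hsS => ?_⟩
      have h1 := hs s hsS
      rw [SimpleGraph.dist_self] at h1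
      omega
    · obtain ⟨z, hz, hzC, hd⟩ := hG.exists_not_adj_dist_lt hi.symm hxi
      refine ⟨z, hzC, hz, fun s hsS => ?_⟩
      have h1 := hs s hsS
      have h2 := hG.1.dist_triangle (u := s) (v := z) (w := x)
      omega
  · intro j hj _
    obtain rfl : i = j := by omega
    refine ⟨y, (hG.mem_comp_iff (hc.mem i)).2 hi'.symm, ?_, fun l hl hyl => ?_⟩
    · rintro rfl
      rw [SimpleGraph.dist_self, Nat.le_zero, hG.1.dist_eq_zero_iff] at hle
      exact hxy.ne hle.symm
    · have := hl.dist_lt_length hG.1 hyl hxy hle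
      omega

theorem isProfile_edgeDist_of_adj (hG : IsCactus G) (hc : C.IsParam c) (S : Finset V) {j : ℤ}
    (hj0 : 0 ≤ j) (hjn : j < C.len) :
    IsProfile C S .edge c (fun s => 2 * edgeDist G s s(c j, c (j + 1)) + 1) (2 * j + 1) 0 := by
  refine ⟨by omega, by omega, le_rfl, ?_, by omega, by simp, by omega, by omega, by omega⟩
  intro s l hl hln hs _
  have h1 := hG.two_mul_dist_param hc hl hln hj0 hjn.le
  have h2 := hG.two_mul_dist_param hc (j := j + 1) hl hln (by omega) (by omega)
  have h3 : min (circleDist C.len (2 * l) (2 * j)) (circleDist C.len (2 * l) (2 * (j + 1))) + 1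
      = circleDist C.len (2 * l) (2 * j + 1) := by
    simp only [circleDist]
    omega
  simp only [edgeDist_mk]
  rw [hG.dist_eq_of_mem (s := s) (hc.mem j), hG.dist_eq_of_mem (s := s) (hc.mem (j + 1)), hs]
  push_cast
  omega

theorem exists_isProfile_edgeDist (hG : IsCactus G) (hc : C.IsParam c) (S : Finset V)
    {x y : V} (hxy : G.Adj x y) :
    ∃ p H, IsProfile C S .edge c (fun s => 2 * edgeDist G s s(x, y) + 1) p H ∧
      ((C.1.Adj x y ∧ ∃ j : ℤ, p = 2 * j + 1 ∧ s(x, y) = s(c j, c (j + 1))) ∨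
        (¬ C.1.Adj x y ∧ ∃ i : ℤ, p = 2 * i ∧ C.root x = c i)) := by
  by_cases hC : C.1.Adj x y
  · obtain ⟨j, hj, he⟩ : ∃ j < C.len, s(x, y) = s(c (j : ℕ), c (j + 1)) := by
      obtain ⟨j, hj, ⟨rfl, rfl⟩ | ⟨rfl, rfl⟩⟩ := hc.adj_iff_exists_lt.1 hC
      · exact ⟨j, hj, rfl⟩
      · exact ⟨j, hj, Sym2.eq_swap⟩
    exact ⟨2 * j + 1, 0, he ▸ hG.isProfile_edgeDist_of_adj hc S (by omega) (by omega),
      Or.inl ⟨hC, j, rfl, he⟩⟩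
  · obtain ⟨i, hi0, hin, hi⟩ := hc.exists_rep 0 (hG.root_mem C x)
    rcases le_total (G.dist (c i) x) (G.dist (c i) y) with hle | hle
    · exact ⟨_, _, hG.isProfile_edgeDist_of_not_adj hc S hxy hC hi0 (by omega) hi hle,
        Or.inr ⟨hC, i, rfl, hi.symm⟩⟩
    · have := hG.isProfile_edgeDist_of_not_adj hc S hxy.symm (fun h => hC h.symm) hi0 (by omega)
        (hi.trans (hG.root_eq_of_adj hxy hC).symm) hle
      rw [Sym2.eq_swap] at this
      exact ⟨_, _, this, Or.inr ⟨hC, i, rfl, hi.symm⟩⟩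

end IsCactus

namespace IsProfile

theorem unresolved_of_isActive (hG : IsCactus G) (h : IsProfile C S κ c D p H)
    (h' : IsProfile C S κ c D' q H') (hpq : p ≠ q) (hH : H' ≤ H) (hD : ∀ s ∈ S, D s = D' s) {l : ℤ}
    (hl : 0 ≤ l) (hln : l < C.len) (hact : C.IsActive S (c l)) : Unresolved C.len p q H H' l := by
  obtain ⟨s, hs, hr⟩ := hG.isActive_iff.1 hact
  have heq := hD s hs
  by_cases hp : 2 * l = p
  · have h1 := h.near s l hl hln hr hp
    have h2 := h'.far s l hl hln hr (by omega)
    rw [hp] at h2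
    exact Or.inr ⟨hp, by omega⟩
  · have h1 := h.far s l hl hln hr hp
    by_cases hq : 2 * l = q
    · exfalso
      have h2 := h'.near s l hl hln hr hq
      have hp0 := h.nonneg
      have hpn := h.lt
      simp only [circleDist] at h1
      omega
    · have h2 := h'.far s l hl hln hr hq
      exact Or.inl ⟨hp, hq, by omega⟩

theorem even (h : IsProfile C S κ c D p H) (hH : 0 < H) : p % 2 = 0 := by
  cases κ with
  | vertex => exact (h.vertex rfl).1
  | edge => rcases h.edge rfl with h | h <;> omega

theorem exists_isFreeThread (hG : IsCactus G) (hbr : IsBranchResolving G S)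
    (hbi : IsBiactive G S) (h : IsProfile C S κ c D p H) (hc : C.IsParam c) (hH : 0 < H) {i : ℤ}
    (hi : p = 2 * i) (hact : ¬ C.IsActive S (c i)) :
    ∃ l, IsFreeThread G S (c i) l ∧ H ≤ 2 * l.length := by
  obtain ⟨x, hx, hxi, hlen⟩ := h.thread i hi hH
  obtain ⟨l, hl, hxl⟩ := exists_isFreeThread_of_mem_comp hG hbr hbi (hc.mem i) hact hx hxi
  exact ⟨l, hl, hlen l hl.1 hxl⟩

theorem containsConfig_of_mirrored (hG : IsCactus G) (hbr : IsBranchResolving G S)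
    (hbi : IsBiactive G S) {lab : Labelling C} (hcan : lab.IsCanonical S k) (hkn : 2 * k ≤ C.len)
    (h : IsProfile C S κ lab.param D p H) (h' : IsProfile C S κ lab.param D' q H')
    (hact : ∀ l : ℤ, 0 ≤ l → l < C.len → C.IsActive S (lab.param l) → l = 0 ∨ l = k)
    (h2 : C.numActive S = 2) (hm : Mirrored C.len k p q H H') : C.ContainsConfig κ S := by
  have hk := hcan.pos h2.ge
  refine Cycle.containsConfig_iff.2 ⟨lab, k, hcan, ?_⟩
  by_cases hA : 2 * k = C.len
  · exact Or.inl ⟨h2, ⟨k, by omega⟩, by omega⟩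
  obtain ⟨hp0, hpq, hkH, hpk⟩ := hm
  have hH' := h'.height_nonneg
  have hthread : ∀ {D p H}, IsProfile C S κ lab.param D p H → 0 < H → ∀ i : ℕ, p = 2 * i →
      i ≠ 0 → i ≠ k → ∃ l, IsFreeThread G S (lab.vert i) l ∧ H ≤ 2 * l.length := by
    intro D p H hP hH i hi hi0 hik
    have hlt := hP.lt
    rw [← lab.param_natCast (by omega)]
    refine hP.exists_isFreeThread hG hbr hbi lab.isParam_param hH hi fun ha => ?_
    rcases hact i (by omega) (by omega) ha with hi | hi <;> omega
  have hpe := h.even (by omega)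
  obtain ⟨l, hl, hlen⟩ := hthread h (by omega) (p / 2).toNat (by omega) (by omega) (by omega)
  refine Or.inr (Or.inr ?_)
  cases κ with
  | vertex =>
    have h1 := h.vertex rfl
    have h1' := h'.vertex rfl
    exact ⟨h2, ⟨C.len / 2, by omega⟩, by omega, _, l, by omega, hl, by omega⟩
  | edge =>
    have h1 := h.edge rfl
    have h1' := h'.edge rfl
    refine ⟨h2, _, l, by omega, hl, by omega, fun heven => ?_⟩
    have heven := Nat.even_iff.1 heven
    obtain ⟨l', hl', -⟩ := hthread h' (by omega) (q / 2).toNat (by omega) (by omega) (by omega)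
    refine ⟨l', ?_⟩
    rwa [show C.len / 2 + k - (p / 2).toNat = (q / 2).toNat by omega]

theorem two_mul_dist_add_le (hG : IsCactus G) (hc : C.IsParam c) {i : ℤ}
    (h : IsProfile C S κ c D (2 * i) H) (h' : IsProfile C S κ c D' q H') (hiq : 2 * i ≠ q)
    (hH : H = H' + circleDist C.len (2 * i) q) {s : V} (hs : D s = D' s) :
    2 * G.dist s (c i) + H ≤ D s := by
  have hi0 := h.nonneg
  have hin := h.lt
  obtain ⟨l, hl0, hln, hl⟩ := hc.exists_rep 0 (hG.root_mem C s)
  by_cases hli : l = i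
  · have h1 := h'.far s i (by omega) (by omega) (hli ▸ hl.symm) hiq
    omega
  · have h1 := h.far s l hl0 (by omega) hl.symm (by omega)
    have h2 := hG.dist_eq_of_mem (s := s) (hc.mem i)
    have h3 := hG.two_mul_dist_param hc (i := l) (j := i) hl0 (by omega) (by omega) (by omega)
    rw [← hl] at h2
    omega

theorem not_hasUniqueShadows_of_behind (hG : IsCactus G) (hc : C.IsParam c)
    (hall : C.ActiveWithin S c k) (hk : 0 < k) (h : IsProfile C S κ c D p H)
    (h' : IsProfile C S κ c D' q H') (hD : ∀ s ∈ S, D s = D' s) (hb : Behind C.len k p q H H') :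
    ¬ HasUniqueShadows G κ S := by
  intro hS
  obtain ⟨hH, hb⟩ := hb
  have hp0 := h.nonneg
  have hpn := h.lt
  have hqn := h'.lt
  have hH' := h'.height_nonneg
  have hHpos : 0 < H := by
    simp only [circleDist] at hH
    omega
  obtain ⟨i, rfl⟩ : ∃ i : ℕ, p = 2 * i := ⟨(p / 2).toNat, by have := h.even hHpos; omega⟩
  have hqe : κ = .vertex → q % 2 = 0 := fun e => (h'.vertex e).1
  have hcb : k ≤ κ.critBound C.len ∧ ((k ≤ i ∧ i ≤ κ.critBound C.len) ∨
      (C.len + k ≤ i + κ.critBound C.len ∧ i < C.len) ∨ i = 0) := by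
    cases κ with
    | vertex => have := hqe rfl; simp only [Kind.critBound]; omega
    | edge => simp only [Kind.critBound]; omega
  obtain ⟨y, hy, hys⟩ := hG.exists_isShadow hc hall hcb.1 hcb.2
  obtain ⟨z, hz, hzs⟩ := h.shadow i rfl hHpos fun s hs =>
    h.two_mul_dist_add_le hG hc h' (by omega) hH (hD s hs)
  exact hz (hS _ _ _ hys hzs ▸ hy)

end IsProfile

theorem IsProfile.exists_ne_of_two_mul_le (hG : IsCactus G) (hgood : IsGood G κ S)
    (hS : HasUniqueShadows G κ S) {lab : Labelling C} (hcan : lab.IsCanonical S k)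
    (hkn : 2 * k ≤ C.len) (h : IsProfile C S κ lab.param D p H)
    (h' : IsProfile C S κ lab.param D' q H') (hpq : p ≠ q) (hH : H' ≤ H) :
    ∃ s ∈ S, D s ≠ D' s := by
  obtain ⟨⟨hbi, hbr⟩, hconf, -⟩ := hgood
  obtain ⟨hk, h0, hkact, hall⟩ := Labelling.hasMaxActive_iff.1 hcan.1
  have hkpos := hcan.pos (hbi C)
  by_contra! hD
  have hun : ∀ l : ℤ, 0 ≤ l → l < C.len → C.IsActive S (lab.param l) →
      Unresolved C.len p q H H' l := fun l hl hln hact =>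
    h.unresolved_of_isActive hG h' hpq hH hD hl hln hact
  rcases mirrored_or_behind (n := C.len) (k := k) (by omega) (by omega) h.nonneg h.lt h'.nonneg
    h'.lt hpq hH (hun 0 le_rfl C.len_pos h0) (hun k (by omega) (by omega) hkact) with hm | hb
  · have hact : ∀ l : ℤ, 0 ≤ l → l ≤ k → C.IsActive S (lab.param l) → l = 0 ∨ l = k := by
      intro l hl hlk hact
      by_contra! hne
      exact hm.not_unresolved (by omega) hpq h.lt (by omega) (by omega)
        (hun l hl (by omega) hact)
    refine hconf C (h.containsConfig_of_mirrored hG hbr hbi hcan hkn h' (fun l hl hln hl' => ?_)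
      ((hall.numActive_le_two hact).antisymm (hbi C)) hm)
    obtain ⟨j, hj0, hjk, hj⟩ := hall _ hl'
    obtain rfl : j = l := lab.isParam_param.inj hj (by omega) (by omega)
    exact hact j hl hjk hl'
  · exact h.not_hasUniqueShadows_of_behind hG lab.isParam_param hall hkpos h' hD hb hS

theorem IsProfile.exists_ne_of_hasGeodesicTriple (hG : IsCactus G) {a b : ℤ}
    (h : IsProfile C S κ c D p H) (h' : IsProfile C S κ c D' q H') (hpq : p ≠ q) (hH : H' ≤ H)
    (h0 : C.IsActive S (c 0)) (ha : C.IsActive S (c a)) (hb : C.IsActive S (c b)) (ha0 : 0 < a)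
    (hab : a < b) (hbn : b < C.len) (h1 : 2 * a ≤ C.len) (h2 : 2 * (b - a) ≤ C.len)
    (h3 : 2 * (C.len - b) ≤ C.len) : ∃ s ∈ S, D s ≠ D' s := by
  by_contra! hD
  have hun : ∀ l : ℤ, 0 ≤ l → l < C.len → C.IsActive S (c l) →
      Unresolved C.len p q H H' l := fun l hl hln hact =>
    h.unresolved_of_isActive hG h' hpq hH hD hl hln hact
  exact not_unresolved_triple ha0 hab hbn h1 h2 h3 h.nonneg h.lt h'.nonneg h'.lt hpq hH
    (hun 0 le_rfl C.len_pos h0) (hun a (by omega) (by omega) ha) (hun b (by omega) hbn hb)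

theorem IsGood.exists_isParam_forall_exists_ne (hG : IsCactus G) (hgood : IsGood G κ S)
    (hS : HasUniqueShadows G κ S) (C : Cycle G) : ∃ c, C.IsParam c ∧
      ∀ {D D' p q H H'}, IsProfile C S κ c D p H → IsProfile C S κ c D' q H' → p ≠ q → H' ≤ H →
        ∃ s ∈ S, D s ≠ D' s := by
  obtain ⟨lab, k, hcan⟩ := Cycle.exists_isCanonical (one_le_two.trans (hgood.1.1 C))
  rcases le_or_gt (2 * k) C.len with hk | hk
  · exact ⟨lab.param, lab.isParam_param, fun h h' hpq hH =>
      h.exists_ne_of_two_mul_le hG hgood hS hcan hk h' hpq hH⟩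
  · obtain ⟨c, a, b, hc, h0, ha, hb, ha0, hab, hbn, h1, h2, h3⟩ := hcan.hasGeodesicTriple hk
    exact ⟨c, hc, fun h h' hpq hH =>
      h.exists_ne_of_hasGeodesicTriple hG h' hpq hH h0 ha hb ha0 hab hbn h1 h2 h3⟩

theorem IsGood.exists_ne_of_isProfile (hG : IsCactus G) (hgood : IsGood G κ S)
    (hS : HasUniqueShadows G κ S) (C : Cycle G)
    (h : ∀ c, C.IsParam c → ∃ p q H H', p ≠ q ∧ IsProfile C S κ c D p H ∧
      IsProfile C S κ c D' q H') : ∃ s ∈ S, D s ≠ D' s := by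
  obtain ⟨c, hc, hres⟩ := hgood.exists_isParam_forall_exists_ne hG hS C
  obtain ⟨p, q, H, H', hpq, hP, hP'⟩ := h c hc
  rcases le_total H' H with hH | hH
  · exact hres hP hP' hpq hH
  · obtain ⟨s, hs, hne⟩ := hres hP' hP hpq.symm hH
    exact ⟨s, hs, hne.symm⟩

end Profile

/-! ### Good sets are generators -/

section Bridges

variable {V : Type*} {G : SimpleGraph V} {S : Finset V} {κ : Kind}

theorem IsCactus.root_ne_of_mem_branch (hG : IsCactus G) {C : Cycle G} {x y z : V}
    (h : C.1.Adj x z) (hy : y ∈ branch G x z) : C.root y ≠ x := by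
  intro hroot
  obtain ⟨z', hz', hz'C, hy'⟩ :=
    Cycle.exists_branch ((hG.mem_comp_iff h.fst_mem).2 hroot) (ne_of_mem_branch hy)
  have hz : z ∈ C.comp x :=
    hG.branch_subset_comp h.fst_mem hz' hz'C (branch_trans (branch_symm hy) hy')
  exact h.ne (hG.eq_of_mem_comp h.fst_mem h.snd_mem hz).symm

theorem IsCactus.isBridge_of_mem_branch (hG : IsCactus G) {x y z : V} (hz : G.Adj x z)
    (hy : y ∈ branch G x z) (hroot : ∀ C : Cycle G, C.root x = C.root y) :
    G.IsBridge s(x, z) :=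
  (isBridge_iff_forall_cycle_not_adj hz).2 fun C hC =>
    hG.root_ne_of_mem_branch hC hy (by rw [← hroot C, hG.root_self hC.fst_mem])

theorem exists_isBridge_of_forall_root_eq (hG : IsCactus G) {x y : V} (hxy : x ≠ y)
    (hroot : ∀ C : Cycle G, C.root x = C.root y) (heq : ∀ s ∈ S, G.dist s x = G.dist s y) :
    ∃ z, G.Adj x z ∧ G.IsBridge s(x, z) ∧ y ∈ branch G x z ∧
      ∀ s ∈ S, G.dist s x = G.dist s z + 1 := by
  obtain ⟨z, hz, hy⟩ := exists_adj_and_mem_branch hG.1 hxy.symm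
  have hb := hG.isBridge_of_mem_branch hz hy hroot
  refine ⟨z, hz, hb, hy, fun s hs => ?_⟩
  rcases dist_eq_or_of_isBridge hG.1 hz hb s with h | h
  · exact h.1
  · have hsy := dist_eq_of_mem_branch hG.1
      (fun hs' => notMem_branch_of_isBridge hb hs' h.2) hy
    have := hG.1.pos_dist_of_ne hxy
    have := heq s hs
    omega

/-- Otherwise the neighbours of `x` and of `y` on the path between them form a closer such pair,
until both coincide and have the two shadows `x` and `y`. -/
theorem HasUniqueShadows.eq_of_forall_root_eq (hS : HasUniqueShadows G κ S) (hG : IsCactus G)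
    (hne : S.Nonempty) {x y : V} (hroot : ∀ C : Cycle G, C.root x = C.root y)
    (heq : ∀ s ∈ S, G.dist s x = G.dist s y) : x = y := by
  induction hm : G.dist x y using Nat.strong_induction_on generalizing x y with
  | _ m ih =>
  by_contra hxy
  obtain ⟨z, hz, hb, hyz, hsz⟩ := exists_isBridge_of_forall_root_eq hG hxy hroot heq
  obtain ⟨w, hw, hb', hxw, hsw⟩ := exists_isBridge_of_forall_root_eq hG (Ne.symm hxy)
    (fun C => (hroot C).symm) fun s hs => (heq s hs).symm
  have hwx : w ≠ x := by
    rintro rfl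
    obtain ⟨s, hs⟩ := hne
    have := heq s hs
    have := hsw s hs
    omega
  have hzw : z = w := by
    refine ih (G.dist z w) ?_ (fun C => ?_) (fun s hs => ?_) rfl
    · have := dist_eq_of_mem_branch hG.1 (fun hx => ne_of_mem_branch hx rfl)
        (mem_branch_of_adj hyz hw hwx)
      have h1 := dist_eq_or_of_isBridge hG.1 hz hb w
      have h2 := dist_eq_or_of_isBridge hG.1 hw hb' x
      have h3 := notMem_branch_of_isBridge hb (mem_branch_of_adj hyz hw hwx)
      have h4 := notMem_branch_of_isBridge hb' hxw
      simp only [h3, h4, and_false, or_false] at h1 h2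
      rw [SimpleGraph.dist_comm (u := w), SimpleGraph.dist_comm (u := w)] at h1
      omega
    · rw [hG.root_eq_of_adj hz ((isBridge_iff_forall_cycle_not_adj hz).1 hb C),
        hG.root_eq_of_adj hw ((isBridge_iff_forall_cycle_not_adj hw).1 hb' C), hroot C]
    · have := hsz s hs
      have := hsw s hs
      have := heq s hs
      omega
  subst hzw
  refine hxy (hS z x y ⟨hz.symm, fun s hs => ?_⟩ ⟨hw.symm, fun s hs => ?_⟩)
  · exact hsz s hs ▸ κ.beyond_succ _
  · exact hsw s hs ▸ κ.beyond_succ _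

theorem exists_forall_mem_branch (hconn : G.Connected) {e f : Sym2 V} (he : e ∈ G.edgeSet)
    (hf : f ∈ G.edgeSet) (hne : e ≠ f) :
    ∃ a b, e = s(a, b) ∧ ∀ x ∈ f, x ∈ branch G a b := by
  obtain ⟨⟨a, b⟩⟩ := e
  obtain ⟨⟨c, d⟩⟩ := f
  change G.Adj a b at he
  change G.Adj c d at hf
  change s(a, b) ≠ s(c, d) at hne
  change ∃ a' b', s(a, b) = s(a', b') ∧ ∀ x ∈ s(c, d), x ∈ branch G a' b'
  simp only [Sym2.mem_iff, forall_eq_or_imp, forall_eq]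
  wlog hc : c ∈ branch G a b generalizing a b
  · obtain ⟨a', b', he', h⟩ := this b a he.symm (by rwa [Sym2.eq_swap])
      ((mem_branch_or hconn he c).resolve_left hc)
    exact ⟨a', b', Sym2.eq_swap.trans he', h⟩
  by_cases hd : d = a
  · subst hd
    have hcb : c ≠ b := by
      rintro rfl
      exact hne Sym2.eq_swap
    have ha : d ∈ branch G b d := mem_branch_self he.ne
    exact ⟨b, d, Sym2.eq_swap, mem_branch_of_adj ha hf.symm hcb, ha⟩
  · exact ⟨a, b, rfl, hc, mem_branch_of_adj hc hf hd⟩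

theorem dist_eq_of_edgeDist_eq (hconn : G.Connected) {a b s : V} {f : Sym2 V} (hab : G.Adj a b)
    (hb : G.IsBridge s(a, b)) (hf : ∀ x ∈ f, x ∈ branch G a b)
    (heq : edgeDist G s s(a, b) = edgeDist G s f) : G.dist s a = G.dist s b + 1 := by
  rcases dist_eq_or_of_isBridge hconn hab hb s with h | h
  · exact h.1
  · obtain ⟨⟨c, d⟩⟩ := f
    have hs : s ∉ branch G a b := fun hs => notMem_branch_of_isBridge hb hs h.2
    have hc := hf c (Sym2.mem_mk_left c d)
    have hd := hf d (Sym2.mem_mk_right c d)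
    have hsc := dist_eq_of_mem_branch hconn hs hc
    have hsd := dist_eq_of_mem_branch hconn hs hd
    have hac := hconn.pos_dist_of_ne (ne_of_mem_branch hc).symm
    have had := hconn.pos_dist_of_ne (ne_of_mem_branch hd).symm
    change edgeDist G s s(a, b) = edgeDist G s s(c, d) at heq
    rw [edgeDist_mk, edgeDist_mk] at heq
    omega

/-- Each edge lies on one side of the other; if `b` and `c` are their ends that face each other,
then `b = c`, and `a` and `d` are shadows of this vertex. -/
theorem HasUniqueShadows.eq_of_forall_edgeDist_eq (hS : HasUniqueShadows G .edge S)
    (hG : IsCactus G) (hne : S.Nonempty) {e f : Sym2 V} (he : e ∈ G.edgeSet) (hf : f ∈ G.edgeSet)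
    (hbe : G.IsBridge e) (hbf : G.IsBridge f)
    (hroot : ∀ C : Cycle G, ∀ x ∈ e, ∀ y ∈ f, C.root x = C.root y)
    (heq : ∀ s ∈ S, edgeDist G s e = edgeDist G s f) : e = f := by
  by_contra hef
  obtain ⟨a, b, rfl, hab⟩ := exists_forall_mem_branch hG.1 he hf hef
  obtain ⟨d, c, rfl, hdc⟩ := exists_forall_mem_branch hG.1 hf he (Ne.symm hef)
  have hsa (s : V) (hs : s ∈ S) := dist_eq_of_edgeDist_eq hG.1 he hbe hab (heq s hs)
  have hsd (s : V) (hs : s ∈ S) := dist_eq_of_edgeDist_eq hG.1 hf hbf hdc (heq s hs).symm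
  obtain rfl : b = c := by
    refine hS.eq_of_forall_root_eq hG hne
      (fun C => hroot C b (Sym2.mem_mk_right a b) c (Sym2.mem_mk_right d c)) fun s hs => ?_
    have h := heq s hs
    rwa [edgeDist_mk, edgeDist_mk, hsa s hs, hsd s hs, min_eq_right (Nat.le_succ _),
      min_eq_right (Nat.le_succ _)] at h
  refine hef ?_
  rw [hS b a d ⟨he.symm, fun s hs => hsa s hs ▸ Kind.beyond_succ _ _⟩
    ⟨hf.symm, fun s hs => hsd s hs ▸ Kind.beyond_succ _ _⟩]

theorem HasUniqueShadows.nonempty [Fintype V] (hS : HasUniqueShadows G κ S)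
    (hG : IsCactus G) (hpath : IsEmpty (G ≃g pathGraph (Fintype.card V))) : S.Nonempty := by
  rw [Finset.nonempty_iff_ne_empty]
  classical
  rintro rfl
  have hdeg : ∀ x, G.degree x ≤ 1 := by
    intro x
    by_contra! h
    obtain ⟨y, hy, z, hz, hyz⟩ := Finset.one_lt_card.1 h
    rw [mem_neighborFinset] at hy hz
    exact hyz (hS x y z ⟨hy, by simp⟩ ⟨hz, by simp⟩)
  obtain ⟨u⟩ := hG.1.nonempty
  obtain ⟨e⟩ := nonempty_iso_pathGraph hG.1 (fun x => (hdeg x).trans (by omega)) (hdeg u)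
  exact hpath.false e

theorem three_le_card_of_mk_ne [Fintype V] {a b c d : V} (hab : a ≠ b) (hcd : c ≠ d)
    (hne : s(a, b) ≠ s(c, d)) : 3 ≤ Fintype.card V := by
  classical
  obtain ⟨z, hza, hzb⟩ : ∃ z, z ≠ a ∧ z ≠ b := by
    by_contra! h
    have := h c
    have := h d
    grind [Sym2.eq_iff]
  rw [← Finset.card_eq_three.2 ⟨a, b, z, hab, hza.symm, hzb.symm, rfl⟩]
  exact Finset.card_le_univ _

end Bridges

section Sufficiency

variable {V : Type*} [Fintype V] {G : SimpleGraph V} [DecidableRel G.Adj] {S : Finset V} {κ : Kind}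

namespace IsGood

theorem isVertexGenerator (hG : IsCactus G) (h : IsGood G .vertex S)
    (hpath : ∀ n, 2 ≤ n → IsEmpty (G ≃g pathGraph n)) : IsVertexGenerator G S := by
  have hS := h.hasUniqueShadows hG fun n hn => hpath n (by omega)
  intro x y hxy
  by_cases hsep : ∃ C : Cycle G, C.root x ≠ C.root y
  · obtain ⟨C, hC⟩ := hsep
    obtain ⟨s, hs, hne⟩ := h.exists_ne_of_isProfile hG hS C (D := fun s => 2 * G.dist s x)
      (D' := fun s => 2 * G.dist s y) fun c hc => by
        obtain ⟨i, -, -, hi, hP⟩ := hG.exists_isProfile_dist hc S x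
        obtain ⟨j, -, -, hj, hP'⟩ := hG.exists_isProfile_dist hc S y
        refine ⟨_, _, _, _, fun e => hC ?_, hP, hP'⟩
        rw [← hi, ← hj, show i = j by omega]
    exact ⟨s, hs, fun e => hne (by simp only [e])⟩
  · push Not at hsep
    by_contra! hD
    refine hxy (hS.eq_of_forall_root_eq hG (hS.nonempty hG (hpath _ ?_)) hsep hD)
    exact Fintype.one_lt_card_iff.2 ⟨x, y, hxy⟩

theorem exists_edgeDist_ne_of_cycle (hG : IsCactus G) (h : IsGood G .edge S)
    (hS : HasUniqueShadows G .edge S) {a b c d : V} (hab : G.Adj a b) (hcd : G.Adj c d)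
    (hne : s(a, b) ≠ s(c, d)) {C : Cycle G}
    (hC : C.1.Adj a b ∨ C.1.Adj c d ∨ C.root a ≠ C.root c) :
    ∃ s ∈ S, edgeDist G s s(a, b) ≠ edgeDist G s s(c, d) := by
  obtain ⟨s, hs, hne⟩ := h.exists_ne_of_isProfile hG hS C
    (D := fun s => 2 * edgeDist G s s(a, b) + 1) (D' := fun s => 2 * edgeDist G s s(c, d) + 1)
    fun r hr => by
      obtain ⟨p, H, hP, h1⟩ := hG.exists_isProfile_edgeDist hr S hab
      obtain ⟨q, H', hP', h2⟩ := hG.exists_isProfile_edgeDist hr S hcd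
      refine ⟨p, q, H, H', ?_, hP, hP'⟩
      rintro rfl
      rcases h1 with ⟨-, i, hi, hi'⟩ | ⟨h1, i, hi, hi'⟩ <;>
        rcases h2 with ⟨-, j, hj, hj'⟩ | ⟨h2, j, hj, hj'⟩
      · obtain rfl : i = j := by omega
        exact hne (hi'.trans hj'.symm)
      · omega
      · omega
      · obtain rfl : i = j := by omega
        exact (hC.resolve_left h1).resolve_left h2 (hi'.trans hj'.symm)
  exact ⟨s, hs, fun e => hne (by simp only [e])⟩

theorem isEdgeGenerator (hG : IsCactus G) (h : IsGood G .edge S)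
    (hpath : ∀ n, 3 ≤ n → IsEmpty (G ≃g pathGraph n)) : IsEdgeGenerator G S := by
  have hS := h.hasUniqueShadows hG hpath
  rintro ⟨a, b⟩ hab ⟨c, d⟩ hcd hne
  change G.Adj a b at hab
  change G.Adj c d at hcd
  change s(a, b) ≠ s(c, d) at hne
  change ∃ s ∈ S, edgeDist G s s(a, b) ≠ edgeDist G s s(c, d)
  by_cases hsep : ∃ C : Cycle G, C.1.Adj a b ∨ C.1.Adj c d ∨ C.root a ≠ C.root c
  · obtain ⟨C, hC⟩ := hsep
    exact h.exists_edgeDist_ne_of_cycle hG hS hab hcd hne hC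
  · push Not at hsep
    by_contra! hD
    refine hne (hS.eq_of_forall_edgeDist_eq hG
      (hS.nonempty hG (hpath _ (three_le_card_of_mk_ne hab.ne hcd.ne hne))) hab hcd
      ((isBridge_iff_forall_cycle_not_adj hab).2 fun C => (hsep C).1)
      ((isBridge_iff_forall_cycle_not_adj hcd).2 fun C => (hsep C).2.1) (fun C => ?_) hD)
    have hroota := hG.root_eq_of_adj hab (hsep C).1
    have hrootc := hG.root_eq_of_adj hcd (hsep C).2.1
    simp [hroota, hrootc, (hsep C).2.2]

end IsGood

end Sufficiency

/-! ### Dependence on the set -/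

section Congr

variable {V : Type*} {G : SimpleGraph V} {C : Cycle G} {S S' : Finset V} {κ : Kind}

theorem Cycle.IsCritical.congr (h : ∀ v, C.IsActive S v ↔ C.IsActive S' v) {v : V}
    (hv : C.IsCritical κ S v) : C.IsCritical κ S' v := by
  simpa only [Cycle.IsCritical, Cycle.IsSPath, Cycle.IsCoveringPath, h] using hv

theorem Cycle.IsCritical.mem_verts {v : V} (h : C.IsCritical κ S v) : v ∈ C.1.verts := by
  obtain ⟨c, -, -, hc, rfl, -⟩ := h.exists_isParam
  exact hc.mem 0

theorem Labelling.IsCanonical.congr (h : ∀ v, C.IsActive S v ↔ C.IsActive S' v)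
    {lab : Labelling C} {k : ℕ} (hk : lab.IsCanonical S k) : lab.IsCanonical S' k := by
  simpa only [Labelling.IsCanonical, Labelling.HasMaxActive, h] using hk

theorem Cycle.numActive_congr (h : ∀ v, C.IsActive S v ↔ C.IsActive S' v) :
    C.numActive S = C.numActive S' := by
  simp only [Cycle.numActive, h]

theorem Cycle.IsActive.mono (hS : S ⊆ S') {v : V} (h : C.IsActive S v) : C.IsActive S' v :=
  ⟨h.1, h.2.imp fun _ hs => ⟨hS hs.1, hs.2⟩⟩

theorem Cycle.HasGeodesicTriple.mono (hS : S ⊆ S') (h : C.HasGeodesicTriple S) :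
    C.HasGeodesicTriple S' := by
  obtain ⟨c, p, q, hc, h0, hp, hq, h⟩ := h
  exact ⟨c, p, q, hc, h0.mono hS, hp.mono hS, hq.mono hS, h⟩

theorem Cycle.exists_isParam_two_mul_le (h2 : 2 ≤ C.numActive S) :
    ∃ (c : ℤ → V) (j : ℤ), C.IsParam c ∧ C.IsActive S (c 0) ∧ C.IsActive S (c j) ∧ 0 < j ∧
      2 * j ≤ C.len := by
  obtain ⟨r, -⟩ := C.exists_isParam
  obtain ⟨a, ha, -⟩ := Cycle.exists_active_ne h2 (r 0)
  obtain ⟨b, hb, hab⟩ := Cycle.exists_active_ne h2 a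
  obtain ⟨c, hc, rfl⟩ := Cycle.exists_isParam_zero ha.1
  obtain ⟨j, hj0, hjn, rfl⟩ := hc.exists_rep 0 hb.1
  have hj : 0 < j := hj0.lt_of_ne (by rintro rfl; exact hab rfl)
  by_cases hjn' : 2 * j ≤ C.len
  · exact ⟨c, j, hc, ha, hb, hj, hjn'⟩
  · refine ⟨_, C.len - j, hc.reflect 0, by simpa using ha, ?_, by omega, by omega⟩
    have := hc.add_len (j - C.len)
    rw [sub_add_cancel] at this
    simpa [← this] using hb

/-- Two active vertices are completed to a triple by a vertex almost antipodal to the first. -/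
theorem Cycle.exists_hasGeodesicTriple_insert [DecidableEq V] (h2 : 2 ≤ C.numActive S) :
    ∃ w ∈ C.1.verts, C.HasGeodesicTriple (insert w S) := by
  have h3 := C.three_le_len
  obtain ⟨c, j, hc, h0, hj, hj0, hjn⟩ := Cycle.exists_isParam_two_mul_le h2
  have hsub : S ⊆ insert (c (C.len / 2 + 1 : ℕ)) S := Finset.subset_insert _ _
  exact ⟨_, hc.mem _, c, j, (C.len / 2 + 1 : ℕ), hc, h0.mono hsub, hj.mono hsub,
    ⟨hc.mem _, _, Finset.mem_insert_self _ _, C.mem_comp_self _⟩, hj0, by omega, by omega, hjn,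
    by omega, by omega⟩

namespace Labelling

variable {lab : Labelling C} {k i : ℕ}

theorem vert_mem_verts (lab : Labelling C) (i : ℕ) : lab.vert i ∈ C.1.verts := by
  rw [← lab.toSubgraph_eq, Walk.mem_verts_toSubgraph]
  exact Walk.getVert_mem_support _ _

theorem HasMaxActive.isCritical_vert (hG : IsCactus G) (h : lab.HasMaxActive S k)
    (hkb : k ≤ κ.critBound C.len) (hi : i = 0 ∨ i = k) : C.IsCritical κ S (lab.vert i) := by
  obtain ⟨hkn, h0, hk, hall⟩ := hasMaxActive_iff.1 h
  have hc := lab.isParam_param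
  rw [← lab.param_natCast (by omega)]
  rcases hi with rfl | rfl
  · exact hG.isCritical_of_activeWithin hc h0 hk hall hkb
  · have := hG.isCritical_of_activeWithin (κ := κ) (hc.reflect i) (by simpa using hk)
      (by simpa using h0) hall.reflect hkb
    simpa using this

theorem IsCanonical.eq_zero_or_eq (hcan : lab.IsCanonical S k) (h2 : C.numActive S = 2)
    (hi : i < C.len) (hact : C.IsActive S (lab.vert i)) : i = 0 ∨ i = k := by
  have hkn := hcan.1.2.1.1
  have hpos := hcan.pos h2.ge
  have hne : lab.vert 0 ≠ lab.vert k := fun e => hpos.ne ((lab.vert_inj (by omega) hkn).1 e)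
  rcases Cycle.eq_or_eq_of_numActive h2 hcan.1.1 hcan.1.2.1.2 hne hact with e | e
  · exact Or.inl ((lab.vert_inj hi (by omega)).1 e)
  · exact Or.inr ((lab.vert_inj hi hkn).1 e)

end Labelling

end Congr

section Transfer

variable {V : Type*} [Fintype V] {G : SimpleGraph V} [DecidableRel G.Adj] {C : Cycle G}
  {S S' : Finset V} {κ : Kind} {lab : Labelling C} {k : ℕ}

namespace Labelling

theorem ConfigThread.of_isCritical (hG : IsCactus G) (hmax : lab.HasMaxActive S k)
    (hkb : k ≤ κ.critBound C.len) {i : ℕ} {l : List V} (hi : i = 0 ∨ i = k)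
    (hl : IsFreeThread G S (lab.vert i) l)
    (hcrit : ∀ v l, C.IsCritical κ S v → IsFreeThread G S v l → ∃ l', IsFreeThread G S' v l') :
    lab.ConfigThread κ S' k := by
  obtain ⟨l', hl'⟩ := hcrit _ _ (hmax.isCritical_vert hG hkb hi) hl
  exact ⟨hkb, i, l', hl', by omega⟩

theorem ConfigThread.transfer (hG : IsCactus G) (hmax : lab.HasMaxActive S k)
    (hthr : ∀ v ∈ C.1.verts, ¬ C.IsActive S v → ∀ l, IsFreeThread G S v l → IsFreeThread G S' v l)
    (hcrit : ∀ v l, C.IsCritical κ S v → IsFreeThread G S v l → ∃ l', IsFreeThread G S' v l')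
    (h : lab.ConfigThread κ S k) : lab.ConfigThread κ S' k := by
  obtain ⟨hkb, i, l, hl, hi⟩ := h
  have hlt := κ.critBound_lt C
  by_cases hact : C.IsActive S (lab.vert i)
  · have hik : i ≤ k := hmax.2.2 ⟨by omega, hact⟩
    exact .of_isCritical hG hmax hkb (i := i) (by omega) hl hcrit
  · exact ⟨hkb, i, l, hthr _ (lab.vert_mem_verts i) hact l hl, hi⟩

theorem ConfigLong.transfer (hG : IsCactus G) (hcan : lab.IsCanonical S k)
    (hnum : C.numActive S = C.numActive S')
    (hthr : ∀ v ∈ C.1.verts, ¬ C.IsActive S v → ∀ l, IsFreeThread G S v l → IsFreeThread G S' v l)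
    (hcrit : ∀ v l, C.IsCritical κ S v → IsFreeThread G S v l → ∃ l', IsFreeThread G S' v l')
    (h : lab.ConfigLong S k κ) :
    lab.ConfigA S' k ∨ lab.ConfigThread κ S' k ∨ lab.ConfigLong S' k κ := by
  obtain ⟨htwo, hk2⟩ : C.numActive S = 2 ∧ 2 * k ≤ C.len := by
    have : C.numActive S = 2 := by cases κ <;> exact h.1
    exact ⟨this, hcan.two_mul_le this⟩
  have hpos := hcan.pos htwo.ge
  have h3 := C.three_le_len
  cases κ with
  | vertex =>
    obtain ⟨-, heven, hkn2, i, l, hik, hl, hlen⟩ := h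
    by_cases hA : k = C.len / 2
    · exact .inl ⟨hnum ▸ htwo, heven, hA⟩
    by_cases hact : C.IsActive S (lab.vert i)
    · have hi := hcan.eq_zero_or_eq htwo (by omega) hact
      exact .inr (.inl (.of_isCritical hG hcan.1 (by simp only [Kind.critBound]; omega) hi hl
        hcrit))
    · exact .inr (.inr ⟨hnum ▸ htwo, heven, hkn2, i, l, hik,
        hthr _ (lab.vert_mem_verts i) hact l hl, hlen⟩)
  | edge =>
    obtain ⟨-, i, l, hik, hl, hlen, hopp⟩ := h
    by_cases hA : 2 * k = C.len
    · exact .inl ⟨hnum ▸ htwo, ⟨k, by omega⟩, by omega⟩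
    by_cases hact : C.IsActive S (lab.vert i)
    · have hi := hcan.eq_zero_or_eq htwo (by omega) hact
      exact .inr (.inl (.of_isCritical hG hcan.1 (by simp only [Kind.critBound]; omega) hi hl
        hcrit))
    · refine .inr (.inr ⟨hnum ▸ htwo, i, l, hik, hthr _ (lab.vert_mem_verts i) hact l hl, hlen,
        fun heven => ?_⟩)
      obtain ⟨l', hl'⟩ := hopp heven
      have hi0 : i ≠ 0 := by
        rintro rfl
        exact hact hcan.1.1
      refine ⟨l', hthr _ (lab.vert_mem_verts _) (fun hact' => ?_) l' hl'⟩
      have heven := Nat.even_iff.1 heven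
      have := hcan.eq_zero_or_eq htwo (by omega) hact'
      omega

end Labelling

/-- The configurations depend only on the active vertices, on the free threads at inactive
vertices, and on the existence of free threads at critical vertices. -/
theorem Cycle.ContainsConfig.transfer (hG : IsCactus G)
    (hact : ∀ v, C.IsActive S v ↔ C.IsActive S' v)
    (hthr : ∀ v ∈ C.1.verts, ¬ C.IsActive S v → ∀ l, IsFreeThread G S v l → IsFreeThread G S' v l)
    (hcrit : ∀ v l, C.IsCritical κ S v → IsFreeThread G S v l → ∃ l', IsFreeThread G S' v l')
    (h : C.ContainsConfig κ S) : C.ContainsConfig κ S' := by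
  rw [Cycle.containsConfig_iff] at h ⊢
  obtain ⟨lab, k, hcan, h⟩ := h
  have hnum := Cycle.numActive_congr hact
  refine ⟨lab, k, hcan.congr hact, ?_⟩
  rcases h with ⟨htwo, hA⟩ | h | h
  · exact .inl ⟨hnum ▸ htwo, hA⟩
  · exact .inr (.inl (h.transfer hG hcan.1 hthr hcrit))
  · exact h.transfer hG hcan hnum hthr hcrit

theorem Cycle.HasGeodesicTriple.not_containsConfig (hG : IsCactus G) (h : C.HasGeodesicTriple S) :
    ¬ C.ContainsConfig κ S := by
  rw [Cycle.containsConfig_iff]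
  rintro ⟨lab, k, hcan, hconf⟩
  have hthree := h.three_le_numActive
  rcases hconf with ⟨htwo, -⟩ | ⟨hkb, -⟩ | hconf
  · omega
  · exact h.not_isCritical hG _ (hcan.1.isCritical_vert hG hkb (.inl rfl))
  · have htwo : C.numActive S = 2 := by cases κ <;> exact hconf.1
    omega

end Transfer

/-! ### Counting: a partition into cells -/

theorem exists_transversal {α V : Type*} {R : α → V → Prop} (hR : ∀ a b x, R a x → R b x → a = b)
    {S : Finset V} {r : ℕ} (hr : r ≤ {a | ∃ x ∈ S, R a x}.ncard) :
    ∃ T ⊆ S, T.card = r ∧ (∀ x ∈ T, ∃ a, R a x) ∧ r ≤ {a | ∃ x ∈ T, R a x}.ncard := by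
  classical
  obtain ⟨Q, hQ, rfl⟩ := Set.exists_subset_card_eq hr
  choose f hfS hfR using hQ
  have hinj : Function.Injective fun a : Q => f a.2 := fun a b hab =>
    Subtype.ext (hR _ _ _ (hfR a.2) ((congrArg (R b) hab).mpr (hfR b.2)))
  have hfin : (Set.range fun a : Q => f a.2).Finite :=
    S.finite_toSet.subset (Set.range_subset_iff.2 fun a => hfS a.2)
  have hmem (a : Q) : f a.2 ∈ hfin.toFinset := hfin.mem_toFinset.2 ⟨a, rfl⟩
  refine ⟨hfin.toFinset, ?_, ?_, ?_, ?_⟩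
  · exact fun x hx => (hfin.mem_toFinset.1 hx).elim fun a ha => ha ▸ hfS a.2
  · rw [← Set.ncard_eq_toFinset_card _ hfin, Set.ncard_range_of_injective hinj,
      Nat.card_coe_set_eq]
  · exact fun x hx => (hfin.mem_toFinset.1 hx).elim fun a ha => ⟨a, ha ▸ hfR a.2⟩
  · refine Set.ncard_le_ncard (fun a ha => ⟨_, hmem ⟨a, ha⟩, hfR ha⟩) ?_
    refine (hfin.toFinset.finite_toSet.biUnion fun x _ =>
      Set.Subsingleton.finite (s := {a | R a x}) fun a ha b hb => hR a b x ha hb).subset ?_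
    exact fun a ⟨x, hx, h⟩ => Set.mem_biUnion hx h

section Threads

variable {V : Type*} [Fintype V] {G : SimpleGraph V} [DecidableRel G.Adj] {C : Cycle G}

theorem IsThread.ne_nil {v : V} {l : List V} (h : IsThread G v l) : l ≠ [] := by
  obtain ⟨-, -, -, u, t, rfl, -⟩ := h
  exact List.cons_ne_nil u t

theorem finite_setOf_isThread (G : SimpleGraph V) [DecidableRel G.Adj] (v : V) :
    {l | IsThread G v l}.Finite :=
  have hnodup : Finite {l : List V // l.Nodup} := inferInstance
  (Set.finite_coe_iff.1 hnodup).subset fun _ h => h.2.1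

theorem IsThread.root_eq (hG : IsCactus G) {v : V} {l : List V} (h : IsThread G v l) {x : V}
    (hx : x ∈ l) (C : Cycle G) : C.root x = C.root v := by
  obtain ⟨z, hz⟩ := h.exists_isTail
  refine branch_induction (P := fun x => C.root x = C.root v) ?_ ?_ (hz.mem_iff_mem_branch.1 hx)
  · exact hG.root_eq_of_adj hz.adj fun hC => h.notMem_verts hz.mem C hC.snd_mem
  · intro a b ha hroot hab _
    rw [← hroot]
    exact hG.root_eq_of_adj hab fun hC =>
      h.notMem_verts (hz.mem_iff_mem_branch.2 ha) C hC.fst_mem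

theorem numThreads_le_one {v : V} (hv : v ∈ C.1.verts) (h : ¬ C.IsBranchActive v) :
    numThreads G v ≤ 1 := by
  rw [numThreads, Set.ncard_le_one (finite_setOf_isThread G v)]
  intro l hl l' hl'
  by_contra hne
  obtain ⟨z, hz⟩ := hl.exists_isTail
  obtain ⟨z', hz'⟩ := hl'.exists_isTail
  refine h ⟨hv, Or.inl (Cycle.four_le_degree hv hz.adj (fun hC => ?_) hz'.adj (fun hC => ?_) ?_)⟩
  · exact hl.notMem_verts hz.mem C hC.snd_mem
  · exact hl'.notMem_verts hz'.mem C hC.snd_mem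
  · rintro rfl
    exact hne (hl.eq_of_mem hl' hz.mem hz'.mem).2

theorem IsCactus.isBranchActive_root (hG : IsCactus G) {C D : Cycle G} (hCD : C ≠ D) {x : V}
    (hx : x ∈ D.1.verts) : C.IsBranchActive (C.root x) := by
  refine ⟨hG.root_mem C x, ?_⟩
  by_cases hu : C.root x ∈ D.1.verts
  · left
    obtain ⟨a, b, hab, ha, hb, -⟩ := Cycle.exists_nbrs hu
    exact Cycle.four_le_degree (C := C) (hG.root_mem C x) ha.adj_sub
      (fun h => hCD (hG.eq_of_adj h ha)) hb.adj_sub (fun h => hCD (hG.eq_of_adj h hb)) hab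
  · right
    have hne : D.root (C.root x) ≠ C.root x := fun e => hu (e ▸ hG.root_mem D _)
    refine ⟨D.root (C.root x), ?_, hne, ?_⟩
    · rw [hG.mem_comp_iff (hG.root_mem C x)]
      exact hG.root_eq_root hCD (hG.root_mem D _) hx
    · obtain ⟨z, hz, hz', -⟩ := Cycle.exists_branch (hG.mem_comp_root D (C.root x)) hne.symm
      exact Cycle.three_le_degree (hG.root_mem D _) hz hz'

theorem IsCactus.isBranchActive_of_mem (hG : IsCactus G) {C D : Cycle G} (hCD : C ≠ D) {v : V}
    (hC : v ∈ C.1.verts) (hD : v ∈ D.1.verts) : C.IsBranchActive v :=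
  hG.root_self hC ▸ hG.isBranchActive_root hCD hD

end Threads

section Cells

variable {V : Type*} [Fintype V] {G : SimpleGraph V} [DecidableRel G.Adj] {C : Cycle G}
  {S S' : Finset V} {v : V}

open Classical in
/-- The set of vertices whose membership in `S` decides whether `S` meets enough threads at a
vertex, respectively whether enough vertices of a cycle are `S`-active. A vertex that lies on a
cycle without being branch-active there has at most one thread; its cell is empty, so that the
cells are pairwise disjoint. -/
noncomputable def cell (G : SimpleGraph V) [DecidableRel G.Adj] : V ⊕ Cycle G → Finset V
  | .inl v => {x | (∃ l, IsThread G v l ∧ x ∈ l) ∧ ∀ C : Cycle G, v ∈ C.1.verts →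
      C.IsBranchActive v}
  | .inr C => {x | ¬ C.IsBranchActive (C.root x)}

/-- The number of elements that a biactive branch-resolving set needs in a cell. -/
noncomputable def demand (G : SimpleGraph V) [DecidableRel G.Adj] : V ⊕ Cycle G → ℕ
  | .inl v => numThreads G v - 1
  | .inr C => 2 - C.numBranchActive

/-- The requirement that branch-resolution imposes at a vertex and biactivity on a cycle; on a
cycle branch-active vertices count as active, as they are active for every set that satisfies all
requirements. -/
def IsSufficient (G : SimpleGraph V) [DecidableRel G.Adj] (S : Finset V) : V ⊕ Cycle G → Prop
  | .inl v => {l | IsFreeThread G S v l}.Subsingleton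
  | .inr C => 2 ≤ {v | C.IsBranchActive v ∨ C.IsActive S v}.ncard

theorem mem_cell_inl {x : V} : x ∈ cell G (.inl v) ↔ (∃ l, IsThread G v l ∧ x ∈ l) ∧
    ∀ C : Cycle G, v ∈ C.1.verts → C.IsBranchActive v := by
  simp [cell]

theorem mem_cell_inr {x : V} : x ∈ cell G (.inr C) ↔ ¬ C.IsBranchActive (C.root x) := by
  simp [cell]

theorem IsFreeThread.anti (hS : S ⊆ S') {l : List V} (h : IsFreeThread G S' v l) :
    IsFreeThread G S v l :=
  ⟨h.1, fun x hx hxS => h.2 x hx (hS hxS)⟩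

theorem isSufficient_inl_iff : IsSufficient G S (.inl v) ↔
    numThreads G v - 1 ≤ {l | ∃ x ∈ S, IsThread G v l ∧ x ∈ l}.ncard := by
  set Q := {l | ∃ x ∈ S, IsThread G v l ∧ x ∈ l}
  have hfin := finite_setOf_isThread G v
  have hadd : ({l | IsThread G v l} \ Q).ncard + Q.ncard = numThreads G v :=
    Set.ncard_sdiff_add_ncard_of_subset (fun l ⟨_, _, hl, _⟩ => hl) hfin
  have hfree : {l | IsFreeThread G S v l} = {l | IsThread G v l} \ Q := by
    ext l
    exact ⟨fun hl => ⟨hl.1, fun ⟨x, hxS, _, hx⟩ => hl.2 x hx hxS⟩,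
      fun hl => ⟨hl.1, fun x hx hxS => hl.2 ⟨x, hxS, hl.1, hx⟩⟩⟩
  have : Finite ({l | IsThread G v l} \ Q : Set (List V)) := hfin.subset Set.sdiff_subset
  rw [IsSufficient, hfree, ← Set.ncard_le_one_iff_subsingleton]
  omega

theorem isSufficient_inr_iff (hG : IsCactus G) : IsSufficient G S (.inr C) ↔
    2 - C.numBranchActive ≤ {u | ∃ x ∈ S, ¬ C.IsBranchActive u ∧ C.root x = u}.ncard := by
  set Q := {u | ∃ x ∈ S, ¬ C.IsBranchActive u ∧ C.root x = u}
  have hunion : {v | C.IsBranchActive v ∨ C.IsActive S v} = {v | C.IsBranchActive v} ∪ Q := by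
    ext u
    simp only [Q, hG.isActive_iff, Set.mem_union, Set.mem_ofPred_eq]
    grind
  have hdisj : Disjoint {v | C.IsBranchActive v} Q :=
    Set.disjoint_left.2 fun u hu ⟨_, _, hu', _⟩ => hu' hu
  rw [IsSufficient, hunion, Set.ncard_union_eq hdisj (Set.toFinite _) (Set.toFinite _),
    Cycle.numBranchActive]
  omega

namespace IsSufficient

theorem mono (hS : S ⊆ S') {i : V ⊕ Cycle G} (h : IsSufficient G S i) : IsSufficient G S' i := by
  cases i with
  | inl v => exact Set.Subsingleton.anti h fun l hl => IsFreeThread.anti hS hl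
  | inr C =>
    exact le_trans h (Set.ncard_le_ncard (fun v hv => hv.imp_right fun h => h.mono hS)
      (Set.toFinite _))

theorem exists_subset (hG : IsCactus G) {i : V ⊕ Cycle G} (h : IsSufficient G S i) :
    ∃ T ⊆ S, T ⊆ cell G i ∧ T.card = demand G i ∧ IsSufficient G T i := by
  cases i with
  | inl v =>
    obtain ⟨T, hTS, hcard, hT, hTr⟩ := exists_transversal
      (fun _ _ _ h h' => (h.1.eq_of_mem h'.1 h.2 h'.2).2) (isSufficient_inl_iff.1 h)
    refine ⟨T, hTS, fun x hx => mem_cell_inl.2 ⟨hT x hx, fun C hC => ?_⟩, hcard,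
      isSufficient_inl_iff.2 hTr⟩
    by_contra hb
    have := numThreads_le_one hC hb
    have := Finset.card_pos.2 ⟨x, hx⟩
    omega
  | inr C =>
    obtain ⟨T, hTS, hcard, hT, hTr⟩ := exists_transversal
      (fun _ _ _ h h' => h.2.symm.trans h'.2) ((isSufficient_inr_iff hG).1 h)
    refine ⟨T, hTS, fun x hx => ?_, hcard, (isSufficient_inr_iff hG).2 hTr⟩
    obtain ⟨_, hu, rfl⟩ := hT x hx
    exact mem_cell_inr.2 hu

theorem univ (i : V ⊕ Cycle G) : IsSufficient G Finset.univ i := by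
  cases i with
  | inl v =>
    intro l hl
    obtain ⟨x, hx⟩ := List.exists_mem_of_ne_nil l hl.1.ne_nil
    exact absurd (Finset.mem_univ x) (hl.2 x hx)
  | inr C =>
    have hlen : C.len ≤ {v | C.IsBranchActive v ∨ C.IsActive Finset.univ v}.ncard :=
      Set.ncard_le_ncard (fun v hv => Or.inr ⟨hv, v, Finset.mem_univ _, C.mem_comp_self v⟩)
        (Set.toFinite _)
    exact (Nat.le_of_succ_le C.three_le_len).trans hlen

end IsSufficient

theorem isBiactive_and_isBranchResolving_iff (hG : IsCactus G) :
    IsBiactive G S ∧ IsBranchResolving G S ↔ ∀ i, IsSufficient G S i := by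
  constructor
  · rintro ⟨hbi, hbr⟩ (v | C)
    · exact hbr v
    · exact hbi.isWeaklyBiactive C
  · intro h
    have hbr : IsBranchResolving G S := fun v => h (.inl v)
    exact ⟨IsWeaklyBiactive.isBiactive hG hbr fun C => h (.inr C), hbr⟩

theorem disjoint_cell_inl_inr (hG : IsCactus G) (v : V) (C : Cycle G) :
    Disjoint (cell G (.inl v)) (cell G (.inr C)) := by
  rw [Finset.disjoint_left]
  intro x hx hxC
  obtain ⟨⟨l, hl, hxl⟩, hb⟩ := mem_cell_inl.1 hx
  rw [mem_cell_inr, hl.root_eq hG hxl C] at hxC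
  by_cases hv : v ∈ C.1.verts
  · rw [hG.root_self hv] at hxC
    exact hxC (hb C hv)
  · exact hxC ⟨hG.root_mem C v, Or.inr ⟨v, hG.mem_comp_root C v,
      fun e => hv (e ▸ hG.root_mem C v), hl.1⟩⟩

theorem disjoint_cell (hG : IsCactus G) {i j : V ⊕ Cycle G} (hij : i ≠ j) :
    Disjoint (cell G i) (cell G j) := by
  rcases i with v | C <;> rcases j with w | D
  · rw [Finset.disjoint_left]
    intro x hx hx'
    obtain ⟨⟨l, hl, hxl⟩, -⟩ := mem_cell_inl.1 hx
    obtain ⟨⟨l', hl', hxl'⟩, -⟩ := mem_cell_inl.1 hx'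
    exact hij (congrArg _ (hl.eq_of_mem hl' hxl hxl').1)
  · exact disjoint_cell_inl_inr hG v D
  · exact (disjoint_cell_inl_inr hG w C).symm
  · rw [Finset.disjoint_left]
    intro x hx hx'
    rw [mem_cell_inr] at hx hx'
    have hCD : C ≠ D := fun e => hij (congrArg _ e)
    obtain ⟨c, hc⟩ := C.exists_isParam
    by_cases hr : D.root x = D.root (c 0)
    · rw [hr] at hx'
      exact hx' (hG.isBranchActive_root hCD.symm (hc.mem 0))
    · rw [hG.root_root (hc.mem 0) hCD hr] at hx
      exact hx (hG.isBranchActive_root hCD (hG.root_mem D x))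

theorem sum_demand : ∑ i, demand G i = surplusThreads G + missingBranchActive G := by
  rw [Fintype.sum_sum_type, surplusThreads, Finset.sum_filter]
  refine congrArg (· + _) (Finset.sum_congr rfl fun v _ => ?_)
  rw [demand]
  split_ifs <;> omega

end Cells

section Splice

variable {V : Type*} [Fintype V] [DecidableEq V] {G : SimpleGraph V} [DecidableRel G.Adj]
  {S S' : Finset V}

theorem IsSufficient.demand_le_card (hG : IsCactus G) {i : V ⊕ Cycle G}
    (h : IsSufficient G S i) : demand G i ≤ (S ∩ cell G i).card := by
  obtain ⟨T, hTS, hTc, hcard, -⟩ := h.exists_subset hG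
  rw [← hcard]
  exact Finset.card_le_card (Finset.subset_inter hTS hTc)

theorem IsSufficient.of_inter_subset (hG : IsCactus G) {i : V ⊕ Cycle G}
    (h : IsSufficient G S i) (hS : S ∩ cell G i ⊆ S') : IsSufficient G S' i := by
  obtain ⟨T, hTS, hTc, -, hT⟩ := h.exists_subset hG
  exact hT.mono ((Finset.subset_inter hTS hTc).trans hS)

theorem sum_card_inter_cell_le (hG : IsCactus G) (S : Finset V) :
    ∑ i, (S ∩ cell G i).card ≤ S.card := by
  rw [← Finset.card_biUnion fun i _ j _ hij =>
    (disjoint_cell hG hij).mono Finset.inter_subset_right Finset.inter_subset_right]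
  exact Finset.card_le_card (Finset.biUnion_subset.2 fun i _ => Finset.inter_subset_left)

theorem biUnion_inter_cell_inter_cell (hG : IsCactus G) (F : V ⊕ Cycle G → Finset V)
    (i : V ⊕ Cycle G) :
    (Finset.univ.biUnion fun j => F j ∩ cell G j) ∩ cell G i = F i ∩ cell G i := by
  ext x
  simp only [Finset.mem_inter, Finset.mem_biUnion, Finset.mem_univ, true_and]
  refine ⟨fun ⟨⟨j, hj, hxj⟩, hxi⟩ => ?_, fun h => ⟨⟨i, h⟩, h.2⟩⟩
  obtain rfl : i = j := by
    by_contra hij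
    exact Finset.disjoint_left.1 (disjoint_cell hG hij) hxi hxj
  exact ⟨hj, hxi⟩

theorem exists_splice (hG : IsCactus G) (F : V ⊕ Cycle G → Finset V)
    (hF : ∀ i, IsSufficient G (F i) i) (hcard : ∀ i, (F i ∩ cell G i).card = demand G i) :
    ∃ S, (∀ i, IsSufficient G S i) ∧ S.card ≤ ∑ i, demand G i ∧
      (∀ i, S ∩ cell G i = F i ∩ cell G i) ∧ ∀ x ∈ S, ∃ i, x ∈ F i := by
  have hinter := biUnion_inter_cell_inter_cell hG F
  refine ⟨Finset.univ.biUnion fun i => F i ∩ cell G i, fun i => ?_, ?_, hinter, fun x hx => ?_⟩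
  · exact (hF i).of_inter_subset hG (hinter i ▸ Finset.inter_subset_left)
  · exact Finset.card_biUnion_le.trans (Finset.sum_le_sum fun i _ => (hcard i).le)
  · obtain ⟨i, -, hi⟩ := Finset.mem_biUnion.1 hx
    exact ⟨i, Finset.mem_of_mem_inter_left hi⟩

end Splice

section Smallest

variable {V : Type*} [Fintype V] {G : SimpleGraph V} [DecidableRel G.Adj] {S : Finset V}

theorem sum_demand_le_card (hG : IsCactus G) (h : ∀ i, IsSufficient G S i) :
    ∑ i, demand G i ≤ S.card := by
  classical
  exact (Finset.sum_le_sum fun i _ => (h i).demand_le_card hG).trans (sum_card_inter_cell_le hG S)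

theorem exists_subset_card_le_sum_demand (hG : IsCactus G) (h : ∀ i, IsSufficient G S i) :
    ∃ T ⊆ S, (∀ i, IsSufficient G T i) ∧ T.card ≤ ∑ i, demand G i := by
  classical
  choose F hFS hFc hcard hF using fun i => (h i).exists_subset hG
  obtain ⟨T, hT, hTc, -, hTF⟩ := exists_splice hG F hF fun i => by
    rw [Finset.inter_eq_left.2 (hFc i), hcard i]
  exact ⟨T, fun x hx => (hTF x hx).elim fun i hi => hFS i hi, hT, hTc⟩

theorem isSmallestBBR_iff (hG : IsCactus G) :
    IsSmallestBBR G S ↔ (∀ i, IsSufficient G S i) ∧ S.card ≤ ∑ i, demand G i := by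
  simp only [IsSmallestBBR, isBiactive_and_isBranchResolving_iff hG]
  refine and_congr_right fun hS => ⟨fun h => ?_, fun h S' hS' => ?_⟩
  · obtain ⟨T, -, hT, hTc⟩ := exists_subset_card_le_sum_demand hG hS
    exact (h T hT).trans hTc
  · exact h.trans (sum_demand_le_card hG hS')

theorem exists_isSmallestBBR_subset (hG : IsCactus G)
    (h : IsBiactive G S ∧ IsBranchResolving G S) : ∃ T ⊆ S, IsSmallestBBR G T := by
  obtain ⟨T, hTS, hT, hTc⟩ :=
    exists_subset_card_le_sum_demand hG ((isBiactive_and_isBranchResolving_iff hG).1 h)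
  exact ⟨T, hTS, (isSmallestBBR_iff hG).2 ⟨hT, hTc⟩⟩

theorem exists_isSmallestBBR (hG : IsCactus G) : ∃ S, IsSmallestBBR G S := by
  obtain ⟨T, -, hT⟩ := exists_isSmallestBBR_subset hG
    ((isBiactive_and_isBranchResolving_iff hG).2 IsSufficient.univ)
  exact ⟨T, hT⟩

namespace IsSmallestBBR

theorem card_eq (hG : IsCactus G) (h : IsSmallestBBR G S) :
    S.card = surplusThreads G + missingBranchActive G := by
  rw [isSmallestBBR_iff hG] at h
  rw [← sum_demand]
  exact le_antisymm h.2 (sum_demand_le_card hG h.1)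

theorem card_inter_cell [DecidableEq V] (hG : IsCactus G) (h : IsSmallestBBR G S)
    (i : V ⊕ Cycle G) : (S ∩ cell G i).card = demand G i := by
  rw [isSmallestBBR_iff hG] at h
  have hle : ∀ i ∈ Finset.univ, demand G i ≤ (S ∩ cell G i).card :=
    fun i _ => (h.1 i).demand_le_card hG
  have hsum : ∑ i, demand G i = ∑ i, (S ∩ cell G i).card :=
    le_antisymm (Finset.sum_le_sum hle) ((sum_card_inter_cell_le hG S).trans h.2)
  exact ((Finset.sum_eq_sum_iff_of_le hle).1 hsum i (Finset.mem_univ i)).symm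

theorem exists_splice [DecidableEq V] (hG : IsCactus G) {F : V ⊕ Cycle G → Finset V}
    (hF : ∀ i, IsSmallestBBR G (F i)) :
    ∃ S, IsSmallestBBR G S ∧ ∀ i, S ∩ cell G i = F i ∩ cell G i := by
  obtain ⟨S, hS, hcard, hi, -⟩ := Cactus.exists_splice hG F
    (fun i => ((isSmallestBBR_iff hG).1 (hF i)).1 i) fun i => (hF i).card_inter_cell hG i
  exact ⟨S, (isSmallestBBR_iff hG).2 ⟨hS, hcard⟩, hi⟩

end IsSmallestBBR

end Smallest

/-! ### Nice sets -/

section Cells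

variable {V : Type*} [Fintype V] [DecidableEq V] {G : SimpleGraph V} [DecidableRel G.Adj]
  {C : Cycle G} {S S' : Finset V} {κ : Kind} {v : V}

theorem Cycle.IsActive.of_inter_subset (hG : IsCactus G)
    (h' : IsBiactive G S' ∧ IsBranchResolving G S') (he : S ∩ cell G (.inr C) ⊆ S')
    (h : C.IsActive S v) : C.IsActive S' v := by
  by_cases hb : C.IsBranchActive v
  · exact hb.isActive hG h'.2 h'.1.isWeaklyBiactive
  · obtain ⟨s, hs, rfl⟩ := hG.isActive_iff.1 h
    exact hG.isActive_iff.2 ⟨s, he (Finset.mem_inter.2 ⟨hs, mem_cell_inr.2 hb⟩), rfl⟩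

theorem Cycle.isActive_congr (hG : IsCactus G) (h : IsBiactive G S ∧ IsBranchResolving G S)
    (h' : IsBiactive G S' ∧ IsBranchResolving G S')
    (he : S ∩ cell G (.inr C) = S' ∩ cell G (.inr C)) (v : V) :
    C.IsActive S v ↔ C.IsActive S' v :=
  ⟨fun hv => hv.of_inter_subset hG h' (he ▸ Finset.inter_subset_left),
    fun hv => hv.of_inter_subset hG h (he ▸ Finset.inter_subset_left)⟩

theorem IsFreeThread.of_inter_subset (hG : IsCactus G) (he : S' ∩ cell G (.inr C) ⊆ S)
    {l : List V} (hv : v ∈ C.1.verts) (hb : ¬ C.IsBranchActive v) (h : IsFreeThread G S v l) :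
    IsFreeThread G S' v l := by
  refine ⟨h.1, fun x hx hxS => h.2 x hx (he (Finset.mem_inter.2 ⟨hxS, mem_cell_inr.2 ?_⟩))⟩
  rwa [h.1.root_eq hG hx C, hG.root_self hv]

theorem demand_lt_card (hG : IsCactus G) (hv : C.IsBranchActive v) {l : List V}
    (hl : IsThread G v l) (hfree : ∀ l', ¬ IsFreeThread G S v l') :
    demand G (.inl v) < (S ∩ cell G (.inl v)).card := by
  have hmeet : {l | IsThread G v l} ⊆ {l | ∃ x ∈ S, IsThread G v l ∧ x ∈ l} := fun l hl => by
    by_contra hS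
    exact hfree l ⟨hl, fun x hx hxS => hS ⟨x, hxS, hl, hx⟩⟩
  obtain ⟨T, hTS, hTc, hT, -⟩ := exists_transversal
    (fun _ _ _ h h' => (h.1.eq_of_mem h'.1 h.2 h'.2).2)
    (Set.ncard_le_ncard hmeet
      ((finite_setOf_isThread G v).subset fun _ ⟨_, _, hl, _⟩ => hl))
  have hsub : T ⊆ S ∩ cell G (.inl v) :=
    Finset.subset_inter hTS fun x hx => mem_cell_inl.2 ⟨hT x hx, fun D hD => by
      by_cases hCD : C = D
      · exact hCD ▸ hv
      · exact hG.isBranchActive_of_mem (Ne.symm hCD) hD hv.1⟩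
  have hpos : 0 < numThreads G v := (Set.ncard_pos (finite_setOf_isThread G v)).2 ⟨l, hl⟩
  calc demand G (.inl v) < numThreads G v := Nat.sub_one_lt_of_lt hpos
    _ = T.card := hTc.symm
    _ ≤ _ := Finset.card_le_card hsub

/-- A configuration that survives in the cell of its cycle can only be destroyed by a selection of
all the threads at a critical vertex, one more than branch-resolution asks for. -/
theorem Cycle.ContainsConfig.exists_isCritical (hG : IsCactus G) (hS : C.ContainsConfig κ S)
    (h : IsBiactive G S ∧ IsBranchResolving G S) (h' : IsBiactive G S' ∧ IsBranchResolving G S')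
    (he : S ∩ cell G (.inr C) = S' ∩ cell G (.inr C)) (hS' : ¬ C.ContainsConfig κ S') :
    ∃ v, C.IsCritical κ S' v ∧ demand G (.inl v) < (S' ∩ cell G (.inl v)).card := by
  by_contra! hcon
  have hact := Cycle.isActive_congr hG h h' he
  have he' : S' ∩ cell G (.inr C) ⊆ S := he ▸ Finset.inter_subset_left
  refine hS' (hS.transfer hG hact (fun v hv hna l hl => ?_) fun v l hcrit hl => ?_)
  · exact hl.of_inter_subset hG he' hv fun hb => hna (hb.isActive hG h.2 h.1.isWeaklyBiactive)
  · by_cases hb : C.IsBranchActive v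
    · by_contra! hno
      exact (hcon v (hcrit.congr hact)).not_gt (demand_lt_card hG hb hl.1 hno)
    · exact ⟨l, hl.of_inter_subset hG he' hcrit.mem_verts hb⟩

theorem IsSmallestBBR.containsConfig_congr (hG : IsCactus G) (h : IsSmallestBBR G S)
    (h' : IsSmallestBBR G S') (he : S ∩ cell G (.inr C) = S' ∩ cell G (.inr C))
    (hS : C.ContainsConfig κ S) : C.ContainsConfig κ S' := by
  by_contra hS'
  obtain ⟨v, -, hv⟩ := hS.exists_isCritical hG h.1 h'.1 he hS'
  exact hv.ne (h'.card_inter_cell hG _).symm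

end Cells

section Nice

variable {V : Type*} [Fintype V] {G : SimpleGraph V} [DecidableRel G.Adj] {C D : Cycle G}
  {S T : Finset V} {κ : Kind} {v : V}

theorem exists_avoidsConfigs (hG : IsCactus G) (κ : Kind) : ∃ S, AvoidsConfigs G κ S := by
  classical
  obtain ⟨S₀, hS₀⟩ := exists_isSmallestBBR hG
  have hF : ∀ i : V ⊕ Cycle G, ∃ S, IsSmallestBBR G S ∧
      ∀ C, i = .inr C → C.IsNegative κ → ¬ C.ContainsConfig κ S := by
    rintro (v | C)
    · exact ⟨S₀, hS₀, by simp⟩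
    · by_cases hC : C.IsNegative κ
      · obtain ⟨S, hS, hSC⟩ := hC
        exact ⟨S, hS, fun D hD _ => Sum.inr_injective hD ▸ hSC⟩
      · exact ⟨S₀, hS₀, fun D hD hD' => absurd (Sum.inr_injective hD ▸ hD') hC⟩
  choose F hF hFC using hF
  obtain ⟨S, hS, hSF⟩ := IsSmallestBBR.exists_splice hG hF
  exact ⟨S, hS, fun C hC hconf => hFC (.inr C) C rfl hC
    (hS.containsConfig_congr hG (hF _) (hSF _) hconf)⟩

theorem exists_isNice (hG : IsCactus G) (κ : Kind) : ∃ S, IsNice G κ S := by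
  obtain ⟨S, hS, hmin⟩ := Set.exists_min_image {S | AvoidsConfigs G κ S}
    (fun S => (criticalGraph G κ S).edgeSet.ncard) (Set.toFinite _) (exists_avoidsConfigs hG κ)
  exact ⟨S, hS, hmin⟩

theorem AvoidsConfigs.exists_replace (hG : IsCactus G) (hS : AvoidsConfigs G κ S)
    (hT : IsSmallestBBR G T) (hTC : ¬ C.ContainsConfig κ T) :
    ∃ S₁, AvoidsConfigs G κ S₁ ∧ (∀ v, C.IsActive S₁ v ↔ C.IsActive T v) ∧
      ∀ E ≠ C, ∀ v, E.IsActive S₁ v ↔ E.IsActive S v := by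
  classical
  obtain ⟨S₁, hS₁, hcell⟩ := IsSmallestBBR.exists_splice hG
    (F := fun i => if i = .inr C then T else S) fun i => by split_ifs; exacts [hT, hS.1]
  have hcellC : S₁ ∩ cell G (.inr C) = T ∩ cell G (.inr C) := by
    simpa only [if_true] using hcell (.inr C)
  have hcellE : ∀ E ≠ C, S₁ ∩ cell G (.inr E) = S ∩ cell G (.inr E) := fun E hE => by
    simpa only [Sum.inr.injEq, hE, if_false] using hcell (.inr E)
  refine ⟨S₁, ⟨hS₁, fun E hE hconf => ?_⟩, Cycle.isActive_congr hG hS₁.1 hT.1 hcellC,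
    fun E hEC => Cycle.isActive_congr hG hS₁.1 hS.1.1 (hcellE E hEC)⟩
  by_cases hEC : E = C
  · subst hEC
    exact hTC (hS₁.containsConfig_congr hG hT hcellC hconf)
  · exact hS.2 E hE (hS₁.containsConfig_congr hG hS.1 (hcellE E hEC) hconf)

theorem IsSmallestBBR.isActive_congr (hG : IsCactus G) (hS : IsSmallestBBR G S)
    (hT : IsSmallestBBR G T) (hC : 2 ≤ C.numBranchActive) (v : V) :
    C.IsActive S v ↔ C.IsActive T v := by
  classical
  have hempty : ∀ {S}, IsSmallestBBR G S → S ∩ cell G (.inr C) = ∅ := fun hS => by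
    rw [← Finset.card_eq_zero, hS.card_inter_cell hG, demand, Nat.sub_eq_zero_of_le hC]
  exact Cycle.isActive_congr hG hS.1 hT.1 ((hempty hS).trans (hempty hT).symm) v

theorem IsCactus.two_le_numBranchActive (hG : IsCactus G) {E : Cycle G} (hCD : C ≠ D)
    (hCE : C ≠ E) {w : V} (hvC : v ∈ C.1.verts) (hvD : v ∈ D.1.verts) (hwC : w ∈ C.1.verts)
    (hwE : w ∈ E.1.verts) (hvw : v ≠ w) : 2 ≤ C.numBranchActive := by
  rw [← Set.ncard_pair hvw]
  refine Set.ncard_le_ncard ?_ (Set.toFinite _)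
  rintro u (rfl | rfl)
  · exact hG.isBranchActive_of_mem hCD hvC hvD
  · exact hG.isBranchActive_of_mem hCE hwC hwE

end Nice

section Graph

variable {V : Type*} {G : SimpleGraph V} {C D : Cycle G} {S S₁ : Finset V} {κ : Kind}

theorem criticalGraph_lt (hact : ∀ E ≠ C, ∀ v, E.IsActive S₁ v ↔ E.IsActive S v)
    (hno : ∀ E, ¬ (criticalGraph G κ S₁).Adj C E) (hCD : (criticalGraph G κ S).Adj C D) :
    criticalGraph G κ S₁ < criticalGraph G κ S := by
  refine lt_of_le_of_ne ?_ fun h => hno D (h ▸ hCD)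
  intro E F hEF
  have hEC : E ≠ C := by rintro rfl; exact hno _ hEF
  have hFC : F ≠ C := by rintro rfl; exact hno _ hEF.symm
  obtain ⟨hne, w, hE, hF⟩ := hEF
  exact ⟨hne, w, hE.congr (hact E hEC), hF.congr (hact F hFC)⟩

end Graph

section VertexCover

variable {V : Type*} [Fintype V] {G : SimpleGraph V} [DecidableRel G.Adj] {C D : Cycle G}
  {S S₀ T : Finset V} {κ : Kind} {v : V}

/-- A critical incidence with respect to a nice set cannot be avoided by any smallest set without
configurations on the cycle: adopting that set on the cycle would save an incident pair. -/
theorem IsNice.isCritical_of_isCritical (hG : IsCactus G) (hS : IsNice G κ S)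
    (hT : IsSmallestBBR G T) (hTC : ¬ C.ContainsConfig κ T) (hCD : C ≠ D)
    (hC : C.IsCritical κ S v) (hD : D.IsCritical κ S v) : C.IsCritical κ T v := by
  by_contra hcrit
  obtain ⟨S₁, hS₁, hactC, hactE⟩ := hS.1.exists_replace hG hT hTC
  have hno : ∀ E, ¬ (criticalGraph G κ S₁).Adj C E := by
    rintro E ⟨hCE, w, hw, hw'⟩
    have hvw : v ≠ w := by
      rintro rfl
      exact hcrit (hw.congr hactC)
    have htwo := hG.two_le_numBranchActive hCD hCE hC.mem_verts hD.mem_verts hw.mem_verts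
      hw'.mem_verts hvw
    exact hcrit (hC.congr (hS.1.1.isActive_congr hG hT htwo))
  have hlt := edgeSet_ssubset_edgeSet.2 (criticalGraph_lt hactE hno ⟨hCD, v, hC, hD⟩)
  exact (hS.2 S₁ hS₁).not_gt (Set.ncard_lt_ncard hlt (Set.toFinite _))

/-- The cells in which `S` has more elements than needed. -/
noncomputable def excessCells [DecidableEq V] (G : SimpleGraph V) [DecidableRel G.Adj]
    (S : Finset V) : Finset (V ⊕ Cycle G) :=
  {i | demand G i < (S ∩ cell G i).card}

theorem mem_excessCells [DecidableEq V] {i : V ⊕ Cycle G} :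
    i ∈ excessCells G S ↔ demand G i < (S ∩ cell G i).card := by
  simp [excessCells]

theorem sum_demand_add_card_excessCells_le [DecidableEq V] (hG : IsCactus G)
    (hS : ∀ i, IsSufficient G S i) : ∑ i, demand G i + (excessCells G S).card ≤ S.card := by
  refine le_trans ?_ (sum_card_inter_cell_le hG S)
  rw [excessCells, Finset.card_filter, ← Finset.sum_add_distrib]
  refine Finset.sum_le_sum fun i _ => ?_
  have := (hS i).demand_le_card hG
  split_ifs <;> omega

theorem IsSmallestBBR.inter_cell_eq [DecidableEq V] (hG : IsCactus G) (hT : IsSmallestBBR G T)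
    (hTS : T ⊆ S) {i : V ⊕ Cycle G} (hi : i ∉ excessCells G S) : T ∩ cell G i = S ∩ cell G i := by
  refine Finset.eq_of_subset_of_card_le (Finset.inter_subset_inter_right hTS) ?_
  rw [hT.card_inter_cell hG]
  exact not_lt.1 fun h => hi (mem_excessCells.2 h)

theorem IsGood.ncard_le_card_excessCells [DecidableEq V] (hG : IsCactus G) (hS : IsGood G κ S)
    (hT : IsSmallestBBR G T) (hTS : T ⊆ S) :
    {C : Cycle G | .inr C ∈ excessCells G S ∨ C.ContainsConfig κ T}.ncard
      ≤ (excessCells G S).card := by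
  set Z := {C : Cycle G | .inr C ∈ excessCells G S ∨ C.ContainsConfig κ T}
  have hcell : ∀ C ∈ Z, ∃ i ∈ excessCells G S,
      i = .inr C ∨ ∃ v, i = .inl v ∧ C.IsCritical κ S v := by
    intro C hC
    by_cases hCS : .inr C ∈ excessCells G S
    · exact ⟨_, hCS, .inl rfl⟩
    · obtain ⟨v, hv, hv'⟩ := (hC.resolve_left hCS).exists_isCritical hG hT.1 hS.1
        (hT.inter_cell_eq hG hTS hCS) (hS.2.1 C)
      exact ⟨_, mem_excessCells.2 hv', .inr ⟨v, rfl, hv⟩⟩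
  obtain ⟨v₀⟩ := hG.1.nonempty
  have : Nonempty (V ⊕ Cycle G) := ⟨.inl v₀⟩
  choose! f hfS hf using hcell
  rw [← Set.ncard_coe_finset]
  refine Set.ncard_le_ncard_of_injOn f hfS fun C hC D hD hCD => ?_
  rcases hf C hC with hC' | ⟨v, hC', hv⟩ <;> rcases hf D hD with hD' | ⟨w, hD', hw⟩ <;>
    rw [hCD, hD'] at hC' <;> cases hC'
  · rfl
  · by_contra hne
    exact hS.2.2 C D ⟨hne, _, hv, hw⟩

theorem IsNice.exists_isVertexCover (hG : IsCactus G) (h₀ : IsNice G κ S₀) (hS : IsGood G κ S) :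
    ∃ X : Set (Cycle G), (incidentGraph G κ S₀).IsVertexCover X ∧
      surplusThreads G + missingBranchActive G + numPositive G κ + X.ncard ≤ S.card := by
  classical
  obtain ⟨T, hTS, hT⟩ := exists_isSmallestBBR_subset hG hS.1
  set Z := {C : Cycle G | .inr C ∈ excessCells G S ∨ C.ContainsConfig κ T} with hZ
  have hpos : {C : Cycle G | ¬ C.IsNegative κ} ⊆ Z := fun C hC => by
    by_contra h
    exact hC ⟨T, hT, fun hconf => h (.inr hconf)⟩
  have hcrit : ∀ {C D : Cycle G} {v : V}, C ∉ Z → C ≠ D → C.IsCritical κ S₀ v →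
      D.IsCritical κ S₀ v → C.IsCritical κ S v := fun {C D v} hC hne hv hv' => by
    obtain ⟨hCS, hCT⟩ := not_or.1 hC
    exact (h₀.isCritical_of_isCritical hG hT hCT hne hv hv').congr
      (Cycle.isActive_congr hG hT.1 hS.1 (hT.inter_cell_eq hG hTS hCS))
  refine ⟨Z \ {C | ¬ C.IsNegative κ}, ?_, ?_⟩
  · rintro C D ⟨hC, hD, hne, v, hCv, hDv⟩
    by_contra! hcon
    have hout : ∀ {C : Cycle G}, C.IsNegative κ → C ∉ Z \ {C | ¬ C.IsNegative κ} → C ∉ Z :=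
      fun hneg h hCZ => h ⟨hCZ, not_not_intro hneg⟩
    exact hS.2.2 C D ⟨hne, v, hcrit (hout hC hcon.1) hne hCv hDv,
      hcrit (hout hD hcon.2) hne.symm hDv hCv⟩
  · have hdiff := Set.ncard_sdiff_add_ncard_of_subset hpos (Set.toFinite _)
    have hle := hS.ncard_le_card_excessCells hG hT hTS
    have hcard := sum_demand_add_card_excessCells_le hG
      ((isBiactive_and_isBranchResolving_iff hG).1 hS.1)
    rw [sum_demand] at hcard
    rw [← hZ] at hle
    rw [numPositive]
    omega

end VertexCover

section Augmentation

variable {V : Type*} {G : SimpleGraph V}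

theorem IsBiactive.exists_superset_hasGeodesicTriple (hG : IsCactus G) {S₀ : Finset V}
    (h₀ : IsBiactive G S₀) (Z : Finset (Cycle G)) :
    ∃ S, S₀ ⊆ S ∧ S.card ≤ S₀.card + Z.card ∧ (∀ C ∈ Z, C.HasGeodesicTriple S) ∧
      ∀ C ∉ Z, ∀ v, C.IsActive S v ↔ C.IsActive S₀ v := by
  classical
  choose w hw hwt using fun C : Cycle G => Cycle.exists_hasGeodesicTriple_insert (h₀ C)
  have hsub : S₀ ⊆ S₀ ∪ Z.image w := Finset.subset_union_left
  refine ⟨S₀ ∪ Z.image w, hsub, ?_, fun C hC => ?_, fun C hC v => ⟨fun hv => ?_, (·.mono hsub)⟩⟩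
  · exact (Finset.card_union_le _ _).trans (Nat.add_le_add_left Finset.card_image_le _)
  · exact (hwt C).mono (Finset.insert_subset
      (Finset.mem_union_right _ (Finset.mem_image_of_mem w hC)) hsub)
  · obtain ⟨s, hs, rfl⟩ := hG.isActive_iff.1 hv
    rcases Finset.mem_union.1 hs with hs | hs
    · exact hG.isActive_iff.2 ⟨s, hs, rfl⟩
    · obtain ⟨D, hD, rfl⟩ := Finset.mem_image.1 hs
      exact hG.isActive_root (C := C) (D := D) (fun e => hC (e ▸ hD)) (h₀ D) (hw D)

variable [Fintype V] [DecidableRel G.Adj] {S₀ : Finset V} {κ : Kind}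

theorem AvoidsConfigs.exists_isGood (hG : IsCactus G) (h₀ : AvoidsConfigs G κ S₀)
    {X : Set (Cycle G)} (hX : (incidentGraph G κ S₀).IsVertexCover X) : ∃ S, IsGood G κ S ∧
      S.card ≤ surplusThreads G + missingBranchActive G + numPositive G κ + X.ncard := by
  classical
  let Z : Finset (Cycle G) := {C | C ∈ X ∨ ¬ C.IsNegative κ}
  have hmem : ∀ C, C ∉ Z ↔ C ∉ X ∧ C.IsNegative κ := by simp [Z]
  obtain ⟨S, hsub, hcard, htriple, hact⟩ := h₀.1.1.1.exists_superset_hasGeodesicTriple hG Z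
  have hsuff := (isBiactive_and_isBranchResolving_iff hG).1 h₀.1.1
  refine ⟨S, ⟨(isBiactive_and_isBranchResolving_iff hG).2 fun i => (hsuff i).mono hsub,
    fun C hconf => ?_, ?_⟩, ?_⟩
  · by_cases hC : C ∈ Z
    · exact (htriple C hC).not_containsConfig hG hconf
    · exact h₀.2 C ((hmem C).1 hC).2 (hconf.transfer hG (hact C hC)
        (fun v _ _ l hl => hl.anti hsub) fun v l _ hl => ⟨l, hl.anti hsub⟩)
  · rintro C D ⟨hne, v, hC, hD⟩
    have hCZ : C ∉ Z := fun h => (htriple C h).not_isCritical hG v hC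
    have hDZ : D ∉ Z := fun h => (htriple D h).not_isCritical hG v hD
    have hadj : (incidentGraph G κ S₀).Adj C D := ⟨((hmem C).1 hCZ).2, ((hmem D).1 hDZ).2, hne, v,
      hC.congr (hact C hCZ), hD.congr (hact D hDZ)⟩
    exact (hX hadj).elim ((hmem C).1 hCZ).1 ((hmem D).1 hDZ).1
  · have hZ : Z.card ≤ X.ncard + numPositive G κ := by
      have hcoe : (Z : Set (Cycle G)) = X ∪ {C | ¬ C.IsNegative κ} := by ext C; simp [Z]
      rw [← Set.ncard_coe_finset, hcoe]
      exact Set.ncard_union_le _ _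
    have := h₀.1.card_eq hG
    omega

theorem sInf_card_isGenerator (hG : IsCactus G) (hgen : ∀ S, IsGenerator G κ S ↔ IsGood G κ S)
    (h₀ : IsNice G κ S₀) :
    ((sInf {n | ∃ S : Finset V, IsGenerator G κ S ∧ S.card = n} : ℕ) : ℕ∞) =
      surplusThreads G + missingBranchActive G + numPositive G κ
        + (incidentGraph G κ S₀).vertexCoverNum := by
  obtain ⟨X, hXc, hX⟩ := vertexCoverNum_exists (incidentGraph G κ S₀)
  obtain ⟨S, hS, hSc⟩ := h₀.1.exists_isGood hG hX
  apply le_antisymm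
  · have hle : sInf {n | ∃ S : Finset V, IsGenerator G κ S ∧ S.card = n} ≤ S.card :=
      Nat.sInf_le ⟨S, (hgen S).2 hS, rfl⟩
    rw [← hXc, ← (Set.toFinite X).cast_ncard_eq]
    exact_mod_cast hle.trans hSc
  · obtain ⟨T, hT, hTc⟩ := Nat.sInf_mem
      (s := {n | ∃ S : Finset V, IsGenerator G κ S ∧ S.card = n}) ⟨_, S, (hgen S).2 hS, rfl⟩
    obtain ⟨Y, hY, hYc⟩ := h₀.exists_isVertexCover hG ((hgen T).1 hT)
    refine (add_le_add_right hY.vertexCoverNum_le _).trans ?_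
    rw [← hTc, ← (Set.toFinite Y).cast_ncard_eq]
    exact_mod_cast hYc

end Augmentation

end Cactus

theorem theorem4 {V : Type*} [Fintype V] (G : SimpleGraph V) [DecidableRel G.Adj]
    (hG : Cactus.IsCactus G) :
    (∃ S, Cactus.IsNice G .vertex S) ∧
    (∃ S, Cactus.IsNice G .edge S) ∧
    ((∀ n, 2 ≤ n → IsEmpty (G ≃g SimpleGraph.pathGraph n)) →
      ∀ S, Cactus.IsNice G .vertex S →
        (Cactus.dim G : ℕ∞) =
          Cactus.surplusThreads G + Cactus.missingBranchActive G + Cactus.numPositive G .vertex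
            + (Cactus.incidentGraph G .vertex S).vertexCoverNum) ∧
    ((∀ n, 3 ≤ n → IsEmpty (G ≃g SimpleGraph.pathGraph n)) →
      ∀ S, Cactus.IsNice G .edge S →
        (Cactus.edim G : ℕ∞) =
          Cactus.surplusThreads G + Cactus.missingBranchActive G + Cactus.numPositive G .edge
            + (Cactus.incidentGraph G .edge S).vertexCoverNum) := by
  refine ⟨Cactus.exists_isNice hG _, Cactus.exists_isNice hG _, fun hpath S hS => ?_,
    fun hpath S hS => ?_⟩
  · exact Cactus.sInf_card_isGenerator hG
      (fun T => ⟨fun h => h.isGood hG, fun h => h.isVertexGenerator hG hpath⟩) hS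
  · exact Cactus.sInf_card_isGenerator hG
      (fun T => ⟨fun h => h.isGood hG, fun h => h.isEdgeGenerator hG hpath⟩) hS
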